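/- Let $(\mathcal M,g)$ be a connected, time-oriented four-dimensional spacetime with $C^{1,1}$ metric of signature $(-,+,+,+)$ that is asymptotically flat at future null infinity $\mathscr I^+$ in the following sense: there are $R_0>0$ and Bondi coordinates $(u,r,x^I)$, ranging over $\mathbb R\times(R_0,\infty)\times S^2$, on an open subset of $\mathcal M$, in which $\partial_u$ is future directed for large $r$, $g_{rr}=g_{rI}=0$, $$g_{uu}=-1+m\,r^{-1}+O(r^{-2}),\quad g_{ur}=-1+O(r^{-2}),\quad g_{uI}=O(r^{0}),\quad g_{IJ}=h_{IJ}r^2=\omega_{IJ}r^2+h^{(1)}_{IJ}\,r+O(r^0),$$ and $\sqrt{\det h_{IJ}}=\omega_2$. Here $\omega_{IJ}$ is the metric of the unit two-sphere, $\omega_2$ its volume element, and $m=m(u,x)$ and $h^{(1)}_{IJ}=h^{(1)}_{IJ}(u,x)$ are $O(r^0)$. The notation $f=O(r^{k})$ means that, as $r\to\infty$, uniformly in $u\in\mathbb R$ and in the angles, $f$, $\partial_u f$ and $\partial_I f$ are bounded by a constant times $r^{k}$ and $\partial_r f$ by a constant times $r^{k-1}$ (with angular components and derivatives measured with respect to $\omega$).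 A curve reaches $\mathscr I^+$ if along it $r\to\infty$ while $u$ tends to a finite value. Put $$\Omega_{IJ}=\omega_{IJ}-\tfrac12\,\partial_u h^{(1)}_{IJ}+\tfrac12\,(\partial_u m)\,\omega_{IJ},\qquad \Omega_i=\inf_{u,\;x,\;w\ne0}\frac{\Omega_{IJ}(u,x)\,w^Iw^J}{\omega_{IJ}(x)\,w^Iw^J},$$ the infimum being over $u\in\mathbb R$, $x\in S^2$ and nonzero vectors $w$ tangent to $S^2$ at $x$, and assume $\Omega_i>0$. Assume that $\mathcal M$ contains black hole(s), i.e. that some point of $\mathcal M$ does not lie in the causal past of $\mathscr I^+$ (the set of points from which a future-directed causal curve reaches $\mathscr I^+$). Let $T^\mu$ be a unit timelike vector field on $\mathcal M$ ($T^\mu T_\mu=-1$) with $T^\mu\propto d(u+r)^\mu$ for all sufficiently large $r$. The inner dark domain (IDD) associated with $T^\mu$ is the set of all points $p$ for which there is a spacelike vector $n^\mu$ at $p$, orthogonal to $T^\mu$, such that no future-directed null geodesic emanating from $p$ whose tangent vector at $p$ is orthogonal to $n^\mu$ reaches $\mathscr I^+$. The inner dark horizon (IDH) associated with $T^\mu$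 is the topological boundary of the IDD in $\mathcal M$. Then the IDH associated with $T^\mu$ is not empty, and it is not connected to future null infinity: there is $R$ such that no point of the Bondi coordinate domain with $r>R$ belongs to the IDH. -/

import Mathlib

open Filter Topology Set
open scoped Manifold ContDiff

noncomputable section

namespace DarkHorizon

/-- Euclidean three-space. -/
abbrev E3 := EuclideanSpace ℝ (Fin 3)

/-- The model space `ℝ⁴`, split as `ℝ × ℝ³`. -/
abbrev E4 := ℝ × E3

section Spacetimes

variable (M : Type*) [TopologicalSpace M] [ChartedSpace E4 M]

/-- A tensor field of type `(0,2)` on `M`, without any regularity. -/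
abbrev BilinField :=
  ∀ p : M, TangentSpace 𝓘(ℝ, E4) p →L[ℝ] TangentSpace 𝓘(ℝ, E4) p →L[ℝ] ℝ

variable {M}

/-- The component `g(v, w)` of `g` in the chart `e`, at the point with coordinates `z`, where `v`
and `w` are coordinate vectors. -/
def comp (g : BilinField M) (e : OpenPartialHomeomorph M E4) (z v w : E4) : ℝ :=
  g (e.symm z) (mfderiv 𝓘(ℝ, E4) 𝓘(ℝ, E4) e.symm z v) (mfderiv 𝓘(ℝ, E4) 𝓘(ℝ, E4) e.symm z w)

/-- Christoffel symbol of the first kind, contracted with coordinate vectors: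
`Γ_{kij} wᵏ vⁱ v'ʲ = ½ (∂_v g(v', w) + ∂_{v'} g(v, w) - ∂_w g(v, v'))`. -/
def christoffel (g : BilinField M) (e : OpenPartialHomeomorph M E4) (z v v' w : E4) : ℝ :=
  (1 / 2 : ℝ) * (fderiv ℝ (fun z' => comp g e z' v' w) z v
    + fderiv ℝ (fun z' => comp g e z' v w) z v'
    - fderiv ℝ (fun z' => comp g e z' v v') z w)

variable (M)

/-- A time-oriented four-dimensional Lorentzian manifold with metric of class `C^{1,1}` and
signature `(-,+,+,+)`. -/
structure Spacetime [IsManifold 𝓘(ℝ, E4) 3 M] where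
  /-- the metric -/
  metric : BilinField M
  symm : ∀ p v w, metric p v w = metric p w v
  /-- there is a timelike vector on whose orthogonal complement the metric is positive definite -/
  lorentzian : ∀ p, ∃ v, metric p v v < 0 ∧ ∀ w, metric p v w = 0 → w ≠ 0 → 0 < metric p w w
  /-- in every chart the metric components are `C¹` with locally Lipschitz derivative -/
  regular : ∀ e ∈ IsManifold.maximalAtlas 𝓘(ℝ, E4) 3 M, ∀ v w : E4,
    ContDiffOn ℝ 1 (fun z => comp metric e z v w) e.target ∧
    LocallyLipschitzOn e.target (fderiv ℝ (fun z => comp metric e z v w))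
  /-- a continuous timelike vector field, which is future directed by convention -/
  timeOrientation : ∀ p : M, TangentSpace 𝓘(ℝ, E4) p
  timeOrientation_continuous :
    Continuous fun p => (⟨p, timeOrientation p⟩ : TangentBundle 𝓘(ℝ, E4) M)
  timeOrientation_timelike : ∀ p, metric p (timeOrientation p) (timeOrientation p) < 0

variable {M} [IsManifold 𝓘(ℝ, E4) 3 M]

/-- The velocity of a curve. -/
def velocity (γ : ℝ → M) (t : ℝ) : TangentSpace 𝓘(ℝ, E4) (γ t) :=
  mfderiv 𝓘(ℝ, ℝ) 𝓘(ℝ, E4) γ t (1 : ℝ)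

/-- The parameter interval `(a, b)`, where `b` may be `∞`. -/
def paramInterval (a : ℝ) (b : EReal) : Set ℝ := {t | a < t ∧ (t : EReal) < b}

/-- The filter of parameters tending to `b` from below (`atTop` if `b = ∞`). -/
def upperEnd (b : EReal) : Filter ℝ := comap (fun t : ℝ => (t : EReal)) (𝓝[<] b)

namespace Spacetime

variable (X : Spacetime M)

/-- Future-directed causal (timelike or null) vectors; they are nonzero. -/
def IsFutureCausal (p : M) (k : TangentSpace 𝓘(ℝ, E4) p) : Prop :=
  X.metric p k k ≤ 0 ∧ X.metric p (X.timeOrientation p) k < 0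

/-- Future-directed null vectors; they are nonzero. -/
def IsFutureNull (p : M) (k : TangentSpace 𝓘(ℝ, E4) p) : Prop :=
  X.metric p k k = 0 ∧ X.metric p (X.timeOrientation p) k < 0

/-- `γ` is on `(a, b)` a future-directed causal `C¹` curve. -/
def IsFutureCausalCurve (γ : ℝ → M) (a : ℝ) (b : EReal) : Prop :=
  ContMDiffOn 𝓘(ℝ, ℝ) 𝓘(ℝ, E4) 1 γ (paramInterval a b) ∧
  ∀ t ∈ paramInterval a b, X.IsFutureCausal (γ t) (velocity γ t)

/-- `γ` is an affinely parametrized geodesic near `t`: it is continuous at `t` and, in some chart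
around `γ t`, its coordinate expression `x` satisfies near `t` the equation
`g_{ki} x''ⁱ + Γ_{kij} x'ⁱ x'ʲ = 0`. (The equation is independent of the chart, and `g` is
nondegenerate, so that this is the usual equation `x''ᵏ + Γᵏ_{ij} x'ⁱ x'ʲ = 0`.) -/
def IsGeodesicNear (γ : ℝ → M) (t : ℝ) : Prop :=
  ContinuousAt γ t ∧
  ∃ e ∈ IsManifold.maximalAtlas 𝓘(ℝ, E4) 3 M, ∀ᶠ s in 𝓝 t, γ s ∈ e.source ∧
    DifferentiableAt ℝ (e ∘ γ) s ∧ DifferentiableAt ℝ (deriv (e ∘ γ)) s ∧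
    ∀ w : E4, comp X.metric e (e (γ s)) (deriv (deriv (e ∘ γ)) s) w +
      christoffel X.metric e (e (γ s)) (deriv (e ∘ γ) s) (deriv (e ∘ γ) s) w = 0

/-- `γ` is on `(a, b)` a future-directed null geodesic. -/
def IsFutureNullGeodesic (γ : ℝ → M) (a : ℝ) (b : EReal) : Prop :=
  ∀ t ∈ paramInterval a b, X.IsGeodesicNear γ t ∧ X.IsFutureNull (γ t) (velocity γ t)

/-- `T` is a unit timelike vector field. -/
def IsUnitTimelike (T : ∀ p : M, TangentSpace 𝓘(ℝ, E4) p) : Prop :=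
  ∀ p, X.metric p (T p) (T p) = -1

end Spacetime

end Spacetimes

/-! ### Bondi coordinates

Bondi coordinates `(u, r, xᴵ)` with values in `ℝ × (R₀, ∞) × S²` are written as
`(u, y)` with `y = r x ∈ ℝ³`, `|y| > R₀`, so that `r = |y|` and `x = y / |y|`. -/

/-- The point `x = y / |y|` of the unit sphere. -/
def dir (y : E3) : E3 := ‖y‖⁻¹ • y

/-- The part of `v` tangent to the unit sphere at `dir y`. -/
def tang (y v : E3) : E3 := v - inner ℝ (dir y) v • dir y

/-- The coordinate vector `∂_u`. -/
def dU : E4 := (1, 0)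

/-- The coordinate vector `∂_r` at `y`. -/
def dR (y : E3) : E4 := (0, dir y)

/-- The angular coordinate vector at `y = r x` given by (the tangential part of) `v`: moving `x`
with velocity `tang y v` at fixed `u` and `r` moves `y` with velocity `r • tang y v`. -/
def dA (y v : E3) : E4 := (0, ‖y‖ • tang y v)

/-- `f = O(r^k)` as `r → ∞`, uniformly in `u` and in the angles, in the sense of an expansion that
may be differentiated once: `f` and `∂_u f` are `O(r^k)`, and the derivatives in the directions of
`y` are `O(r^(k-1))`, that is `∂_r f = O(r^(k-1))` and `∂_I f = O(r^k)`. -/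
def IsBondiO (k : ℤ) (f : E4 → ℝ) : Prop :=
  ∃ C R : ℝ, ∀ (u : ℝ) (y : E3), R < ‖y‖ →
    DifferentiableAt ℝ f (u, y) ∧
    |f (u, y)| ≤ C * ‖y‖ ^ k ∧
    |fderiv ℝ f (u, y) dU| ≤ C * ‖y‖ ^ k ∧
    ∀ v : E3, |fderiv ℝ f (u, y) (0, v)| ≤ C * ‖y‖ ^ (k - 1) * ‖v‖

/-- The quotient `Ω_{IJ} wᴵ wᴶ / (ω_{IJ} wᴵ wᴶ)`, where
`Ω_{IJ} = ω_{IJ} - ½ ∂_u h⁽¹⁾_{IJ} + ½ (∂_u m) ω_{IJ}`, at `(u, x)` and for `w` tangent to the unit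
sphere at `x`. -/
def Omega (m : ℝ → E3 → ℝ) (h₁ : ℝ → E3 → E3 →L[ℝ] E3 →L[ℝ] ℝ) (u : ℝ) (x w : E3) : ℝ :=
  (inner ℝ w w)⁻¹ * (inner ℝ w w - (1 / 2 : ℝ) * deriv (fun s => h₁ s x w w) u
    + (1 / 2 : ℝ) * deriv (fun s => m s x) u * inner ℝ w w)

section Asymptotics

variable {M : Type*} [TopologicalSpace M] [ChartedSpace E4 M] [IsManifold 𝓘(ℝ, E4) 3 M]

/-- Bondi coordinates near future null infinity: the spacetime is asymptotically flat at future
null infinity, which is the sphere bundle `ℝ × S²` at `r = ∞`. -/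
structure BondiChart (X : Spacetime M) where
  /-- the coordinates `(u, y)` -/
  chart : OpenPartialHomeomorph M E4
  chart_mem : chart ∈ IsManifold.maximalAtlas 𝓘(ℝ, E4) 3 M
  /-- the coordinates cover all `u ∈ ℝ`, `r > R₀` and all angles -/
  R₀ : ℝ
  R₀_pos : 0 < R₀
  mem_target : ∀ (u : ℝ) (y : E3), R₀ < ‖y‖ → (u, y) ∈ chart.target
  /-- the mass aspect `m(u, x)`; only its values for `x` in the unit sphere matter -/
  m : ℝ → E3 → ℝ
  /-- the form `h⁽¹⁾_{IJ}(u, x)`; only its values for `x` in the unit sphere and on vectors tangent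
  to the sphere at `x` matter -/
  h₁ : ℝ → E3 → E3 →L[ℝ] E3 →L[ℝ] ℝ
  m_bounded : IsBondiO 0 fun z => m z.1 (dir z.2)
  h₁_bounded : ∀ v w : E3,
    IsBondiO 0 fun z => h₁ z.1 (dir z.2) (tang z.2 v) (tang z.2 w)
  /-- `g_{rr} = 0` -/
  metric_rr : ∀ (u : ℝ) (y : E3), R₀ < ‖y‖ → comp X.metric chart (u, y) (dR y) (dR y) = 0
  /-- `g_{rI} = 0` -/
  metric_rI : ∀ (u : ℝ) (y v : E3), R₀ < ‖y‖ →
    comp X.metric chart (u, y) (dR y) (dA y v) = 0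
  /-- `√(det h_{IJ})` is the volume element of the unit sphere, where `g_{IJ} = r² h_{IJ}` -/
  gauge : ∀ (u : ℝ) (y v w : E3), R₀ < ‖y‖ → ‖v‖ = 1 → ‖w‖ = 1 → inner ℝ v w = 0 →
    inner ℝ y v = 0 → inner ℝ y w = 0 →
    comp X.metric chart (u, y) (dA y v) (dA y v) * comp X.metric chart (u, y) (dA y w) (dA y w)
      - comp X.metric chart (u, y) (dA y v) (dA y w) ^ 2 = ‖y‖ ^ 4
  /-- `g_{uu} = -1 + m r⁻¹ + O(r⁻²)` -/
  metric_uu : IsBondiO (-2) fun z =>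
    comp X.metric chart z dU dU - (-1 + m z.1 (dir z.2) * ‖z.2‖⁻¹)
  /-- `g_{ur} = -1 + O(r⁻²)` -/
  metric_ur : IsBondiO (-2) fun z => comp X.metric chart z dU (dR z.2) - (-1)
  /-- `g_{uI} = O(r⁰)` -/
  metric_uI : ∀ v : E3, IsBondiO 0 fun z => comp X.metric chart z dU (dA z.2 v)
  /-- `g_{IJ} = ω_{IJ} r² + h⁽¹⁾_{IJ} r + O(r⁰)` -/
  metric_IJ : ∀ v w : E3, IsBondiO 0 fun z =>
    comp X.metric chart z (dA z.2 v) (dA z.2 w)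
      - (inner ℝ (tang z.2 v) (tang z.2 w) * ‖z.2‖ ^ 2
        + h₁ z.1 (dir z.2) (tang z.2 v) (tang z.2 w) * ‖z.2‖)
  /-- near null infinity `∂_u` points to the future -/
  future : ∃ R : ℝ, R₀ ≤ R ∧ ∀ (u : ℝ) (y : E3), R < ‖y‖ →
    X.metric (chart.symm (u, y)) (X.timeOrientation (chart.symm (u, y)))
      (mfderiv 𝓘(ℝ, E4) 𝓘(ℝ, E4) chart.symm (u, y) dU) < 0

namespace BondiChart

variable {X : Spacetime M} (B : BondiChart X)

/-- The retarded time. -/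
def u (p : M) : ℝ := (B.chart p).1

/-- The radial coordinate. -/
def r (p : M) : ℝ := ‖(B.chart p).2‖

/-- The part `r > R` of the domain of the Bondi coordinates. -/
def region (R : ℝ) : Set M := {p | p ∈ B.chart.source ∧ B.R₀ < B.r p ∧ R < B.r p}

/-- `Ω_i`, the infimum of `Ω` over all `u ∈ ℝ`, all points `x` of the unit sphere and all nonzero
tangent vectors at `x`. -/
def OmegaInf : ℝ :=
  sInf {c | ∃ (u : ℝ) (x w : E3), ‖x‖ = 1 ∧ w ≠ 0 ∧ inner ℝ x w = 0 ∧ c = Omega B.m B.h₁ u x w}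

/-- The curve `γ` reaches future null infinity as its parameter tends to `b`: it ends up in the
domain of the Bondi coordinates, with `r → ∞` and `u` tending to a finite value. -/
def Reaches (γ : ℝ → M) (b : EReal) : Prop :=
  (∀ᶠ t in upperEnd b, γ t ∈ B.region B.R₀) ∧
  Tendsto (fun t => B.r (γ t)) (upperEnd b) atTop ∧
  ∃ u₁ : ℝ, Tendsto (fun t => B.u (γ t)) (upperEnd b) (𝓝 u₁)

/-- The causal past of future null infinity. -/
def causalPast : Set M :=
  {p | ∃ (γ : ℝ → M) (a : ℝ) (b : EReal), (0 : ℝ) ∈ paramInterval a b ∧ γ 0 = p ∧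
    X.IsFutureCausalCurve γ a b ∧ B.Reaches γ b}

/-- The black hole region: the complement of the causal past of future null infinity. -/
def blackHole : Set M := B.causalPastᶜ

/-- The inner dark domain associated with `T`: the points `p` with a spacelike vector `n`
orthogonal to `T` such that no future-directed null geodesic emanating from `p` with tangent
vector orthogonal to `n` at `p` reaches future null infinity. -/
def innerDarkDomain (T : ∀ p : M, TangentSpace 𝓘(ℝ, E4) p) : Set M :=
  {p | ∃ n : TangentSpace 𝓘(ℝ, E4) p, 0 < X.metric p n n ∧ X.metric p (T p) n = 0 ∧
    ∀ (k : TangentSpace 𝓘(ℝ, E4) p), X.metric p n k = 0 →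
      ∀ (γ : ℝ → M) (a : ℝ) (b : EReal), (0 : ℝ) ∈ paramInterval a b →
        X.IsFutureNullGeodesic γ a b →
        (⟨γ 0, velocity γ 0⟩ : TangentBundle 𝓘(ℝ, E4) M) = ⟨p, k⟩ → ¬ B.Reaches γ b}

/-- The inner dark horizon associated with `T`: the boundary of the inner dark domain. -/
def innerDarkHorizon (T : ∀ p : M, TangentSpace 𝓘(ℝ, E4) p) : Set M :=
  frontier (B.innerDarkDomain T)

/-- The one-form `d(u + r)`. -/
def dUR (p : M) (v : TangentSpace 𝓘(ℝ, E4) p) : ℝ :=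
  mfderiv 𝓘(ℝ, E4) 𝓘(ℝ, ℝ) (fun q => B.u q + B.r q) p v

/-- Near future null infinity, `T` is proportional to the vector metrically dual to
`d(u + r)`. -/
def IsAdapted (T : ∀ p : M, TangentSpace 𝓘(ℝ, E4) p) : Prop :=
  ∃ R : ℝ, ∀ p ∈ B.region R, ∃ c : ℝ, ∀ v : TangentSpace 𝓘(ℝ, E4) p,
    X.metric p (T p) v = c * B.dUR p v

/-- `A` is connected to future null infinity: it meets each of the neighbourhoods `r > R` of
future null infinity. -/
def ConnectedToScri (A : Set M) : Prop := ∀ R : ℝ, (A ∩ B.region R).Nonempty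

end BondiChart

end Asymptotics

end DarkHorizon

end

/-! A black hole point lies in the IDD of every unit timelike `T`: a future null geodesic is a
causal curve, so none from such a point reaches null infinity, whatever `n` is
(`blackHole_subset_innerDarkDomain`). In contrast, no point of large `r` lies in the IDD
(`exists_disjoint_region`). The IDD is therefore neither empty nor everything. Its boundary is
nonempty because `M` is connected, and it avoids the open set `r > R`, which is disjoint from the
IDD.

The substance is the claim about large `r`. Let `n` be orthogonal to `T` there. Some nonzero `η`
tangent to the coordinate sphere is orthogonal to `n`, and it is orthogonal to `T` because `d(u +
r)` annihilates it. Suitably scaled, `T + η` is null and orthogonal to `n`, and it is almost tangent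
to the sphere since `T` is almost parallel to `∂_u` (`exists_null`; if `T` points to the past, `-T`
takes its place). It remains to see that such geodesics escape (`exists_escaping_trajectory`).

Write `p = k^u`, `q = k^r`, `L` for the length of the angular part of the velocity `k`, and `π` for
the momentum conjugate to `y`. In Minkowski space `-π_r = p`, `|π|² = p² + L²` and `2pq = L² - p²`.
The ratio `S = |π|² / π_r²` equals 2 for tangential directions and satisfies `r p S' = S L²`. At
large `r` these relations persist up to errors of relative size 1/100 (`NullEstimates`). Two facts
make this possible. The evolution of `π` involves only the `y`-derivatives of the metric, whose
deviation from the flat ones is `O(r⁻²)`, and no `u`-derivatives, which are only known to be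
`O(r⁻¹)`. The gauge `g_rr = g_rI = 0` removes all terms quadratic in `q`, which `p² + L²` would not
control.

As long as `S ≥ 8/5`, the quantities `S`, `-π_r S²` and `log r - 2/S - (log S)/16` do not decrease,
and `-π_r` and `u + 4r/S` do not increase. So `u` is bounded above and `r` never falls below `e⁻²`
times its initial value. If `S` were bounded, position and velocity would stay in a compact set, the
geodesic would exist for all later parameters with `p` bounded below, and `u` would be unbounded.
Hence `S → ∞`, the logarithmic quantity forces `r → ∞`, and `u` converges, being monotone and
bounded. -/

set_option maxSynthPendingDepth 3

namespace DarkHorizon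

/-! ### Linear algebra of Lorentzian forms. -/

section

section LorentzianForms

variable {V : Type*} [AddCommGroup V] [Module ℝ V] [TopologicalSpace V]

/-- Symmetric bilinear forms of signature `(-,+,…,+)`. -/
structure IsLorentzian (g : V →L[ℝ] V →L[ℝ] ℝ) : Prop where
  symm : ∀ v w, g v w = g w v
  exists_timelike : ∃ v, g v v < 0 ∧ ∀ w, g v w = 0 → w ≠ 0 → 0 < g w w

namespace IsLorentzian

variable {g : V →L[ℝ] V →L[ℝ] ℝ}

/-- Coordinates adapted to a timelike vector. -/
theorem exists_splitting (hg : IsLorentzian g) :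
    ∃ (σ : ℝ) (t : V → ℝ) (s : V → V), 0 < σ ∧
      (∀ x y, g x y = -σ * t x * t y + g (s x) (s y)) ∧
      (∀ x, t x = 0 → s x = x) ∧ (∀ x, 0 ≤ g (s x) (s x)) ∧
      (∀ x, g (s x) (s x) = 0 → s x = 0) ∧
      ∀ x y, g (s x) (s y) ^ 2 ≤ g (s x) (s x) * g (s y) (s y) := by
  obtain ⟨v, hv, hpos⟩ := hg.exists_timelike
  have hne : g v v ≠ 0 := hv.ne
  set t : V → ℝ := fun x => g v x / g v v with ht
  set s : V → V := fun x => x - t x • v with hs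
  have horth : ∀ x, g v (s x) = 0 := fun x => by
    simp only [hs, ht, map_sub, map_smul, smul_eq_mul]
    field_simp
    ring
  have hnn : ∀ w, g v w = 0 → 0 ≤ g w w := fun w hw => by
    by_cases h : w = 0
    · simp [h]
    · exact (hpos w hw h).le
  refine ⟨-g v v, t, s, by linarith, fun x y => ?_, fun x hx => by simp [hs, hx],
    fun x => hnn _ (horth x), fun x hx => ?_, fun x y => ?_⟩
  · have h1 : g x v = t x * g v v := by rw [hg.symm x v]; simp only [ht]; field_simp
    have h2 : g v y = t y * g v v := by simp only [ht]; field_simp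
    simp only [hs, map_sub, map_smul, smul_eq_mul, sub_apply, smul_apply, h1, h2]
    ring
  · by_contra h
    exact (hpos _ (horth x) h).ne' hx
  · by_cases h : s y = 0
    · simp [h]
    have hy := hpos _ (horth y) h
    -- The usual proof of Cauchy–Schwarz: positivity on the component of `s x` orthogonal to `s y`,
    -- cleared of denominators.
    have h3 := hnn (g (s y) (s y) • s x - g (s x) (s y) • s y) (by
      simp [horth x, horth y])
    have h4 : g (g (s y) (s y) • s x - g (s x) (s y) • s y)
        (g (s y) (s y) • s x - g (s x) (s y) • s y)
        = g (s y) (s y) * (g (s x) (s x) * g (s y) (s y) - g (s x) (s y) ^ 2) := by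
      simp only [map_sub, map_smul, smul_eq_mul, sub_apply,
        smul_apply, hg.symm (s y) (s x)]
      ring
    rw [h4] at h3
    have := nonneg_of_mul_nonneg_right h3 hy
    linarith

/-- Nonzero vectors orthogonal to a timelike vector are spacelike. -/
theorem pos_of_orthogonal (hg : IsLorentzian g) {a x : V} (ha : g a a < 0) (hax : g a x = 0)
    (hx : x ≠ 0) : 0 < g x x := by
  obtain ⟨σ, t, s, hσ, hgs, hts, hnn, hz, hcs⟩ := hg.exists_splitting
  by_contra! h
  have hcs' := hcs a x
  rw [hgs] at ha hax h
  have hA := hnn a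
  have hX := hnn x
  by_cases htx : t x = 0
  · apply hx
    rw [htx] at h
    have : g (s x) (s x) = 0 := by nlinarith
    rw [← hts x htx]
    exact hz x this
  -- Orthogonality makes the spatial product as large as the temporal one, which Cauchy–Schwarz
  -- forbids when `a` is timelike and `x` causal.
  · have h1 : g (s a) (s x) = σ * t a * t x := by linarith
    rw [h1] at hcs'
    have hx2 : 0 < t x ^ 2 := by positivity
    have h2 : g (s x) (s x) ≤ σ * t x ^ 2 := by nlinarith
    have h3 : g (s a) (s a) < σ * t a ^ 2 := by nlinarith
    have h4 : g (s a) (s a) * g (s x) (s x) ≤ g (s a) (s a) * (σ * t x ^ 2) := by gcongr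
    have h5 : g (s a) (s a) * (σ * t x ^ 2) < σ * t a ^ 2 * (σ * t x ^ 2) := by gcongr
    nlinarith

/-- A causal vector in the time cone of `b` lies in the time cone of `a`, if `b` does. -/
theorem neg_of_neg_of_neg (hg : IsLorentzian g) {a b k : V} (ha : g a a < 0) (hb : g b b < 0)
    (hk : g k k ≤ 0) (hab : g a b < 0) (hbk : g b k < 0) : g a k < 0 := by
  obtain ⟨σ, t, s, hσ, hgs, hts, hnn, hz, hcs⟩ := hg.exists_splitting
  -- The temporal part dominates, so `g x y` is negative exactly when `t x` and `t y` have the same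
  -- sign. The claim then reduces to multiplying signs.
  have key : ∀ x y, g x x < 0 → g y y ≤ 0 → t y ≠ 0 → |g (s x) (s y)| < σ * |t x| * |t y| := by
    intro x y hx hy hty
    rw [hgs] at hx hy
    apply abs_lt_of_sq_lt_sq _ (by positivity)
    have hy2 : 0 < t y ^ 2 := by positivity
    have h2 : g (s y) (s y) ≤ σ * t y ^ 2 := by nlinarith
    have h3 : g (s x) (s x) < σ * t x ^ 2 := by nlinarith
    have hX := hnn x
    calc g (s x) (s y) ^ 2 ≤ g (s x) (s x) * g (s y) (s y) := hcs x y
      _ ≤ g (s x) (s x) * (σ * t y ^ 2) := by gcongr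
      _ < σ * t x ^ 2 * (σ * t y ^ 2) := by gcongr
      _ = (σ * |t x| * |t y|) ^ 2 := by rw [mul_pow, mul_pow, sq_abs, sq_abs]; ring
  have sgn : ∀ x y, g x x < 0 → g y y ≤ 0 → t y ≠ 0 → (g x y < 0 ↔ 0 < t x * t y) := by
    intro x y hx hy hty
    have h1 := abs_lt.mp (key x y hx hy hty)
    have h2 : σ * |t x| * |t y| = σ * |t x * t y| := by rw [abs_mul]; ring
    rw [h2] at h1
    have h3 : g x y = -(σ * (t x * t y)) + g (s x) (s y) := by rw [hgs]; ring
    constructor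
    · intro h
      by_contra! hle
      rw [abs_of_nonpos hle] at h1
      nlinarith [h1.1]
    · intro h
      rw [abs_of_pos h] at h1
      linarith [h1.2]
  have ht : ∀ x y, g x x ≤ 0 → g x y ≠ 0 → t x ≠ 0 := by
    intro x y hx hne h
    have h0 := hnn x
    rw [hgs, h] at hx
    have h1 : g (s x) (s x) = 0 := by nlinarith
    have h2 : x = 0 := by rw [← hts x h]; exact hz x h1
    exact hne (by simp [h2])
  have htk : t k ≠ 0 := ht k b hk (by rw [hg.symm]; exact hbk.ne)
  have htb : t b ≠ 0 := ht b k hb.le hbk.ne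
  rw [sgn a b ha hb.le htb] at hab
  rw [sgn b k hb hk htk] at hbk
  rw [sgn a k ha hk htk]
  have h1 : 0 < (t a * t b) * (t b * t k) := mul_pos hab hbk
  have h2 : (t a * t b) * (t b * t k) = t b ^ 2 * (t a * t k) := by ring
  rw [h2] at h1
  exact pos_of_mul_pos_right h1 (sq_nonneg _)

theorem eq_zero_of_forall (hg : IsLorentzian g) {x : V} (hx : ∀ y, g x y = 0) : x = 0 := by
  obtain ⟨v, hv, hpos⟩ := hg.exists_timelike
  by_contra h
  exact (hpos x (by rw [hg.symm]; exact hx v) h).ne' (hx x)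

end IsLorentzian

end LorentzianForms

end

/-! ### Forward-maximal solutions of ordinary differential equations. -/

section

theorem isOpen_paramInterval (a : ℝ) (b : EReal) : IsOpen (paramInterval a b) :=
  (isOpen_lt continuous_const continuous_id).inter
    (isOpen_lt continuous_coe_real_ereal continuous_const)

section MaximalSolutions

variable {E : Type*} [NormedAddCommGroup E] [NormedSpace ℝ E]

/-- `γ` solves `γ' = f(γ)` on `(a, b)`, with values in `U` and initial value `x₀` at `0`. -/
def IsSolution (f : E → E) (U : Set E) (x₀ : E) (a : ℝ) (b : EReal) (γ : ℝ → E) : Prop :=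
  γ 0 = x₀ ∧ ∀ t ∈ paramInterval a b, γ t ∈ U ∧ HasDerivAt γ (f (γ t)) t

theorem exists_local_solution [CompleteSpace E] {f : E → E} {U : Set E} (hU : IsOpen U)
    (hf : LocallyLipschitzOn U f) {x₀ : E} (hx₀ : x₀ ∈ U) (t₀ : ℝ) :
    ∃ (γ : ℝ → E) (ε : ℝ), 0 < ε ∧ γ t₀ = x₀ ∧
      ∀ t ∈ Ioo (t₀ - ε) (t₀ + ε), γ t ∈ U ∧ HasDerivAt γ (f (γ t)) t := by
  obtain ⟨K, s, hs, hl⟩ := hf hx₀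
  rw [hU.nhdsWithin_eq hx₀] at hs
  obtain ⟨a, ha, has⟩ := Metric.mem_nhds_iff.mp hs
  -- A bound for the speed on the ball of radius `a / 2`, which the solution therefore cannot leave
  -- within time `a / (2L)`. The summand 1 only ensures `L > 0`.
  set L : ℝ := K * a + ‖f x₀‖ + 1 with hL
  have hL0 : 0 < L := by positivity
  have hsub : Metric.closedBall x₀ (a / 2) ⊆ s :=
    (Metric.closedBall_subset_ball (half_lt_self ha)).trans has
  have hb : ∀ x ∈ Metric.closedBall x₀ (a / 2), ‖f x‖ ≤ L := by
    intro x hx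
    have h1 := hl.norm_sub_le (hsub hx) (mem_of_mem_nhds hs)
    have h2 : ‖x - x₀‖ ≤ a := by
      rw [← dist_eq_norm]; exact (Metric.mem_closedBall.mp hx).trans (by linarith)
    have h3 : (K : ℝ) * ‖x - x₀‖ ≤ K * a := by gcongr
    have h4 := norm_le_norm_sub_add (f x) (f x₀)
    linarith
  have hε0 : 0 < a / L / 2 := by positivity
  have hpl : IsPicardLindelof (fun _ ↦ f) (tmin := t₀ - a / L / 2) (tmax := t₀ + a / L / 2)
      ⟨t₀, by constructor <;> linarith⟩ x₀ (.mk (a / 2) (half_pos ha).le) 0 (.mk L hL0.le) K := by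
    apply IsPicardLindelof.of_time_independent hb (hl.mono hsub)
    simp only [add_sub_cancel_left, sub_sub_cancel, max_self, NNReal.coe_mk, NNReal.coe_zero,
      sub_zero]
    exact le_of_eq (by field_simp)
  obtain ⟨γ, h0, hγ⟩ := hpl.exists_eq_forall_mem_Icc_hasDerivWithinAt₀
  have hd : ∀ t ∈ Ioo (t₀ - a / L / 2) (t₀ + a / L / 2), HasDerivAt γ (f (γ t)) t := fun t ht =>
    (hγ t (Ioo_subset_Icc_self ht)).hasDerivAt (Icc_mem_nhds ht.1 ht.2)
  have h0' : γ t₀ = x₀ := h0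
  have hc : ContinuousAt γ t₀ := (hd t₀ ⟨by linarith, by linarith⟩).continuousAt
  have hmem : ∀ᶠ t in 𝓝 t₀, γ t ∈ U := hc (hU.mem_nhds (by rw [h0']; exact hx₀))
  obtain ⟨δ, hδ, hball⟩ := Metric.eventually_nhds_iff.mp hmem
  refine ⟨γ, min δ (a / L / 2), lt_min hδ hε0, h0', fun t ht => ⟨?_, ?_⟩⟩
  · apply hball
    rw [Real.dist_eq, abs_lt]
    constructor <;> linarith [ht.1, ht.2, min_le_left δ (a / L / 2)]
  · apply hd
    constructor <;> linarith [ht.1, ht.2, min_le_right δ (a / L / 2)]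

/-- A solution that stays in a compact set up to a finite time has a limit there. -/
theorem exists_limit_of_mem_compact [CompleteSpace E] {f : E → E} {U K : Set E}
    (hf : LocallyLipschitzOn U f) (hK : IsCompact K) (hKU : K ⊆ U) {β : ℝ} (hβ : 0 < β) {γ : ℝ → E}
    (hγ : ∀ t ∈ Ioo 0 β, HasDerivAt γ (f (γ t)) t) (hmem : ∀ t ∈ Ioo 0 β, γ t ∈ K) :
    ∃ x ∈ K, Tendsto γ (𝓝[<] β) (𝓝 x) := by
  obtain ⟨C, hC⟩ := (hK.image_of_continuousOn (hf.continuousOn.mono hKU)).isBounded.exists_norm_le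
  have hlip : LipschitzOnWith (Real.toNNReal C) γ (Ioo 0 β) := by
    refine (convex_Ioo 0 β).lipschitzOnWith_of_nnnorm_hasDerivWithin_le
      (fun t ht => (hγ t ht).hasDerivWithinAt) (fun t ht => ?_)
    rw [← NNReal.coe_le_coe, coe_nnnorm]
    exact (hC _ (mem_image_of_mem f (hmem t ht))).trans (Real.le_coe_toNNReal C)
  have hIoo : Ioo 0 β ∈ 𝓝[<] β := Ioo_mem_nhdsLT hβ
  have hcau : Cauchy (map γ (𝓝[<] β)) := by
    refine Cauchy.map_of_le (cauchy_nhds.mono nhdsWithin_le_nhds) hlip.uniformContinuousOn ?_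
    exact le_principal_iff.mpr hIoo
  obtain ⟨x, hx⟩ := CompleteSpace.complete hcau
  refine ⟨x, ?_, hx⟩
  exact hK.isClosed.mem_of_tendsto hx (mem_of_superset hIoo hmem)

/-- Two solutions that match at `β` can be glued there. -/
theorem glue_solutions {f : E → E} {U : Set E} (hf : ContinuousOn f U) (hU : IsOpen U)
    {a β ε : ℝ} (haβ : a < β) (hε : 0 < ε) {γ δ : ℝ → E}
    (hγ : ∀ t ∈ Ioo a β, γ t ∈ U ∧ HasDerivAt γ (f (γ t)) t)
    (hδ : ∀ t ∈ Ioo (β - ε) (β + ε), δ t ∈ U ∧ HasDerivAt δ (f (δ t)) t)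
    (hlim : Tendsto γ (𝓝[<] β) (𝓝 (δ β))) :
    ∀ t ∈ Ioo a (β + ε), (if t < β then γ t else δ t) ∈ U ∧
      HasDerivAt (fun s => if s < β then γ s else δ s) (f (if t < β then γ t else δ t)) t := by
  intro t ht
  have hδβ := hδ β ⟨by linarith, by linarith⟩
  have hleft : ∀ t, t < β → (fun s => if s < β then γ s else δ s) =ᶠ[𝓝 t] γ := fun t ht => by
    filter_upwards [Iio_mem_nhds ht] with s hs
    exact if_pos hs
  rcases lt_trichotomy t β with h | rfl | h
  · simp only [h, if_true]
    exact ⟨(hγ t ⟨ht.1, h⟩).1, (hγ t ⟨ht.1, h⟩).2.congr_of_eventuallyEq (hleft t h)⟩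
  · simp only [lt_irrefl, if_false]
    refine ⟨hδβ.1, ?_⟩
    have hr : HasDerivWithinAt (fun s => if s < t then γ s else δ s) (f (δ t)) (Ici t) t :=
      hδβ.2.hasDerivWithinAt.congr (fun s hs => if_neg (not_lt.mpr hs)) (if_neg (lt_irrefl _))
    have hIoo : Ioo a t ∈ 𝓝[<] t := Ioo_mem_nhdsLT haβ
    have heq : (fun s => if s < t then γ s else δ s) =ᶠ[𝓝[<] t] γ := by
      filter_upwards [hIoo] with s hs
      exact if_pos hs.2
    -- The left derivative at the gluing point is the limit of the derivatives `f (γ s)`, by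
    -- continuity of `f`.
    have hl : HasDerivWithinAt (fun s => if s < t then γ s else δ s) (f (δ t)) (Iic t) t := by
      refine hasDerivWithinAt_Iic_of_tendsto_deriv (s := Ioo a t) ?_ ?_ hIoo ?_
      · intro s hs
        exact ((hγ s hs).2.congr_of_eventuallyEq
          (hleft s hs.2)).differentiableAt.differentiableWithinAt
      · refine ContinuousWithinAt.mono (t := Iio t) ?_ Ioo_subset_Iio_self
        unfold ContinuousWithinAt
        simp only [lt_irrefl, if_false]
        exact hlim.congr' heq.symm
      · have h1 : Tendsto (fun s => f (γ s)) (𝓝[<] t) (𝓝 (f (δ t))) :=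
          (hf.continuousAt (hU.mem_nhds hδβ.1)).tendsto.comp hlim
        refine h1.congr' ?_
        filter_upwards [hIoo] with s hs
        exact ((hγ s hs).2.congr_of_eventuallyEq (hleft s hs.2)).deriv.symm
    have := hl.union hr
    rwa [Iic_union_Ici, hasDerivWithinAt_univ] at this
  · have h' : ¬ t < β := not_lt.mpr h.le
    simp only [h', if_false]
    have heq : (fun s => if s < β then γ s else δ s) =ᶠ[𝓝 t] δ := by
      filter_upwards [Ioi_mem_nhds h] with s hs
      exact if_neg (not_lt.mpr (le_of_lt hs))
    have hd := hδ t ⟨by linarith, ht.2⟩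
    exact ⟨hd.1, hd.2.congr_of_eventuallyEq heq⟩

/-- Solutions of an ordinary differential equation with a locally Lipschitz right-hand side can be
extended until they leave every compact set. -/
theorem exists_maximal_solution [CompleteSpace E] {f : E → E} {U : Set E} (hU : IsOpen U)
    (hf : LocallyLipschitzOn U f) {x₀ : E} (hx₀ : x₀ ∈ U) :
    ∃ (a : ℝ) (b : EReal) (γ : ℝ → E), a < 0 ∧ 0 < b ∧ IsSolution f U x₀ a b γ ∧
      ∀ K ⊆ U, IsCompact K → (∀ t : ℝ, 0 ≤ t → (t : EReal) < b → γ t ∈ K) → b = ⊤ := by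
  obtain ⟨γ₀, ε₀, hε₀, hγ₀, hsol₀⟩ := exists_local_solution hU hf hx₀ 0
  -- Zorn's lemma for extensions to the right; the left end stays fixed. Extension is only a
  -- preorder, since values outside the interval are arbitrary.
  let α := {s : EReal × (ℝ → E) // 0 < s.1 ∧ IsSolution f U x₀ (-ε₀) s.1 s.2}
  let r : α → α → Prop := fun s t =>
    s.1.1 ≤ t.1.1 ∧ ∀ x ∈ paramInterval (-ε₀) s.1.1, s.1.2 x = t.1.2 x
  have hbase : IsSolution f U x₀ (-ε₀) (ε₀ : EReal) γ₀ :=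
    ⟨hγ₀, fun t ht => hsol₀ t ⟨by linarith [ht.1], by
      have := EReal.coe_lt_coe_iff.mp ht.2; linarith⟩⟩
  have hchain : ∀ c : Set α, IsChain r c → ∃ ub, ∀ s ∈ c, r s ub := by
    intro c hc
    rcases c.eq_empty_or_nonempty with rfl | ⟨s₀, hs₀⟩
    · exact ⟨⟨(ε₀, γ₀), EReal.coe_pos.mpr hε₀, hbase⟩, by simp⟩
    classical
    let b : EReal := sSup ((fun s : α => s.1.1) '' c)
    have hb : ∀ t : ℝ, (t : EReal) < b → ∃ s ∈ c, (t : EReal) < s.1.1 := by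
      intro t ht
      obtain ⟨_, ⟨s, hs, rfl⟩, hlt⟩ := lt_sSup_iff.mp ht
      exact ⟨s, hs, hlt⟩
    have hle : ∀ s ∈ c, s.1.1 ≤ b := fun s hs => le_sSup (mem_image_of_mem _ hs)
    -- Any member of the chain defined at `t` may be chosen, because members agree where both are
    -- defined.
    let γ : ℝ → E := fun t => if h : ∃ s ∈ c, (t : EReal) < s.1.1 then h.choose.1.2 t else 0
    have hγ : ∀ s ∈ c, ∀ t ∈ paramInterval (-ε₀) s.1.1, γ t = s.1.2 t := by
      intro s hs t ht
      have h : ∃ s ∈ c, (t : EReal) < s.1.1 := ⟨s, hs, ht.2⟩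
      have hval : γ t = h.choose.1.2 t := dif_pos h
      rw [hval]
      by_cases hcs : h.choose = s
      · rw [hcs]
      rcases hc h.choose_spec.1 hs hcs with h1 | h1
      · exact h1.2 t ⟨ht.1, h.choose_spec.2⟩
      · exact (h1.2 t ht).symm
    have hmem0 : ∀ s : α, (0 : ℝ) ∈ paramInterval (-ε₀) s.1.1 := fun s =>
      ⟨by linarith, by simpa using s.2.1⟩
    refine ⟨⟨(b, γ), s₀.2.1.trans_le (hle s₀ hs₀), ?_, ?_⟩, fun s hs => ⟨hle s hs, fun t ht =>
      (hγ s hs t ht).symm⟩⟩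
    · exact (hγ s₀ hs₀ 0 (hmem0 s₀)).trans s₀.2.2.1
    · intro t ht
      obtain ⟨s, hs, hlt⟩ := hb t ht.2
      have ht' : t ∈ paramInterval (-ε₀) s.1.1 := ⟨ht.1, hlt⟩
      have heq : γ =ᶠ[𝓝 t] s.1.2 := by
        filter_upwards [(isOpen_paramInterval _ _).mem_nhds ht'] with x hx
        exact hγ s hs x hx
      have hd := s.2.2.2 t ht'
      show γ t ∈ U ∧ HasDerivAt γ (f (γ t)) t
      rw [hγ s hs t ht']
      exact ⟨hd.1, hd.2.congr_of_eventuallyEq heq⟩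
  obtain ⟨m, hm⟩ := exists_maximal_of_chains_bounded hchain (fun {s t w} hst htw =>
    ⟨hst.1.trans htw.1, fun x hx => (hst.2 x hx).trans
      (htw.2 x ⟨hx.1, hx.2.trans_le hst.1⟩)⟩)
  obtain ⟨⟨b, γ⟩, hb, hsol⟩ := m
  refine ⟨-ε₀, b, γ, by linarith, hb, hsol, fun K hKU hK hmem => ?_⟩
  by_contra hbt
  induction b with
  | top => exact hbt rfl
  | bot => exact absurd hb (by simp)
  | coe β =>
    simp only at hb hsol hmem
    have hβ : 0 < β := EReal.coe_pos.mp hb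
    have hsol' : ∀ t ∈ Ioo (-ε₀) β, γ t ∈ U ∧ HasDerivAt γ (f (γ t)) t := fun t ht =>
      hsol.2 t ⟨ht.1, EReal.coe_lt_coe_iff.mpr ht.2⟩
    -- At a finite end `β` the solution has a limit in `U`; a local solution started there extends
    -- it past `β`, against maximality.
    obtain ⟨x, hxK, hlim⟩ := exists_limit_of_mem_compact hf hK hKU hβ
      (fun t ht => (hsol' t ⟨by linarith [ht.1], ht.2⟩).2)
      (fun t ht => hmem t ht.1.le (EReal.coe_lt_coe_iff.mpr ht.2))
    obtain ⟨δ, ε, hε, hδ, hsolδ⟩ := exists_local_solution hU hf (hKU hxK) β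
    have hglue := glue_solutions hf.continuousOn hU (by linarith) hε hsol' hsolδ (by rwa [hδ])
    let m' : α := ⟨(((β + ε : ℝ) : EReal), fun s => if s < β then γ s else δ s), by
      refine ⟨EReal.coe_pos.mpr (by linarith), ?_, fun t ht => ?_⟩
      · simp only [hβ, if_true]; exact hsol.1
      · exact hglue t ⟨ht.1, EReal.coe_lt_coe_iff.mp ht.2⟩⟩
    have h1 := hm m' ⟨EReal.coe_le_coe_iff.mpr (by linarith), fun t ht => by
      have : t < β := EReal.coe_lt_coe_iff.mp ht.2
      simp [m', this]⟩
    have h2 : ((β + ε : ℝ) : EReal) ≤ (β : EReal) := h1.1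
    have := EReal.coe_le_coe_iff.mp h2
    linarith

end MaximalSolutions

end

/-! ### Calculus of locally Lipschitz maps. -/

section

section LocallyLipschitz

theorem locallyLipschitzOn_prodMk {α β γ : Type*} [PseudoEMetricSpace α] [PseudoEMetricSpace β]
    [PseudoEMetricSpace γ] {s : Set α} {f : α → β} {g : α → γ}
    (hf : LocallyLipschitzOn s f) (hg : LocallyLipschitzOn s g) :
    LocallyLipschitzOn s (fun x => (f x, g x)) := by
  intro x hx
  obtain ⟨K, t, ht, hl⟩ := hf hx
  obtain ⟨K', t', ht', hl'⟩ := hg hx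
  refine ⟨max K K', t ∩ t', inter_mem ht ht', ?_⟩
  exact (hl.mono inter_subset_left).prodMk (hl'.mono inter_subset_right)

theorem locallyLipschitzOn_finsetSum {α F ι : Type*} [PseudoEMetricSpace α]
    [SeminormedAddCommGroup F] (I : Finset ι) {s : Set α} {f : ι → α → F}
    (hf : ∀ i ∈ I, LocallyLipschitzOn s (f i)) :
    LocallyLipschitzOn s (fun x => ∑ i ∈ I, f i x) := by
  classical
  induction I using Finset.induction_on with
  | empty =>
    simp only [Finset.sum_empty]
    exact (LocallyLipschitz.const (0 : F)).locallyLipschitzOn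
  | insert i I hi ih =>
    simp only [Finset.sum_insert hi]
    exact (hf i (Finset.mem_insert_self i I)).add
      (ih fun j hj => hf j (Finset.mem_insert_of_mem hj))

theorem locallyLipschitzOn_comp_fst {α β γ : Type*} [PseudoEMetricSpace α] [PseudoEMetricSpace β]
    [PseudoEMetricSpace γ] {s : Set α} {f : α → γ} (hf : LocallyLipschitzOn s f) :
    LocallyLipschitzOn (s ×ˢ (univ : Set β)) (fun p => f p.1) := by
  rintro ⟨x, y⟩ ⟨hx, -⟩
  obtain ⟨K, t, ht, hl⟩ := hf hx
  refine ⟨K, t ×ˢ univ, ?_, ?_⟩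
  · rw [nhdsWithin_prod_eq, nhdsWithin_univ]
    exact prod_mem_prod ht univ_mem
  · have := hl.comp (LipschitzWith.prod_fst (α := α) (β := β)).lipschitzOnWith
      (s := t ×ˢ (univ : Set β)) (fun p hp => hp.1)
    rw [mul_one] at this
    exact this

theorem locallyLipschitzOn_contDiffAt_comp {E F G : Type*} [PseudoEMetricSpace E]
    [NormedAddCommGroup F] [NormedSpace ℝ F] [NormedAddCommGroup G] [NormedSpace ℝ G]
    {s : Set E} {f : E → F} {g : F → G}
    (hf : LocallyLipschitzOn s f) (hg : ∀ x ∈ s, ContDiffAt ℝ 1 g (f x)) :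
    LocallyLipschitzOn s (fun x => g (f x)) := by
  intro x hx
  obtain ⟨K, t, ht, hl⟩ := hf hx
  obtain ⟨K', t', ht', hl'⟩ := (hg x hx).exists_lipschitzOnWith
  refine ⟨K' * K, t ∩ f ⁻¹' t', inter_mem ht (hf.continuousOn x hx ht'), ?_⟩
  exact hl'.comp (hl.mono inter_subset_left) (fun y hy => hy.2)

theorem locallyLipschitzOn_contDiffAt_comp₃ {E A B C G : Type*} [PseudoEMetricSpace E]
    [NormedAddCommGroup A] [NormedSpace ℝ A] [NormedAddCommGroup B] [NormedSpace ℝ B]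
    [NormedAddCommGroup C] [NormedSpace ℝ C] [NormedAddCommGroup G] [NormedSpace ℝ G]
    {s : Set E} {f : E → A} {g : E → B} {h : E → C} {Φ : A × B × C → G}
    (hf : LocallyLipschitzOn s f) (hg : LocallyLipschitzOn s g) (hh : LocallyLipschitzOn s h)
    (hΦ : ∀ x ∈ s, ContDiffAt ℝ 1 Φ (f x, g x, h x)) :
    LocallyLipschitzOn s (fun x => Φ (f x, g x, h x)) :=
  locallyLipschitzOn_contDiffAt_comp
    (locallyLipschitzOn_prodMk hf (locallyLipschitzOn_prodMk hg hh)) hΦ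

end LocallyLipschitz

/-! ### The metric in a chart. -/

section CoordinateMetric

variable {M : Type*} [TopologicalSpace M] [ChartedSpace E4 M]

/-- The derivative of the inverse of the chart `e`. -/
noncomputable def coordFrame (e : OpenPartialHomeomorph M E4) (z : E4) : E4 →L[ℝ] E4 :=
  mfderiv 𝓘(ℝ, E4) 𝓘(ℝ, E4) e.symm z

/-- The derivative of the chart `e` at the point with coordinates `z`. -/
noncomputable def coordCoframe (e : OpenPartialHomeomorph M E4) (z : E4) : E4 →L[ℝ] E4 :=
  mfderiv 𝓘(ℝ, E4) 𝓘(ℝ, E4) e (e.symm z)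

/-- The metric at a point, as a form on the model space. -/
def metricAt (g : BilinField M) (p : M) : E4 →L[ℝ] E4 →L[ℝ] ℝ := g p

/-- The metric in the chart `e`, as a form on the coordinate space. -/
noncomputable def coordMetric (g : BilinField M) (e : OpenPartialHomeomorph M E4) (z : E4) :
    E4 →L[ℝ] E4 →L[ℝ] ℝ :=
  (metricAt g (e.symm z)).bilinearComp (coordFrame e z) (coordFrame e z)

theorem coordMetric_apply (g : BilinField M) (e : OpenPartialHomeomorph M E4) (z v w : E4) :
    coordMetric g e z v w = metricAt g (e.symm z) (coordFrame e z v) (coordFrame e z w) := rfl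

theorem comp_eq_coordMetric (g : BilinField M) (e : OpenPartialHomeomorph M E4) (z v w : E4) :
    comp g e z v w = coordMetric g e z v w := rfl

theorem mdifferentiable_of_mem_maximalAtlas [IsManifold 𝓘(ℝ, E4) 3 M]
    {e : OpenPartialHomeomorph M E4} (he : e ∈ IsManifold.maximalAtlas 𝓘(ℝ, E4) 3 M) :
    e.MDifferentiable 𝓘(ℝ, E4) 𝓘(ℝ, E4) :=
  ⟨(contMDiffOn_of_mem_maximalAtlas he).mdifferentiableOn (by norm_num),
    (contMDiffOn_symm_of_mem_maximalAtlas he).mdifferentiableOn (by norm_num)⟩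

/-- The metric in terms of its components in a basis. -/
theorem coordMetric_eq_sum (g : BilinField M) (e : OpenPartialHomeomorph M E4) {ι : Type*}
    [Fintype ι] (b : Module.Basis ι ℝ E4) (z : E4) :
    coordMetric g e z = ∑ i, ∑ j, comp g e z (b i) (b j) •
      (LinearMap.toContinuousLinearMap (b.coord i)).smulRight
        (LinearMap.toContinuousLinearMap (b.coord j)) := by
  refine ContinuousLinearMap.ext fun v => ContinuousLinearMap.ext fun w => ?_
  simp only [sum_apply, smul_apply, ContinuousLinearMap.smulRight_apply,
    LinearMap.coe_toContinuousLinearMap', Module.Basis.coord_apply, smul_eq_mul,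
    comp_eq_coordMetric]
  conv_lhs => rw [← b.sum_repr v, ← b.sum_repr w]
  simp only [map_sum, map_smul, sum_apply, smul_apply, smul_eq_mul, Finset.mul_sum]
  rw [Finset.sum_comm]
  refine Finset.sum_congr rfl fun i _ => Finset.sum_congr rfl fun j _ => ?_
  ring

variable [IsManifold 𝓘(ℝ, E4) 3 M]
  {e : OpenPartialHomeomorph M E4} (he : e ∈ IsManifold.maximalAtlas 𝓘(ℝ, E4) 3 M)

section
include he

theorem coordCoframe_comp_coordFrame {z : E4} (hz : z ∈ e.target) :
    (coordCoframe e z).comp (coordFrame e z) = ContinuousLinearMap.id ℝ E4 :=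
  (mdifferentiable_of_mem_maximalAtlas he).comp_symm_deriv hz

/-- In finite dimension a one-sided inverse is two-sided. -/
theorem coordFrame_comp_coordCoframe {z : E4} (hz : z ∈ e.target) :
    (coordFrame e z).comp (coordCoframe e z) = ContinuousLinearMap.id ℝ E4 := by
  have h := coordCoframe_comp_coordFrame he hz
  have h1 : (coordCoframe e z : E4 →ₗ[ℝ] E4) * (coordFrame e z : E4 →ₗ[ℝ] E4) = 1 := by
    refine LinearMap.ext fun v => ?_
    exact congrArg (fun L : E4 →L[ℝ] E4 => L v) h
  rw [mul_eq_one_comm] at h1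
  refine ContinuousLinearMap.ext fun v => ?_
  exact congrArg (fun L : E4 →ₗ[ℝ] E4 => L v) h1

theorem coordFrame_coordCoframe {z : E4} (hz : z ∈ e.target) (v : E4) :
    coordFrame e z (coordCoframe e z v) = v :=
  congrArg (fun L : E4 →L[ℝ] E4 => L v) (coordFrame_comp_coordCoframe he hz)

theorem coordCoframe_coordFrame {z : E4} (hz : z ∈ e.target) (v : E4) :
    coordCoframe e z (coordFrame e z v) = v :=
  congrArg (fun L : E4 →L[ℝ] E4 => L v) (coordCoframe_comp_coordFrame he hz)

end

namespace Spacetime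

variable (X : Spacetime M)

theorem isLorentzian (p : M) : IsLorentzian (metricAt X.metric p) := ⟨X.symm p, X.lorentzian p⟩

variable {X}

section
include he

theorem isLorentzian_coordMetric {z : E4} (hz : z ∈ e.target) :
    IsLorentzian (coordMetric X.metric e z) := by
  obtain ⟨hs, v, hv, hpos⟩ := X.isLorentzian (e.symm z)
  refine ⟨fun v w => hs _ _, coordCoframe e z v, ?_, fun w hw hne => ?_⟩
  · rw [coordMetric_apply, coordFrame_coordCoframe he hz]
    exact hv
  · rw [coordMetric_apply, coordFrame_coordCoframe he hz] at hw
    refine hpos _ hw fun h0 => hne ?_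
    rw [← coordCoframe_coordFrame he hz w]
    exact (congrArg (coordCoframe e z) h0).trans (map_zero _)

theorem differentiableAt_comp {z : E4} (hz : z ∈ e.target) (v w : E4) :
    DifferentiableAt ℝ (fun z => comp X.metric e z v w) z :=
  ((X.regular e he v w).1.contDiffAt (e.open_target.mem_nhds hz)).differentiableAt (by norm_num)

/-- Regularity is assumed for components with fixed vectors; a finite basis expansion transfers it
to the operator-valued map. -/
theorem contDiffAt_coordMetric {z : E4} (hz : z ∈ e.target) :
    ContDiffAt ℝ 1 (coordMetric X.metric e) z := by
  have b := Module.finBasis ℝ E4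
  rw [show coordMetric X.metric e = _ from funext (coordMetric_eq_sum X.metric e b)]
  refine ContDiffAt.sum fun i _ => ContDiffAt.sum fun j _ => ContDiffAt.fun_smul ?_ contDiffAt_const
  exact (X.regular e he _ _).1.contDiffAt (e.open_target.mem_nhds hz)

theorem differentiableAt_coordMetric {z : E4} (hz : z ∈ e.target) :
    DifferentiableAt ℝ (coordMetric X.metric e) z :=
  (contDiffAt_coordMetric he hz).differentiableAt (by norm_num)

theorem fderiv_comp_apply {z : E4} (hz : z ∈ e.target) (v w : E4) :
    fderiv ℝ (fun z => comp X.metric e z v w) z =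
      ((fderiv ℝ (coordMetric X.metric e) z).flip v).flip w := by
  have h := (differentiableAt_coordMetric (X := X) he hz).hasFDerivAt
  have h1 := (h.clm_apply (hasFDerivAt_const v z)).clm_apply (hasFDerivAt_const w z)
  refine h1.fderiv.trans ?_
  refine ContinuousLinearMap.ext fun x => ?_
  simp

/-- This is the `C^{1,1}` assumption in the form in which the geodesic equation needs it. -/
theorem locallyLipschitzOn_fderiv_coordMetric :
    LocallyLipschitzOn e.target (fderiv ℝ (coordMetric X.metric e)) := by
  have b := Module.finBasis ℝ E4
  set c := fun i j => (LinearMap.toContinuousLinearMap (b.coord i)).smulRight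
        (LinearMap.toContinuousLinearMap (b.coord j)) with hc
  have hsum : ∀ z ∈ e.target, fderiv ℝ (coordMetric X.metric e) z =
      ∑ i, ∑ j, (fderiv ℝ (fun z => comp X.metric e z (b i) (b j)) z).smulRight (c i j) := by
    intro z hz
    rw [show coordMetric X.metric e = _ from funext (coordMetric_eq_sum X.metric e b)]
    refine HasFDerivAt.fderiv ?_
    refine HasFDerivAt.fun_sum fun i _ => HasFDerivAt.fun_sum fun j _ => ?_
    exact (differentiableAt_comp he hz _ _).hasFDerivAt.smul_const _
  have hlip : LocallyLipschitzOn e.target (fun z =>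
      ∑ i, ∑ j, (fderiv ℝ (fun z => comp X.metric e z (b i) (b j)) z).smulRight (c i j)) := by
    refine locallyLipschitzOn_finsetSum _ fun i _ => locallyLipschitzOn_finsetSum _ fun j _ => ?_
    refine locallyLipschitzOn_contDiffAt_comp (g := fun A : E4 →L[ℝ] ℝ => A.smulRight (c i j))
      (X.regular e he (b i) (b j)).2 fun z _ => ?_
    exact ((ContinuousLinearMap.smulRightL ℝ E4 (E4 →L[ℝ] E4 →L[ℝ] ℝ)).flip
      (c i j)).contDiff.contDiffAt
  intro z hz
  obtain ⟨K, t, ht, hl⟩ := hlip hz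
  refine ⟨K, t ∩ e.target, inter_mem ht self_mem_nhdsWithin, fun x hx y hy => ?_⟩
  rw [hsum x hx.2, hsum y hy.2]
  exact hl hx.1 hy.1

end

end Spacetime

end CoordinateMetric

end

/-! ### The geodesic equation in a chart. -/

section

section GeodesicEquation

/-- `Γ_{kij} kⁱ kʲ` in terms of the derivative `D` of the metric. -/
noncomputable def gammaForm (D : E4 →L[ℝ] E4 →L[ℝ] E4 →L[ℝ] ℝ) (k : E4) : E4 →L[ℝ] ℝ :=
  D k k - (1 / 2 : ℝ) • (D.flip k).flip k

theorem gammaForm_apply (D : E4 →L[ℝ] E4 →L[ℝ] E4 →L[ℝ] ℝ) (k w : E4) :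
    gammaForm D k w = D k k w - 1 / 2 * D w k k := by
  simp [gammaForm]

theorem contDiff_gammaForm :
    ContDiff ℝ 1 (fun p : (E4 →L[ℝ] E4 →L[ℝ] E4 →L[ℝ] ℝ) × E4 => gammaForm p.1 p.2) := by
  unfold gammaForm
  have h1 : ContDiff ℝ 1 (fun p : (E4 →L[ℝ] E4 →L[ℝ] E4 →L[ℝ] ℝ) × E4 => p.1 p.2 p.2) :=
    (contDiff_fst.clm_apply contDiff_snd).clm_apply contDiff_snd
  have h2 : ContDiff ℝ 1 (fun p : (E4 →L[ℝ] E4 →L[ℝ] E4 →L[ℝ] ℝ) × E4 => p.1.flip p.2) :=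
    (((ContinuousLinearMap.flipₗᵢ ℝ E4 E4 (E4 →L[ℝ] ℝ)).contDiff).comp contDiff_fst).clm_apply
      contDiff_snd
  have h3 : ContDiff ℝ 1
      (fun p : (E4 →L[ℝ] E4 →L[ℝ] E4 →L[ℝ] ℝ) × E4 => (p.1.flip p.2).flip p.2) :=
    (((ContinuousLinearMap.flipₗᵢ ℝ E4 E4 ℝ).contDiff).comp h2).clm_apply contDiff_snd
  exact h1.sub (h3.const_smul (1 / 2 : ℝ))

/-- Nondegeneracy gives injectivity, and the dual has the same dimension. Thus `g` is an invertible
operator, and inversion is smooth near it. -/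
theorem exists_continuousLinearEquiv {g : E4 →L[ℝ] E4 →L[ℝ] ℝ} (hg : IsLorentzian g) :
    ∃ e : E4 ≃L[ℝ] (E4 →L[ℝ] ℝ), (e : E4 →L[ℝ] E4 →L[ℝ] ℝ) = g := by
  have hinj : Function.Injective (g : E4 →ₗ[ℝ] E4 →L[ℝ] ℝ) := by
    rw [← LinearMap.ker_eq_bot, LinearMap.ker_eq_bot']
    intro x hx
    exact hg.eq_zero_of_forall fun y => congrArg (fun L : E4 →L[ℝ] ℝ => L y) hx
  have hrank : Module.finrank ℝ E4 = Module.finrank ℝ (E4 →L[ℝ] ℝ) := by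
    rw [← (LinearMap.toContinuousLinearMap (E := E4) (F' := ℝ) (𝕜 := ℝ)).finrank_eq]
    exact (Subspace.dual_finrank_eq (K := ℝ) (V := E4)).symm
  refine ⟨(LinearEquiv.ofInjectiveOfFinrankEq _ hinj hrank).toContinuousLinearEquiv, ?_⟩
  refine ContinuousLinearMap.ext fun v => ?_
  rfl

/-- The coordinate acceleration of a geodesic with velocity `k`, where the metric is `g` and its
derivative is `D`. -/
noncomputable def geodesicAcceleration (g : E4 →L[ℝ] E4 →L[ℝ] ℝ)
    (D : E4 →L[ℝ] E4 →L[ℝ] E4 →L[ℝ] ℝ) (k : E4) : E4 :=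
  -(g.inverse (gammaForm D k))

theorem apply_geodesicAcceleration {g : E4 →L[ℝ] E4 →L[ℝ] ℝ} (hg : IsLorentzian g)
    (D : E4 →L[ℝ] E4 →L[ℝ] E4 →L[ℝ] ℝ) (k w : E4) :
    g (geodesicAcceleration g D k) w = -(D k k w - 1 / 2 * D w k k) := by
  obtain ⟨e, rfl⟩ := exists_continuousLinearEquiv hg
  rw [geodesicAcceleration, ContinuousLinearMap.inverse_equiv, map_neg, neg_apply,
    ContinuousLinearEquiv.coe_coe, ContinuousLinearEquiv.coe_coe,
    ContinuousLinearEquiv.apply_symm_apply, gammaForm_apply]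

theorem contDiffAt_geodesicAcceleration {g : E4 →L[ℝ] E4 →L[ℝ] ℝ} (hg : IsLorentzian g)
    (D : E4 →L[ℝ] E4 →L[ℝ] E4 →L[ℝ] ℝ) (k : E4) :
    ContDiffAt ℝ 1 (fun p : (E4 →L[ℝ] E4 →L[ℝ] ℝ) × (E4 →L[ℝ] E4 →L[ℝ] E4 →L[ℝ] ℝ) × E4 =>
      geodesicAcceleration p.1 p.2.1 p.2.2) (g, D, k) := by
  obtain ⟨e, rfl⟩ := exists_continuousLinearEquiv hg
  unfold geodesicAcceleration
  refine ContDiffAt.neg (ContDiffAt.clm_apply ?_ ?_)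
  · exact ContDiffAt.comp (f := Prod.fst) (g := ContinuousLinearMap.inverse)
      ((e : E4 →L[ℝ] E4 →L[ℝ] ℝ), D, k) (contDiffAt_map_inverse e) contDiffAt_fst
  · exact (contDiff_gammaForm.comp contDiff_snd).contDiffAt

variable {M : Type*} [TopologicalSpace M] [ChartedSpace E4 M] [IsManifold 𝓘(ℝ, E4) 3 M]

namespace Spacetime

/-- The geodesic vector field in the chart `e`. -/
noncomputable def geodesicField (X : Spacetime M) (e : OpenPartialHomeomorph M E4)
    (p : E4 × E4) : E4 × E4 :=
  (p.2, geodesicAcceleration (coordMetric X.metric e p.1)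
    (fderiv ℝ (coordMetric X.metric e) p.1) p.2)

variable {X : Spacetime M} {e : OpenPartialHomeomorph M E4}
  (he : e ∈ IsManifold.maximalAtlas 𝓘(ℝ, E4) 3 M)
include he

/-- The field is a `C¹` function of the metric, its first derivative and the velocity, all of them
locally Lipschitz. Picard–Lindelöf applies without a second derivative of the metric. -/
theorem locallyLipschitzOn_geodesicField :
    LocallyLipschitzOn (e.target ×ˢ (univ : Set E4)) (X.geodesicField e) := by
  have hsnd : LocallyLipschitzOn (e.target ×ˢ (univ : Set E4)) (fun p : E4 × E4 => p.2) :=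
    LipschitzWith.prod_snd.locallyLipschitz.locallyLipschitzOn
  have hD := locallyLipschitzOn_comp_fst (β := E4)
    (locallyLipschitzOn_fderiv_coordMetric (X := X) he)
  have hG : LocallyLipschitzOn (e.target ×ˢ (univ : Set E4))
      (fun p : E4 × E4 => coordMetric X.metric e p.1) := by
    refine locallyLipschitzOn_comp_fst (fun z hz => ?_)
    obtain ⟨K, t, ht, hl⟩ := (contDiffAt_coordMetric (X := X) he hz).exists_lipschitzOnWith
    exact ⟨K, t, mem_nhdsWithin_of_mem_nhds ht, hl⟩
  have hacc := locallyLipschitzOn_contDiffAt_comp₃ hG hD hsnd fun p hp =>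
    contDiffAt_geodesicAcceleration (isLorentzian_coordMetric (X := X) he hp.1) _ _
  exact locallyLipschitzOn_prodMk hsnd hacc

variable (X) in
/-- Geodesics exist until their position and velocity leave every compact subset of a given open
set `U`. -/
theorem exists_maximal_geodesic {U : Set (E4 × E4)} (hU : IsOpen U)
    (hUe : U ⊆ e.target ×ˢ univ) {z₀ k₀ : E4} (h₀ : (z₀, k₀) ∈ U) :
    ∃ (a : ℝ) (b : EReal) (z k : ℝ → E4), a < 0 ∧ 0 < b ∧ z 0 = z₀ ∧ k 0 = k₀ ∧
      (∀ t ∈ paramInterval a b, (z t, k t) ∈ U ∧ HasDerivAt z (k t) t ∧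
        HasDerivAt k (geodesicAcceleration (coordMetric X.metric e (z t))
          (fderiv ℝ (coordMetric X.metric e) (z t)) (k t)) t) ∧
      ∀ K ⊆ U, IsCompact K →
        (∀ t : ℝ, 0 ≤ t → (t : EReal) < b → (z t, k t) ∈ K) → b = ⊤ := by
  obtain ⟨a, b, γ, ha, hb, ⟨h0, hγ⟩, hmax⟩ :=
    exists_maximal_solution hU ((locallyLipschitzOn_geodesicField (X := X) he).mono hUe) h₀
  refine ⟨a, b, fun t => (γ t).1, fun t => (γ t).2, ha, hb, congrArg Prod.fst h0,
    congrArg Prod.snd h0, fun t ht => ⟨(hγ t ht).1, ?_, ?_⟩, fun K hKU hK hC => ?_⟩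
  · exact (hγ t ht).2.fst
  · exact (hγ t ht).2.snd
  · exact hmax K hKU hK hC

theorem christoffel_eq {z : E4} (hz : z ∈ e.target) (k w : E4) :
    christoffel X.metric e z k k w = fderiv ℝ (coordMetric X.metric e) z k k w
      - 1 / 2 * fderiv ℝ (coordMetric X.metric e) z w k k := by
  simp only [christoffel, fderiv_comp_apply he hz, ContinuousLinearMap.flip_apply]
  ring

variable {z k : ℝ → E4} {t : ℝ}

/-- The Euler–Lagrange equation of a geodesic. -/
theorem hasDerivAt_coordMetric_apply (hzt : z t ∈ e.target) (hz : HasDerivAt z (k t) t)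
    (hk : HasDerivAt k (geodesicAcceleration (coordMetric X.metric e (z t))
      (fderiv ℝ (coordMetric X.metric e) (z t)) (k t)) t) (w : E4) :
    HasDerivAt (fun s => coordMetric X.metric e (z s) (k s) w)
      (1 / 2 * fderiv ℝ (coordMetric X.metric e) (z t) w (k t) (k t)) t := by
  have hG := (differentiableAt_coordMetric (X := X) he hzt).hasFDerivAt.comp_hasDerivAt t hz
  have h := (hG.clm_apply hk).clm_apply (hasDerivAt_const t w)
  refine h.congr_deriv ?_
  simp only [Function.comp_apply, map_zero, add_zero, add_apply,
    apply_geodesicAcceleration (isLorentzian_coordMetric (X := X) he hzt)]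
  ring

/-- The Christoffel terms cancel the derivative of the metric; hence null initial vectors stay null.
-/
theorem hasDerivAt_coordMetric_self (hzt : z t ∈ e.target) (hz : HasDerivAt z (k t) t)
    (hk : HasDerivAt k (geodesicAcceleration (coordMetric X.metric e (z t))
      (fderiv ℝ (coordMetric X.metric e) (z t)) (k t)) t) :
    HasDerivAt (fun s => coordMetric X.metric e (z s) (k s) (k s)) 0 t := by
  have hL := isLorentzian_coordMetric (X := X) he hzt
  have hG := (differentiableAt_coordMetric (X := X) he hzt).hasFDerivAt.comp_hasDerivAt t hz
  have h := (hG.clm_apply hk).clm_apply hk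
  refine h.congr_deriv ?_
  simp only [Function.comp_apply, add_apply, hL.symm (k t), apply_geodesicAcceleration hL]
  ring

theorem hasMFDerivAt_symm_comp (hzt : z t ∈ e.target) (hz : HasDerivAt z (k t) t) :
    HasMFDerivAt 𝓘(ℝ, ℝ) 𝓘(ℝ, E4) (fun s => e.symm (z s)) t
      ((coordFrame e (z t)).comp (ContinuousLinearMap.toSpanSingleton ℝ (k t))) := by
  have h1 := ((mdifferentiable_of_mem_maximalAtlas he).mdifferentiableAt_symm hzt).hasMFDerivAt
  exact HasMFDerivAt.comp t h1 hz.hasFDerivAt.hasMFDerivAt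

theorem velocity_symm_comp (hzt : z t ∈ e.target) (hz : HasDerivAt z (k t) t) :
    velocity (fun s => e.symm (z s)) t = coordFrame e (z t) (k t) := by
  have h := (hasMFDerivAt_symm_comp he hzt hz).mfderiv
  unfold velocity
  rw [h]
  exact (congrArg (coordFrame e (z t)) (one_smul ℝ (k t)))

theorem isGeodesicNear_symm_comp (hzt : ∀ᶠ s in 𝓝 t, z s ∈ e.target)
    (hz : ∀ᶠ s in 𝓝 t, HasDerivAt z (k s) s)
    (hk : ∀ᶠ s in 𝓝 t, HasDerivAt k (geodesicAcceleration (coordMetric X.metric e (z s))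
      (fderiv ℝ (coordMetric X.metric e) (z s)) (k s)) s) :
    X.IsGeodesicNear (fun s => e.symm (z s)) t := by
  refine ⟨(e.continuousAt_symm hzt.self_of_nhds).comp hz.self_of_nhds.continuousAt, e, he, ?_⟩
  have heq : ∀ᶠ s in 𝓝 t, (e ∘ fun s => e.symm (z s)) =ᶠ[𝓝 s] z := by
    filter_upwards [eventually_eventually_nhds.mpr hzt] with r hr
    filter_upwards [hr] with s hs
    exact e.right_inv hs
  have hder : ∀ᶠ s in 𝓝 t, deriv (e ∘ fun s => e.symm (z s)) =ᶠ[𝓝 s] k := by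
    filter_upwards [eventually_eventually_nhds.mpr hz, eventually_eventually_nhds.mpr heq]
      with r hr hr'
    filter_upwards [hr, hr'] with s hs h
    rw [h.deriv_eq, hs.deriv]
  filter_upwards [hzt, hz, hk, heq, hder] with s h1 h2 h3 h4 h5
  refine ⟨e.map_target h1, h2.differentiableAt.congr_of_eventuallyEq h4,
    h3.differentiableAt.congr_of_eventuallyEq h5, fun w => ?_⟩
  rw [h5.deriv_eq, h5.self_of_nhds, h3.deriv, e.right_inv h1, comp_eq_coordMetric,
    christoffel_eq he h1, apply_geodesicAcceleration (isLorentzian_coordMetric he h1)]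
  ring

end Spacetime

end GeodesicEquation

end

/-! ### Calculus of decay in `r`. -/

section

section Decay

/-- `f = O(r^k)` and `∂_y f = O(r^(k-1))`, uniformly in `u` and in the angles. -/
def IsDecay (k : ℤ) (f : E4 → ℝ) : Prop :=
  ∃ C R : ℝ, ∀ (u : ℝ) (y : E3), R < ‖y‖ →
    DifferentiableAt ℝ f (u, y) ∧ |f (u, y)| ≤ C * ‖y‖ ^ k ∧
    ∀ v : E3, |fderiv ℝ f (u, y) (0, v)| ≤ C * ‖y‖ ^ (k - 1) * ‖v‖

/-- The bound for `∂_u f`, which gains no power of `r`, is dropped: the escape estimates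
differentiate the metric only in the directions of `y`. -/
theorem IsBondiO.isDecay {k : ℤ} {f : E4 → ℝ} (h : IsBondiO k f) : IsDecay k f := by
  obtain ⟨C, R, h⟩ := h
  exact ⟨C, R, fun u y hy => ⟨(h u y hy).1, (h u y hy).2.1, (h u y hy).2.2.2⟩⟩

namespace IsDecay

variable {k l : ℤ} {f g : E4 → ℝ}

theorem exists_pos (h : IsDecay k f) : ∃ C R : ℝ, 0 ≤ C ∧ 0 < R ∧ ∀ (u : ℝ) (y : E3), R < ‖y‖ →
    DifferentiableAt ℝ f (u, y) ∧ |f (u, y)| ≤ C * ‖y‖ ^ k ∧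
    ∀ v : E3, |fderiv ℝ f (u, y) (0, v)| ≤ C * ‖y‖ ^ (k - 1) * ‖v‖ := by
  obtain ⟨C, R, h⟩ := h
  refine ⟨|C|, max R 1, abs_nonneg _, by positivity, fun u y hy => ?_⟩
  obtain ⟨h1, h2, h3⟩ := h u y ((le_max_left _ _).trans_lt hy)
  exact ⟨h1, h2.trans (by gcongr; exact le_abs_self C),
    fun v => (h3 v).trans (by gcongr; exact le_abs_self C)⟩

theorem add (hf : IsDecay k f) (hg : IsDecay k g) : IsDecay k (fun z => f z + g z) := by
  obtain ⟨C, R, hf⟩ := hf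
  obtain ⟨C', R', hg⟩ := hg
  refine ⟨C + C', max R R', fun u y hy => ?_⟩
  obtain ⟨f1, f2, f3⟩ := hf u y ((le_max_left _ _).trans_lt hy)
  obtain ⟨g1, g2, g3⟩ := hg u y ((le_max_right _ _).trans_lt hy)
  refine ⟨f1.add g1, (abs_add_le _ _).trans (by linarith), fun v => ?_⟩
  rw [fderiv_fun_add f1 g1, add_apply]
  refine (abs_add_le _ _).trans ?_
  linarith [f3 v, g3 v]

theorem mul (hf : IsDecay k f) (hg : IsDecay l g) : IsDecay (k + l) (fun z => f z * g z) := by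
  obtain ⟨C, R, hC, hR, hf⟩ := hf.exists_pos
  obtain ⟨C', R', hC', hR', hg⟩ := hg.exists_pos
  refine ⟨2 * (C * C'), max R R', fun u y hy => ?_⟩
  obtain ⟨f1, f2, f3⟩ := hf u y ((le_max_left _ _).trans_lt hy)
  obtain ⟨g1, g2, g3⟩ := hg u y ((le_max_right _ _).trans_lt hy)
  have hy0 : 0 < ‖y‖ := hR.trans ((le_max_left _ _).trans_lt hy)
  have hne := hy0.ne'
  refine ⟨f1.mul g1, ?_, fun v => ?_⟩
  · rw [abs_mul, zpow_add₀ hne]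
    calc |f (u, y)| * |g (u, y)| ≤ (C * ‖y‖ ^ k) * (C' * ‖y‖ ^ l) := by gcongr
      _ ≤ 2 * (C * C') * (‖y‖ ^ k * ‖y‖ ^ l) := by
        have : 0 ≤ C * C' * (‖y‖ ^ k * ‖y‖ ^ l) := by positivity
        linarith
  · rw [fderiv_fun_mul f1 g1, add_apply, smul_apply, smul_apply, smul_eq_mul, smul_eq_mul]
    have e1 : ‖y‖ ^ (k + l - 1) = ‖y‖ ^ k * ‖y‖ ^ (l - 1) := by
      rw [← zpow_add₀ hne]; congr 1; ring
    have e2 : ‖y‖ ^ k * ‖y‖ ^ (l - 1) = ‖y‖ ^ (k - 1) * ‖y‖ ^ l := by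
      rw [← zpow_add₀ hne, ← zpow_add₀ hne]; congr 1; ring
    calc |f (u, y) * fderiv ℝ g (u, y) (0, v) + g (u, y) * fderiv ℝ f (u, y) (0, v)|
        ≤ |f (u, y)| * |fderiv ℝ g (u, y) (0, v)| + |g (u, y)| * |fderiv ℝ f (u, y) (0, v)| := by
          rw [← abs_mul, ← abs_mul]; exact abs_add_le _ _
      _ ≤ (C * ‖y‖ ^ k) * (C' * ‖y‖ ^ (l - 1) * ‖v‖)
          + (C' * ‖y‖ ^ l) * (C * ‖y‖ ^ (k - 1) * ‖v‖) := by
          gcongr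
          · exact g3 v
          · exact f3 v
      _ = C * C' * ‖v‖ * (‖y‖ ^ k * ‖y‖ ^ (l - 1)) + C * C' * ‖v‖ * (‖y‖ ^ (k - 1) * ‖y‖ ^ l) := by
          ring
      _ = 2 * (C * C') * ‖y‖ ^ (k + l - 1) * ‖v‖ := by rw [e1, ← e2]; ring

theorem mono (hf : IsDecay k f) (hkl : k ≤ l) : IsDecay l f := by
  obtain ⟨C, R, hC, hR, hf⟩ := hf.exists_pos
  refine ⟨C, max R 1, fun u y hy => ?_⟩
  obtain ⟨f1, f2, f3⟩ := hf u y ((le_max_left _ _).trans_lt hy)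
  have hy1 : 1 ≤ ‖y‖ := ((le_max_right _ _).trans_lt hy).le
  exact ⟨f1, f2.trans (by gcongr), fun v => (f3 v).trans (by gcongr)⟩

theorem congr (hf : IsDecay k f) {R : ℝ} (h : ∀ (u : ℝ) (y : E3), R < ‖y‖ → g (u, y) = f (u, y)) :
    IsDecay k g := by
  obtain ⟨C, R', hf⟩ := hf
  refine ⟨C, max R R', fun u y hy => ?_⟩
  obtain ⟨f1, f2, f3⟩ := hf u y ((le_max_right _ _).trans_lt hy)
  have hR : R < ‖y‖ := (le_max_left _ _).trans_lt hy
  have heq : g =ᶠ[𝓝 (u, y)] f := by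
    have : {z : E4 | R < ‖z.2‖} ∈ 𝓝 (u, y) :=
      (isOpen_lt continuous_const continuous_snd.norm).mem_nhds hR
    filter_upwards [this] with z hz
    exact h z.1 z.2 hz
  rw [h u y hR, heq.fderiv_eq]
  exact ⟨f1.congr_of_eventuallyEq heq, f2, f3⟩

theorem const (c : ℝ) : IsDecay 0 (fun _ => c) :=
  ⟨|c|, 0, fun u y hy => ⟨differentiableAt_const c, by simp, fun v => by
    simp only [fderiv_fun_const, Pi.zero_apply, zero_apply, abs_zero]; positivity⟩⟩

theorem const_mul (hf : IsDecay k f) (c : ℝ) : IsDecay k (fun z => c * f z) := by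
  simpa using (const c).mul hf

end IsDecay

theorem hasFDerivAt_norm_snd {z : E4} (hz : z.2 ≠ 0) :
    HasFDerivAt (fun z : E4 => ‖z.2‖)
      ((innerSL ℝ (dir z.2)).comp (ContinuousLinearMap.snd ℝ ℝ E3)) z := by
  have h := (hasStrictFDerivAt_norm_sq z.2).hasFDerivAt
  have h1 := (h.comp z (hasFDerivAt_snd (𝕜 := ℝ) (p := z))).sqrt
    (by simpa using hz)
  have h2 : (fun x : E4 => √(((fun x : E3 => ‖x‖ ^ 2) ∘ Prod.snd) x)) = fun z : E4 => ‖z.2‖ := by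
    funext x; simp [Real.sqrt_sq (norm_nonneg _)]
  rw [h2] at h1
  refine h1.congr_fderiv (ContinuousLinearMap.ext fun w => ?_)
  have hn : ‖z.2‖ ≠ 0 := norm_ne_zero_iff.mpr hz
  simp only [Function.comp_apply, Real.sqrt_sq (norm_nonneg _), smul_apply,
    ContinuousLinearMap.comp_apply, ContinuousLinearMap.coe_snd', innerSL_apply_apply, smul_eq_mul, dir,
    real_inner_smul_left, nsmul_eq_mul]
  field_simp
  norm_num

theorem norm_dir {y : E3} (hy : y ≠ 0) : ‖dir y‖ = 1 := by
  rw [dir, norm_smul, norm_inv, norm_norm, inv_mul_cancel₀ (norm_ne_zero_iff.mpr hy)]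

theorem isDecay_norm_zpow (k : ℤ) : IsDecay k (fun z => ‖z.2‖ ^ k) := by
  refine ⟨|(k : ℝ)| + 1, 0, fun u y hy => ?_⟩
  have hy0 : y ≠ 0 := norm_pos_iff.mp hy
  have h := hasFDerivAt_norm_snd (z := (u, y)) hy0
  have h2 := (hasDerivAt_zpow k ‖y‖ (Or.inl hy.ne')).comp_hasFDerivAt (f := fun z : E4 => ‖z.2‖)
    (u, y) h
  refine ⟨h2.differentiableAt, ?_, fun v => ?_⟩
  · rw [abs_of_nonneg (by positivity)]
    have : 0 ≤ |(k : ℝ)| * ‖y‖ ^ k := by positivity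
    linarith
  · have h3 : fderiv ℝ (fun z : E4 => ‖z.2‖ ^ k) (u, y) (0, v)
        = (k * ‖y‖ ^ (k - 1)) * inner ℝ (dir y) v := by
      have := congrArg (fun L : E4 →L[ℝ] ℝ => L (0, v)) h2.fderiv
      simpa [Function.comp_def] using this
    rw [h3, abs_mul, abs_mul, abs_of_nonneg (a := ‖y‖ ^ (k - 1)) (by positivity)]
    have h4 : |inner ℝ (dir y) v| ≤ ‖v‖ := by
      simpa [norm_dir hy0] using abs_real_inner_le_norm (dir y) v
    gcongr
    linarith

theorem isDecay_inner (v : E3) : IsDecay 1 (fun z => inner ℝ z.2 v) := by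
  refine ⟨‖v‖, 0, fun u y hy => ?_⟩
  have h : HasFDerivAt (fun z : E4 => inner ℝ z.2 v)
      ((innerSL ℝ v).comp (ContinuousLinearMap.snd ℝ ℝ E3)) (u, y) := by
    have := ((innerSL ℝ v).comp (ContinuousLinearMap.snd ℝ ℝ E3)).hasFDerivAt (x := (u, y))
    refine this.congr_of_eventuallyEq (Eventually.of_forall fun z => ?_)
    simp [real_inner_comm]
  refine ⟨h.differentiableAt, ?_, fun w => ?_⟩
  · have := abs_real_inner_le_norm y v
    simpa [mul_comm] using this
  · rw [h.fderiv]
    have := abs_real_inner_le_norm v w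
    simpa using this

theorem isDecay_inner_dir (v : E3) : IsDecay 0 (fun z => inner ℝ (dir z.2) v) := by
  refine ((isDecay_norm_zpow (-1)).mul (isDecay_inner v)).congr (R := 0) fun u y _ => ?_
  simp [dir, real_inner_smul_left]

end Decay

/-! ### The deviation of the Bondi metric from the Minkowski metric. -/

section Perturbation

/-- The form `d(u + r)` of Minkowski space at a point in the direction of `y`. -/
noncomputable def flatTime (y : E3) : E4 →L[ℝ] ℝ :=
  ContinuousLinearMap.fst ℝ ℝ E3 + (innerSL ℝ (dir y)).comp (ContinuousLinearMap.snd ℝ ℝ E3)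

theorem flatTime_apply (y : E3) (V : E4) : flatTime y V = V.1 + inner ℝ (dir y) V.2 := by
  simp [flatTime]

/-- The Euclidean inner product as a bilinear form. -/
noncomputable def euclideanForm : E3 →L[ℝ] E3 →L[ℝ] ℝ := innerSL ℝ

theorem euclideanForm_apply (v w : E3) : euclideanForm v w = inner ℝ v w := rfl

/-- The Minkowski metric `-(d(u + r))² + dy²`. -/
noncomputable def flatMetric (y : E3) : E4 →L[ℝ] E4 →L[ℝ] ℝ :=
  euclideanForm.bilinearComp (ContinuousLinearMap.snd ℝ ℝ E3)
    (ContinuousLinearMap.snd ℝ ℝ E3) - (flatTime y).smulRight (flatTime y)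

theorem flatMetric_apply (y : E3) (V W : E4) : flatMetric y V W =
    inner ℝ V.2 W.2 - (V.1 + inner ℝ (dir y) V.2) * (W.1 + inner ℝ (dir y) W.2) := by
  simp [flatMetric, flatTime_apply, euclideanForm_apply]

theorem contDiffAt_dir {y : E3} (hy : y ≠ 0) : ContDiffAt ℝ 1 dir y := by
  have h1 : ContDiffAt ℝ 1 (fun y : E3 => ‖y‖⁻¹) y :=
    (contDiffAt_norm ℝ hy).inv (norm_ne_zero_iff.mpr hy)
  exact h1.smul contDiffAt_id

theorem differentiableAt_flatMetric {z : E4} (hz : z.2 ≠ 0) :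
    DifferentiableAt ℝ (fun z : E4 => flatMetric z.2) z := by
  have h1 : DifferentiableAt ℝ (fun z : E4 => dir z.2) z :=
    ((contDiffAt_dir hz).differentiableAt (by norm_num)).comp z differentiableAt_snd
  have h2 : DifferentiableAt ℝ (fun z : E4 => flatTime z.2) z := by
    unfold flatTime
    refine (differentiableAt_const _).add ?_
    exact ((euclideanForm.differentiableAt).comp z h1).clm_comp (differentiableAt_const _)
  unfold flatMetric
  refine (differentiableAt_const _).sub ?_
  exact ((((ContinuousLinearMap.smulRightL ℝ E4 (E4 →L[ℝ] ℝ))).differentiableAt).comp z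
    h2).clm_apply h2

theorem spatial_eq_radial_add_angular {y : E3} (hy : y ≠ 0) (v : E3) :
    ((0, v) : E4) = inner ℝ (dir y) v • dR y + ‖y‖⁻¹ • dA y v := by
  have : ‖y‖ ≠ 0 := norm_ne_zero_iff.mpr hy
  refine Prod.ext (by simp [dR, dA]) ?_
  simp only [dR, dA, tang, Prod.snd_add, Prod.smul_snd, smul_smul, inv_mul_cancel₀ this, one_smul]
  abel

theorem tang_dir {y : E3} (hy : y ≠ 0) : tang y (dir y) = 0 := by
  simp [tang, norm_dir hy]

theorem inner_tang_tang {y : E3} (hy : y ≠ 0) (v w : E3) : inner ℝ (tang y v) (tang y w) =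
    inner ℝ v w - inner ℝ (dir y) v * inner ℝ (dir y) w := by
  simp only [tang, inner_sub_left, inner_sub_right, real_inner_smul_left, real_inner_smul_right,
    real_inner_self_eq_norm_sq, norm_dir hy, real_inner_comm (dir y) v]
  ring

variable {M : Type*} [TopologicalSpace M] [ChartedSpace E4 M] [IsManifold 𝓘(ℝ, E4) 3 M]
  {X : Spacetime M}

namespace BondiChart

/-- The metric in Bondi coordinates. -/
noncomputable def coordForm (B : BondiChart X) (z : E4) : E4 →L[ℝ] E4 →L[ℝ] ℝ :=
  coordMetric X.metric B.chart z

/-- The deviation of the metric from the Minkowski metric. -/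
noncomputable def deviation (B : BondiChart X) (z : E4) : E4 →L[ℝ] E4 →L[ℝ] ℝ :=
  B.coordForm z - flatMetric z.2

variable (B : BondiChart X)

theorem comp_eq_coordForm (z V W : E4) : comp X.metric B.chart z V W = B.coordForm z V W := rfl

theorem coordForm_symm {z : E4} (hz : B.R₀ < ‖z.2‖) (V W : E4) :
    B.coordForm z V W = B.coordForm z W V :=
  (Spacetime.isLorentzian_coordMetric B.chart_mem (B.mem_target z.1 z.2 hz)).symm V W

theorem snd_ne_zero {z : E4} (hz : B.R₀ < ‖z.2‖) : z.2 ≠ 0 :=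
  norm_pos_iff.mp (B.R₀_pos.trans hz)

theorem deviation_symm {z : E4} (hz : B.R₀ < ‖z.2‖) (V W : E4) :
    B.deviation z V W = B.deviation z W V := by
  simp only [deviation, sub_apply, B.coordForm_symm hz V W, flatMetric_apply,
    real_inner_comm V.2 W.2]
  ring

/-- By `g_rr = g_rI = 0` only the angular parts contribute, and each angular coordinate vector
carries a factor `r`. -/
theorem coordForm_spatial {u : ℝ} {y : E3} (hy : B.R₀ < ‖y‖) (v w : E3) :
    B.coordForm (u, y) (0, v) (0, w)
      = (‖y‖⁻¹) ^ 2 * comp X.metric B.chart (u, y) (dA y v) (dA y w) := by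
  have h1 : B.coordForm (u, y) (dR y) (dR y) = 0 := by
    rw [← comp_eq_coordForm]; exact B.metric_rr u y hy
  have h2 : ∀ v, B.coordForm (u, y) (dR y) (dA y v) = 0 := fun v => by
    rw [← comp_eq_coordForm]; exact B.metric_rI u y v hy
  rw [comp_eq_coordForm]
  have h3 : ∀ v, B.coordForm (u, y) (dA y v) (dR y) = 0 := fun v => by
    rw [B.coordForm_symm (z := (u, y)) hy]; exact h2 v
  generalize B.coordForm (u, y) = G at *
  rw [spatial_eq_radial_add_angular (B.snd_ne_zero (z := (u, y)) hy) v,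
    spatial_eq_radial_add_angular (B.snd_ne_zero (z := (u, y)) hy) w]
  simp only [map_add, map_smul, add_apply, smul_apply, smul_eq_mul, h1, h2, h3]
  ring

/-- The deviation has no components `rr` and `rI`. -/
theorem deviation_dir {u : ℝ} {y : E3} (hy : B.R₀ < ‖y‖) (w : E3) :
    B.deviation (u, y) (0, dir y) (0, w) = 0 := by
  have hy0 := B.snd_ne_zero (z := (u, y)) hy
  have h : dA y (dir y) = 0 := by
    simp [dA, tang_dir hy0]
  simp only [deviation, sub_apply, B.coordForm_spatial hy, h, comp_eq_coordForm, map_zero,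
    flatMetric_apply, zero_apply, mul_zero, real_inner_self_eq_norm_sq, norm_dir hy0]
  ring

/-- The term `ω_{IJ} r²` is the flat one; after division by `r²` the slowest remainder is `h⁽¹⁾ /
r`. -/
theorem isDecay_deviation_spatial (v w : E3) :
    IsDecay (-1) (fun z => B.deviation z (0, v) (0, w)) := by
  have h1 := (isDecay_norm_zpow (-2)).mul (B.metric_IJ v w).isDecay
  have h2 := (isDecay_norm_zpow (-1)).mul (B.h₁_bounded v w).isDecay
  refine ((h1.mono (by norm_num)).add h2).congr (R := B.R₀) fun u y hy => ?_
  have hy0 := B.snd_ne_zero (z := (u, y)) hy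
  have hn : ‖y‖ ≠ 0 := norm_ne_zero_iff.mpr hy0
  simp only [deviation, sub_apply, B.coordForm_spatial hy, flatMetric_apply, inner_tang_tang hy0,
    zero_add, zpow_neg, zpow_ofNat]
  field_simp
  ring

/-- The slowest term is the angular one, `g_uI / r`; the radial one is `O(r⁻²)`. -/
theorem isDecay_deviation_mixed (w : E3) : IsDecay (-1) (fun z => B.deviation z dU (0, w)) := by
  have h1 := (isDecay_inner_dir w).mul B.metric_ur.isDecay
  have h2 := (isDecay_norm_zpow (-1)).mul (B.metric_uI w).isDecay
  refine ((h1.mono (by norm_num)).add h2).congr (R := B.R₀) fun u y hy => ?_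
  have hy0 := B.snd_ne_zero (z := (u, y)) hy
  have h3 : B.coordForm (u, y) dU (0, w) = inner ℝ (dir y) w * B.coordForm (u, y) dU (dR y)
      + ‖y‖⁻¹ * B.coordForm (u, y) dU (dA y w) := by
    conv_lhs => rw [spatial_eq_radial_add_angular hy0 w]
    simp only [map_add, map_smul, smul_eq_mul]
  have h4 : flatMetric y dU (0, w) = -inner ℝ (dir y) w := by
    simp [flatMetric_apply, dU]
  simp only [deviation, sub_apply, h3, h4, comp_eq_coordForm, zpow_neg, zpow_one]
  ring

theorem isDecay_deviation_uu : IsDecay (-1) (fun z => B.deviation z dU dU) := by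
  have h2 := B.m_bounded.isDecay.mul (isDecay_norm_zpow (-1))
  refine ((B.metric_uu.isDecay.mono (by norm_num)).add h2).congr (R := B.R₀) fun u y hy => ?_
  simp only [deviation, sub_apply, flatMetric_apply, comp_eq_coordForm, dU,
    zpow_neg, zpow_one, inner_zero_right]
  ring

theorem isDecay_deviation (V W : E4) : IsDecay (-1) (fun z => B.deviation z V W) := by
  have h := (((B.isDecay_deviation_uu.const_mul (V.1 * W.1)).add
    ((B.isDecay_deviation_mixed W.2).const_mul V.1)).add
    ((B.isDecay_deviation_mixed V.2).const_mul W.1)).add (B.isDecay_deviation_spatial V.2 W.2)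
  refine h.congr (R := B.R₀) fun u y hy => ?_
  have hV : ∀ V : E4, V = V.1 • dU + (0, V.2) := fun V => by simp [dU]
  conv_lhs => rw [hV V, hV W]
  simp only [map_add, map_smul, add_apply, smul_apply, smul_eq_mul,
    B.deviation_symm (z := (u, y)) hy (0, V.2) dU]
  ring

theorem differentiableAt_deviation {z : E4} (hz : B.R₀ < ‖z.2‖) :
    DifferentiableAt ℝ B.deviation z :=
  (Spacetime.differentiableAt_coordMetric B.chart_mem (B.mem_target z.1 z.2 hz)).sub
    (differentiableAt_flatMetric (B.snd_ne_zero hz))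

theorem fderiv_deviation_apply {z : E4} (hz : B.R₀ < ‖z.2‖) (V W x : E4) :
    fderiv ℝ (fun z => B.deviation z V W) z x = fderiv ℝ B.deviation z x V W := by
  have h := (B.differentiableAt_deviation hz).hasFDerivAt
  have h1 := (h.clm_apply (hasFDerivAt_const V z)).clm_apply (hasFDerivAt_const W z)
  rw [h1.fderiv]
  simp

/-- Bounds for the components of bilinear forms in a basis give bounds for the forms. -/
theorem exists_bilinear_bound {ι : Type*} [Fintype ι] (b : Module.Basis ι ℝ E4) (c : ι → ι → ℝ)
    (hc : ∀ i j, 0 ≤ c i j) : ∃ C : ℝ, 0 < C ∧ ∀ (A : E4 →L[ℝ] E4 →L[ℝ] ℝ) (K : ℝ), 0 ≤ K →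
      (∀ i j, |A (b i) (b j)| ≤ c i j * K) → ∀ V W, |A V W| ≤ C * K * ‖V‖ * ‖W‖ := by
  set φ := fun i => LinearMap.toContinuousLinearMap (b.coord i) with hφ
  have hexp : ∀ A : E4 →L[ℝ] E4 →L[ℝ] ℝ, ∀ V W, A V W =
      ∑ i, ∑ j, φ i V * φ j W * A (b i) (b j) := by
    intro A V W
    conv_lhs => rw [← b.sum_repr V, ← b.sum_repr W]
    simp only [map_sum, map_smul, sum_apply, smul_apply, smul_eq_mul, Finset.mul_sum]
    rw [Finset.sum_comm]
    refine Finset.sum_congr rfl fun i _ => Finset.sum_congr rfl fun j _ => ?_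
    simp [hφ]
    ring
  set C := ∑ i, ∑ j, ‖φ i‖ * ‖φ j‖ * c i j with hC
  have hCnn : 0 ≤ C := Finset.sum_nonneg fun i _ => Finset.sum_nonneg fun j _ =>
    mul_nonneg (by positivity) (hc i j)
  refine ⟨C + 1, by positivity, fun A K hK hA V W => ?_⟩
  rw [hexp]
  calc |∑ i, ∑ j, φ i V * φ j W * A (b i) (b j)|
      ≤ ∑ i, ∑ j, |φ i V * φ j W * A (b i) (b j)| :=
        (Finset.abs_sum_le_sum_abs _ _).trans
          (Finset.sum_le_sum fun i _ => Finset.abs_sum_le_sum_abs _ _)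
    _ ≤ ∑ i, ∑ j, ‖φ i‖ * ‖φ j‖ * c i j * (K * ‖V‖ * ‖W‖) := by
        refine Finset.sum_le_sum fun i _ => Finset.sum_le_sum fun j _ => ?_
        rw [abs_mul, abs_mul]
        have h1 : |φ i V| ≤ ‖φ i‖ * ‖V‖ := (φ i).le_opNorm V
        have h2 : |φ j W| ≤ ‖φ j‖ * ‖W‖ := (φ j).le_opNorm W
        calc |φ i V| * |φ j W| * |A (b i) (b j)|
            ≤ (‖φ i‖ * ‖V‖) * (‖φ j‖ * ‖W‖) * (c i j * K) := by
              gcongr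
              exact hA i j
          _ = _ := by ring
    _ = C * (K * ‖V‖ * ‖W‖) := by simp only [hC, Finset.sum_mul]
    _ ≤ (C + 1) * K * ‖V‖ * ‖W‖ := by
        have : 0 ≤ K * ‖V‖ * ‖W‖ := by positivity
        nlinarith

/-- The deviation is `O(1/r)` and its derivatives with respect to `y` are `O(1/r²)`. -/
theorem exists_deviation_bound : ∃ C R : ℝ, 0 < C ∧ B.R₀ ≤ R ∧ ∀ (u : ℝ) (y : E3), R < ‖y‖ →
    (∀ V W : E4, |B.deviation (u, y) V W| ≤ C / ‖y‖ * ‖V‖ * ‖W‖) ∧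
    ∀ (v : E3) (V W : E4), |fderiv ℝ B.deviation (u, y) (0, v) V W| ≤
      C / ‖y‖ / ‖y‖ * ‖v‖ * ‖V‖ * ‖W‖ := by
  have b := Module.finBasis ℝ E4
  choose c R hc hR h using fun i j => (B.isDecay_deviation (b i) (b j)).exists_pos
  obtain ⟨C, hC, hbound⟩ := exists_bilinear_bound b c hc
  -- The sum of the positive radii serves as a common radius for all components.
  have hsum : ∀ i j, R i j ≤ ∑ i, ∑ j, R i j := fun i j =>
    (Finset.single_le_sum (f := fun j => R i j) (fun j _ => (hR i j).le) (Finset.mem_univ j)).trans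
      (Finset.single_le_sum (f := fun i => ∑ j, R i j)
        (fun i _ => Finset.sum_nonneg fun j _ => (hR i j).le) (Finset.mem_univ i))
  refine ⟨C, max B.R₀ (∑ i, ∑ j, R i j), hC, le_max_left _ _, fun u y hy => ?_⟩
  have hy0 : B.R₀ < ‖y‖ := (le_max_left _ _).trans_lt hy
  have hyR : ∀ i j, R i j < ‖y‖ := fun i j =>
    (hsum i j).trans_lt ((le_max_right _ _).trans_lt hy)
  have hpos : 0 < ‖y‖ := B.R₀_pos.trans hy0
  refine ⟨fun V W => ?_, fun v V W => ?_⟩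
  · have h1 : ∀ i j, |B.deviation (u, y) (b i) (b j)| ≤ c i j * ‖y‖⁻¹ := fun i j => by
      rw [← zpow_neg_one]
      exact (h i j u y (hyR i j)).2.1
    have := hbound (B.deviation (u, y)) ‖y‖⁻¹ (by positivity) h1 V W
    rwa [div_eq_mul_inv]
  · have h1 : ∀ i j, |fderiv ℝ B.deviation (u, y) (0, v) (b i) (b j)| ≤
        c i j * (‖y‖⁻¹ * ‖y‖⁻¹ * ‖v‖) := fun i j => by
      rw [← B.fderiv_deviation_apply (z := (u, y)) hy0]
      refine ((h i j u y (hyR i j)).2.2 v).trans (le_of_eq ?_)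
      rw [show (-1 - 1 : ℤ) = -1 + -1 by norm_num, zpow_add₀ hpos.ne', zpow_neg_one]
      ring
    have := hbound (fderiv ℝ B.deviation (u, y) (0, v)) (‖y‖⁻¹ * ‖y‖⁻¹ * ‖v‖) (by positivity)
      h1 V W
    refine this.trans (le_of_eq ?_)
    field_simp

end BondiChart

end Perturbation

end

/-! ### Real inequalities for null vectors in a weak field. -/

section

section RealEstimates

/-- The relations between the scalar quantities attached to a null vector `k` with `k^u = p`,
`k^r = q`, `|k^⊥| = L` and momentum `π`, where `n = |π|`, `ph = -π_r`, `S = n² / ph²`; the numbers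
`S'` and `ph'` are the derivatives of `S` and `ph` along the geodesic. -/
structure NullEstimates (r p q L S S' ph ph' : ℝ) : Prop where
  deriv_S : |r * p * S' - S * L ^ 2| ≤ 1 / 100 * (S * (p ^ 2 + L ^ 2))
  null : |2 * p * q - (L ^ 2 - p ^ 2)| ≤ 1 / 100 * (p ^ 2 + L ^ 2)
  deriv_ph : |r * p * ph' + ph * L ^ 2| ≤ 1 / 100 * (ph * (p ^ 2 + L ^ 2))
  ratio : |p ^ 2 + L ^ 2 - S * p ^ 2| ≤ 1 / 100 * (p ^ 2 + L ^ 2)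
  ph_near : |ph - p| ≤ 1 / 100 * p

-- Everything is compared with `N = p² + L²`. Here `a` stands for the product of `π` with the
-- angular velocity, and `Xr`, `Xπ` for the contributions of the deviation to the derivatives of
-- `π_r` and `|π|²`. The product `n L |q|` in the bound for `Xπ` is harmless because it occurs only
-- multiplied by `p`.
set_option maxHeartbeats 2000000 in
theorem nullEstimates_of_bounds {r ε p q L n ph a Xr Xπ : ℝ} (hr : 0 < r) (hε : 0 ≤ ε)
    (hε' : ε ≤ 1 / 10000) (hp : 0 < p) (hL : 0 ≤ L) (hn : 0 ≤ n)
    (ha : |a - L ^ 2| ≤ ε * (L * (p + L)))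
    (hph : |ph - p| ≤ ε * p)
    (hn2 : |n ^ 2 - (p ^ 2 + L ^ 2)| ≤ 5 * ε * (p ^ 2 + L ^ 2))
    (hq : |2 * p * q - (L ^ 2 - p ^ 2)| ≤ ε * (p ^ 2 + 2 * (p * |q|) + 2 * (p * L) + L ^ 2))
    (hXr : r * |Xr| ≤ ε * (p ^ 2 + 2 * (p * |q|) + 2 * (p * L) + L ^ 2))
    (hXπ : r * |Xπ| ≤ ε * n * (p ^ 2 + 2 * (p * |q|) + 2 * (p * L) + L ^ 2 + 2 * (|q| * L))) :
    NullEstimates r p q L (n ^ 2 / ph ^ 2)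
      (((-2 * (p + q) * a / r + Xπ) * ph ^ 2 - n ^ 2 * (2 * ph * (-Xr - a / r))) / (ph ^ 2) ^ 2)
      ph (-Xr - a / r) := by
  set N := p ^ 2 + L ^ 2 with hN
  have hp2 : 0 < p ^ 2 := by positivity
  have hL2 : 0 ≤ L ^ 2 := by positivity
  have hNpos : 0 < N := by positivity
  have hpN : p ^ 2 ≤ N := by linarith
  have hLN : L ^ 2 ≤ N := by linarith
  have hεN : 0 ≤ ε * N := by positivity
  have hεN' : ε * N ≤ 1 / 10000 * N := by gcongr
  have hpL : 2 * (p * L) ≤ N := by linarith [sq_nonneg (p - L)]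
  have hqnn := abs_nonneg q
  have hpq0 : 0 ≤ p * |q| := by positivity
  -- The error in the null relation itself contains `p |q|`; it is absorbed on the left because `ε`
  -- is small.
  have hpq : p * |q| ≤ N := by
    have h1 : 2 * (p * |q|) ≤ |2 * p * q - (L ^ 2 - p ^ 2)| + |L ^ 2 - p ^ 2| := by
      have h2 : 2 * (p * |q|) = |2 * p * q| := by
        rw [abs_mul, abs_of_pos (by positivity : 0 < 2 * p)]; ring
      rw [h2]
      have := abs_add_le (2 * p * q - (L ^ 2 - p ^ 2)) (L ^ 2 - p ^ 2)
      simpa using this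
    have h3 : |L ^ 2 - p ^ 2| ≤ N := abs_le.mpr ⟨by linarith, by linarith⟩
    have h4 : ε * (p ^ 2 + 2 * (p * |q|) + 2 * (p * L) + L ^ 2) ≤
        1 / 10000 * (p ^ 2 + 2 * (p * |q|) + 2 * (p * L) + L ^ 2) := by gcongr
    linarith
  set T := p ^ 2 + 2 * (p * |q|) + 2 * (p * L) + L ^ 2 with hT
  have hTN : T ≤ 4 * N := by linarith
  have hT0 : 0 ≤ T := by positivity
  have hεT : ε * T ≤ 4 * (ε * N) :=
    (mul_le_mul_of_nonneg_left hTN hε).trans_eq (by ring)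
  have hq' := hq.trans hεT
  have ha' : |a - L ^ 2| ≤ 2 * (ε * N) := by
    refine ha.trans ((mul_le_mul_of_nonneg_left (c := 2 * N) ?_ hε).trans_eq (by ring))
    have : L * (p + L) = p * L + L ^ 2 := by ring
    linarith
  have hεp : ε * p ≤ 1 / 10000 * p := by gcongr
  have hPhpos : 0 < ph := by
    have := (abs_le.mp hph).1
    linarith
  have hph2 : p ≤ 2 * ph := by
    have := (abs_le.mp hph).1
    linarith
  have hn2N : N ≤ 2 * n ^ 2 := by
    have := (abs_le.mp hn2).1
    linarith
  have hn2N' : n ^ 2 ≤ 2 * N := by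
    have := (abs_le.mp hn2).2
    linarith
  have hn2pos : 0 < n ^ 2 := by linarith
  have hD2 : |r * (-Xr - a / r) + L ^ 2| ≤ 6 * (ε * N) := by
    have e : r * (-Xr - a / r) + L ^ 2 = -(r * Xr) - (a - L ^ 2) := by field_simp; ring
    rw [e]
    have h1 : |r * Xr| ≤ 4 * (ε * N) := by
      rw [abs_mul, abs_of_pos hr]; exact hXr.trans hεT
    have := abs_sub (-(r * Xr)) (a - L ^ 2)
    rw [abs_neg] at this
    linarith
  -- With `a ≈ L²` and `2pq ≈ L² - p²`, the main term `-2p(p + q)a` becomes `-N L²`.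
  have hD1 : |r * p * (-2 * (p + q) * a / r + Xπ) + N * L ^ 2| ≤ 20 * (ε * N ^ 2) := by
    have e : r * p * (-2 * (p + q) * a / r + Xπ) + N * L ^ 2
        = -((2 * p * q - (L ^ 2 - p ^ 2)) * a) - N * (a - L ^ 2) + p * (r * Xπ) := by
      rw [hN]; field_simp; ring
    have haN : |a| ≤ 2 * N := by
      have h1 := abs_le.mp ha'
      exact abs_le.mpr ⟨by linarith, by linarith⟩
    have h1 : |(2 * p * q - (L ^ 2 - p ^ 2)) * a| ≤ 8 * (ε * N ^ 2) := by
      rw [abs_mul]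
      calc _ ≤ 4 * (ε * N) * (2 * N) := by gcongr
        _ = 8 * (ε * N ^ 2) := by ring
    have h2 : |N * (a - L ^ 2)| ≤ 2 * (ε * N ^ 2) := by
      rw [abs_mul, abs_of_pos hNpos]
      calc _ ≤ N * (2 * (ε * N)) := by gcongr
        _ = 2 * (ε * N ^ 2) := by ring
    have h3 : |p * (r * Xπ)| ≤ 9 * (ε * N ^ 2) := by
      rw [abs_mul, abs_mul, abs_of_pos hp, abs_of_pos hr]
      have hpn : p * n ≤ 3 / 2 * N := by linarith [sq_nonneg (p - n)]
      have hLn : n * L ≤ 3 / 2 * N := by linarith [sq_nonneg (L - n)]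
      calc p * (r * |Xπ|) ≤ p * (ε * n * (T + 2 * (|q| * L))) := by gcongr
        _ = ε * (p * n * T + 2 * (p * |q| * (n * L))) := by ring
        _ ≤ ε * (3 / 2 * N * (4 * N) + 2 * (N * (3 / 2 * N))) := by gcongr
        _ = 9 * (ε * N ^ 2) := by ring
    rw [e]
    have h4 := abs_add_le (-((2 * p * q - (L ^ 2 - p ^ 2)) * a) - N * (a - L ^ 2)) (p * (r * Xπ))
    have h5 := abs_sub (-((2 * p * q - (L ^ 2 - p ^ 2)) * a)) (N * (a - L ^ 2))
    rw [abs_neg] at h5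
    have h6 : 0 ≤ ε * N ^ 2 := by positivity
    linarith
  set dn := -2 * (p + q) * a / r + Xπ with hdn
  set dph := -Xr - a / r with hdph
  -- The quotient `ρ ≈ 1` converts the factor `p` in front of the derivatives into multiples of
  -- `ph`.
  set ρ := p / ph with hρ
  have hρph : ρ * ph = p := by rw [hρ]; field_simp
  have hρ1 : |ρ - 1| ≤ 2 * ε := by
    have e : ρ - 1 = -(ph - p) / ph := by rw [hρ]; field_simp; ring
    rw [e, abs_div, abs_neg, abs_of_pos hPhpos, div_le_iff₀ hPhpos]
    have := mul_le_mul_of_nonneg_left hph2 hε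
    linarith
  have hρpos : 0 < ρ := by positivity
  have hρ2 : ρ ≤ 2 := by
    have := (abs_le.mp hρ1).2
    linarith
  refine ⟨?_, ?_, ?_, ?_, ?_⟩
  · have e : r * p * ((dn * ph ^ 2 - n ^ 2 * (2 * ph * dph)) / (ph ^ 2) ^ 2)
        - n ^ 2 / ph ^ 2 * L ^ 2
        = (1 / ph ^ 2) * ((r * p * dn + N * L ^ 2) - 2 * n ^ 2 * ρ * (r * dph + L ^ 2)
          + L ^ 2 * (n ^ 2 - N) + 2 * n ^ 2 * (ρ - 1) * L ^ 2) := by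
      rw [hρ]; field_simp; ring
    have h1 : |2 * n ^ 2 * ρ * (r * dph + L ^ 2)| ≤ 24 * (ε * (n ^ 2 * N)) := by
      rw [abs_mul, abs_of_nonneg (by positivity)]
      calc _ ≤ 2 * n ^ 2 * 2 * (6 * (ε * N)) := by gcongr
        _ = _ := by ring
    have h2 : |L ^ 2 * (n ^ 2 - N)| ≤ 5 * (ε * N ^ 2) := by
      rw [abs_mul, abs_of_nonneg hL2]
      calc _ ≤ N * (5 * ε * N) := by gcongr
        _ = _ := by ring
    have h3 : |2 * n ^ 2 * (ρ - 1) * L ^ 2| ≤ 4 * (ε * (n ^ 2 * N)) := by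
      rw [abs_mul, abs_mul, abs_of_nonneg (a := 2 * n ^ 2) (by positivity), abs_of_nonneg hL2]
      calc _ ≤ 2 * n ^ 2 * (2 * ε) * N := by gcongr
        _ = _ := by ring
    have h4 : ε * N ^ 2 ≤ 2 * (ε * (n ^ 2 * N)) := by
      have : N ^ 2 ≤ 2 * (n ^ 2 * N) := by
        linarith [mul_le_mul_of_nonneg_right hn2N hNpos.le]
      linarith [mul_le_mul_of_nonneg_left this hε]
    have h5 : ε * (n ^ 2 * N) ≤ 1 / 10000 * (n ^ 2 * N) := by gcongr
    rw [e, abs_mul, abs_of_pos (by positivity : 0 < 1 / ph ^ 2)]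
    have h6 := abs_add_le (r * p * dn + N * L ^ 2 - 2 * n ^ 2 * ρ * (r * dph + L ^ 2)
          + L ^ 2 * (n ^ 2 - N)) (2 * n ^ 2 * (ρ - 1) * L ^ 2)
    have h7 := abs_add_le (r * p * dn + N * L ^ 2 - 2 * n ^ 2 * ρ * (r * dph + L ^ 2))
          (L ^ 2 * (n ^ 2 - N))
    have h8 := abs_sub (r * p * dn + N * L ^ 2) (2 * n ^ 2 * ρ * (r * dph + L ^ 2))
    have h9 : 0 < n ^ 2 * N := by positivity
    calc _ ≤ 1 / ph ^ 2 * (1 / 100 * (n ^ 2 * N)) := by gcongr; linarith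
      _ = _ := by ring
  · linarith
  · have e : r * p * dph + ph * L ^ 2 = p * (r * dph + L ^ 2) + (ph - p) * L ^ 2 := by ring
    rw [e]
    have h1 : |p * (r * dph + L ^ 2)| ≤ p * (6 * (ε * N)) := by
      rw [abs_mul, abs_of_pos hp]; gcongr
    have h2 : |(ph - p) * L ^ 2| ≤ ε * p * N := by
      rw [abs_mul, abs_of_nonneg hL2]; gcongr
    have h3 := abs_add_le (p * (r * dph + L ^ 2)) ((ph - p) * L ^ 2)
    have h4 : p * (ε * N) ≤ 2 * ph * (1 / 10000 * N) := by gcongr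
    have h5 : 0 < ph * N := by positivity
    linarith
  · have e : N - n ^ 2 / ph ^ 2 * p ^ 2 = -(n ^ 2 - N) - n ^ 2 * (ρ - 1) * (ρ + 1) := by
      rw [hρ]; field_simp; ring
    rw [e]
    have h1 : |n ^ 2 * (ρ - 1) * (ρ + 1)| ≤ 2 * N * (2 * ε) * 3 := by
      rw [abs_mul, abs_mul, abs_of_pos hn2pos, abs_of_pos (by linarith : 0 < ρ + 1)]
      gcongr
      linarith
    have h2 := abs_sub (-(n ^ 2 - N)) (n ^ 2 * (ρ - 1) * (ρ + 1))
    rw [abs_neg] at h2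
    linarith
  · refine hph.trans ?_
    gcongr
    linarith

namespace NullEstimates

variable {r p q L S S' ph ph' : ℝ} (h : NullEstimates r p q L S S' ph ph')
include h

/-- In the flat case `L² = (1 - 1/S)(p² + L²)`, which is at least 3/8 of the sum; 36/100 leaves room
for the error. This share of `L²` beats the errors of 1/100 in the monotonicity statements. -/
theorem L_sq_ge (hp : 0 < p) (hS : 8 / 5 ≤ S) : 36 / 100 * (p ^ 2 + L ^ 2) ≤ L ^ 2 := by
  have h1 := (abs_le.mp h.ratio).1
  have hp2 : 0 < p ^ 2 := by positivity
  nlinarith [sq_nonneg L]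

theorem S'_nonneg (hr : 0 < r) (hp : 0 < p) (hS : 8 / 5 ≤ S) : 0 ≤ S' := by
  have h1 := (abs_le.mp h.deriv_S).1
  have h2 := h.L_sq_ge hp hS
  have h3 : 0 ≤ S * (L ^ 2 - 1 / 100 * (p ^ 2 + L ^ 2)) :=
    mul_nonneg (by linarith) (by nlinarith [sq_nonneg L, sq_nonneg p])
  have h4 : 0 ≤ r * p * S' := by linarith
  exact nonneg_of_mul_nonneg_right h4 (by positivity)

theorem ph_pos (hp : 0 < p) : 0 < ph := by
  have := (abs_le.mp h.ph_near).1
  linarith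

theorem ph'_nonpos (hr : 0 < r) (hp : 0 < p) (hS : 8 / 5 ≤ S) : ph' ≤ 0 := by
  have h1 := (abs_le.mp h.deriv_ph).2
  have h2 := h.L_sq_ge hp hS
  have h3 : 0 ≤ ph * (L ^ 2 - 1 / 100 * (p ^ 2 + L ^ 2)) :=
    mul_nonneg (h.ph_pos hp).le (by nlinarith [sq_nonneg L, sq_nonneg p])
  have h4 : r * p * ph' ≤ 0 := by linarith
  exact nonpos_of_mul_nonpos_right h4 (by positivity)

/-- In Minkowski space `ph * S` is conserved. The additional factor `S` supplies the growth that
absorbs the errors. -/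
theorem ph_mul_S_sq (hr : 0 < r) (hp : 0 < p) (hS : 8 / 5 ≤ S) :
    0 ≤ ph' * S ^ 2 + ph * (2 * S * S') := by
  have h1 := (abs_le.mp h.deriv_ph).1
  have h2 := h.L_sq_ge hp hS
  have h3 := (abs_le.mp h.deriv_S).1
  have hph := h.ph_pos hp
  have hS0 : 0 < S := by linarith
  have hN : 0 ≤ p ^ 2 + L ^ 2 := by positivity
  have h4 : 0 ≤ r * p * (ph' * S ^ 2 + ph * (2 * S * S')) := by
    have e : r * p * (ph' * S ^ 2 + ph * (2 * S * S'))
        = S ^ 2 * (r * p * ph' + ph * L ^ 2) + 2 * ph * S * (r * p * S' - S * L ^ 2)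
          + ph * S ^ 2 * L ^ 2 := by ring
    have h5 : S ^ 2 * (r * p * ph' + ph * L ^ 2)
        ≥ S ^ 2 * (-(1 / 100 * (ph * (p ^ 2 + L ^ 2)))) := by gcongr
    have h6 : 2 * ph * S * (r * p * S' - S * L ^ 2)
        ≥ 2 * ph * S * (-(1 / 100 * (S * (p ^ 2 + L ^ 2)))) := by gcongr
    have h7 : ph * S ^ 2 * L ^ 2 ≥ ph * S ^ 2 * (36 / 100 * (p ^ 2 + L ^ 2)) := by gcongr
    have h8 : 0 ≤ ph * S ^ 2 * (p ^ 2 + L ^ 2) := by positivity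
    rw [e]
    linarith
  exact nonneg_of_mul_nonneg_right h4 (by positivity)

/-- `u + 4 r / S` does not increase. -/
theorem u_add_nonpos (hp : 0 < p) (hS : 8 / 5 ≤ S) :
    p + 4 * ((q * S - r * S') / S ^ 2) ≤ 0 := by
  have h1 := (abs_le.mp h.null).2
  have h3 := (abs_le.mp h.deriv_S).1
  have h4 := (abs_le.mp h.ratio).1
  have hS0 : 0 < S := by linarith
  have hN : 0 ≤ p ^ 2 + L ^ 2 := by positivity
  -- The flat value is `-S N / 2` with `N = p² + L²`. There `u + 2r/S` would be constant, and the
  -- coefficient 4 provides the margin.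
  have h5 : p * (q * S - r * S') ≤ S * (-(48 / 100) * (p ^ 2 + L ^ 2)) := by
    have e : p * (q * S - r * S') = S * ((2 * p * q - (L ^ 2 - p ^ 2)) / 2)
      - (r * p * S' - S * L ^ 2) + S * ((L ^ 2 - p ^ 2) / 2 - L ^ 2) := by ring
    have h6 : S * ((2 * p * q - (L ^ 2 - p ^ 2)) / 2) ≤ S * (1 / 100 * (p ^ 2 + L ^ 2) / 2) := by
      gcongr
    rw [e]
    have : 0 ≤ S * (p ^ 2 + L ^ 2) := by positivity
    linarith
  have h7 : p * (p + 4 * ((q * S - r * S') / S ^ 2)) ≤ 0 := by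
    have e : p * (p + 4 * ((q * S - r * S') / S ^ 2))
        = (1 / S) * (S * p ^ 2 + 4 * ((1 / S) * (p * (q * S - r * S')))) := by field_simp
    have h8 : (1 / S) * (p * (q * S - r * S')) ≤ -(48 / 100) * (p ^ 2 + L ^ 2) := by
      rw [one_div, inv_mul_le_iff₀ hS0]
      exact h5
    rw [e]
    apply mul_nonpos_of_nonneg_of_nonpos (by positivity)
    linarith
  exact nonpos_of_mul_nonpos_right h7 hp

/-- `log r - 2 / S - (log S) / 16` does not decrease. -/
theorem log_r_nonneg (hr : 0 < r) (hp : 0 < p) (hS : 8 / 5 ≤ S) :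
    0 ≤ q / r + 2 * S' / S ^ 2 - 1 / 16 * (S' / S) := by
  have h1 := (abs_le.mp h.null).1
  have h2 := abs_le.mp h.deriv_S
  have h5 := h.L_sq_ge hp hS
  have hS0 : 0 < S := by linarith
  have hp2 : 0 < p ^ 2 := by positivity
  have hN : 0 < p ^ 2 + L ^ 2 := by positivity
  set N := p ^ 2 + L ^ 2 with hNdef
  -- After division by `N` everything depends on `ℓ`, on `1/S ≈ 1 - ℓ` and on `s ≈ ℓ`. For `ℓ < 1/2`
  -- the geodesic moves inwards, `(2ℓ - 1)/2 < 0`, and the growth of `-2/S`, about `2ℓ(1 - ℓ)`,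
  -- compensates.
  set ℓ := L ^ 2 / N with hℓ
  have hLℓ : L ^ 2 = ℓ * N := by rw [hℓ]; field_simp
  have hpℓ : p ^ 2 = (1 - ℓ) * N := by linarith
  have hℓ1 : 36 / 100 ≤ ℓ := by rw [hℓ, le_div_iff₀ hN]; exact h5
  have hℓ2 : ℓ ≤ 1 := by rw [hℓ, div_le_one hN]; linarith
  set s := r * p * S' / (S * N) with hs
  have hSs : r * p * S' = s * (S * N) := by rw [hs]; field_simp
  have hSN : 0 < S * N := by positivity
  have hs1 : ℓ - 1 / 100 ≤ s := by
    rw [hs, le_div_iff₀ hSN]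
    rw [hLℓ] at h2
    linarith [h2.1]
  have hs2 : s ≤ ℓ + 1 / 100 := by
    rw [hs, div_le_iff₀ hSN]
    rw [hLℓ] at h2
    linarith [h2.2]
  have hSinv : (1 - ℓ) * (99 / 100) ≤ 1 / S := by
    rw [le_div_iff₀ hS0]
    have h7 := (abs_le.mp h.ratio).1
    rw [hpℓ] at h7
    have h8 : (S * (1 - ℓ)) * N ≤ 101 / 100 * N := by linarith
    have h9 := le_of_mul_le_mul_right h8 hN
    linarith
  have h6 : 0 ≤ r * p * (q / r + 2 * S' / S ^ 2 - 1 / 16 * (S' / S)) := by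
    have e : r * p * (q / r + 2 * S' / S ^ 2 - 1 / 16 * (S' / S))
        = (2 * p * q - (L ^ 2 - p ^ 2)) / 2 + (L ^ 2 - p ^ 2) / 2
          + 2 * (1 / S) * s * N - 1 / 16 * s * N := by
      rw [hs]; field_simp; ring
    have hs0 : 0 ≤ s := by linarith
    have h7 : 2 * ((1 - ℓ) * (99 / 100)) * s * N ≤ 2 * (1 / S) * s * N := by gcongr
    have h8 : 0 ≤ -(1 / 100) / 2 + (2 * ℓ - 1) / 2 + 2 * ((1 - ℓ) * (99 / 100)) * s - 1 / 16 * s := by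
      nlinarith
    have h9 : 0 ≤ (-(1 / 100) / 2 + (2 * ℓ - 1) / 2 + 2 * ((1 - ℓ) * (99 / 100)) * s
      - 1 / 16 * s) * N := by positivity
    rw [e]
    rw [hLℓ, hpℓ] at h1 ⊢
    linarith
  exact nonneg_of_mul_nonneg_right h6 (by positivity)

end NullEstimates

end RealEstimates

end

/-! ### Bounds for the deviation, adapted to the radial and angular parts of a vector. -/

section

section Directions

/-- The derivative of the direction `y / |y|`. -/
noncomputable def dirDeriv (y : E3) : E4 →L[ℝ] E3 :=
  ‖y‖⁻¹ • (ContinuousLinearMap.snd ℝ ℝ E3 -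
    ((innerSL ℝ (dir y)).comp (ContinuousLinearMap.snd ℝ ℝ E3)).smulRight (dir y))

theorem dirDeriv_apply (y : E3) (w : E4) : dirDeriv y w = ‖y‖⁻¹ • tang y w.2 := by
  simp [dirDeriv, tang]

theorem hasFDerivAt_dir_snd {z : E4} (hz : z.2 ≠ 0) :
    HasFDerivAt (fun z : E4 => dir z.2) (dirDeriv z.2) z := by
  have hn : ‖z.2‖ ≠ 0 := norm_ne_zero_iff.mpr hz
  have h1 := (hasDerivAt_inv hn).comp_hasFDerivAt (f := fun z : E4 => ‖z.2‖) z
    (hasFDerivAt_norm_snd hz)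
  have h2 := h1.smul (hasFDerivAt_snd (𝕜 := ℝ) (p := z))
  refine h2.congr_fderiv (ContinuousLinearMap.ext fun w => ?_)
  have h3 : z.2 = ‖z.2‖ • dir z.2 := by
    rw [dir, smul_smul, mul_inv_cancel₀ hn, one_smul]
  rw [dirDeriv_apply]
  simp only [Function.comp_apply, add_apply, smul_apply, ContinuousLinearMap.smulRight_apply,
    ContinuousLinearMap.comp_apply, ContinuousLinearMap.coe_snd', innerSL_apply_apply, smul_eq_mul,
    tang, smul_sub, smul_smul]
  generalize dir z.2 = x at *
  generalize ‖z.2‖ = r at *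
  rw [h3, smul_smul, sub_eq_add_neg, ← neg_smul]
  congr 2
  field_simp

theorem inner_dir_tang {y : E3} (hy : y ≠ 0) (v : E3) : inner ℝ (dir y) (tang y v) = 0 := by
  simp [tang, inner_sub_right, real_inner_smul_right, norm_dir hy]

theorem inner_tang_right {y : E3} (hy : y ≠ 0) (v w : E3) :
    inner ℝ v (tang y w) = inner ℝ (tang y v) (tang y w) := by
  rw [inner_tang_tang hy, tang, inner_sub_right, real_inner_smul_right, real_inner_comm v (dir y)]
  ring

theorem decompose_dir (y v : E3) : v = inner ℝ (dir y) v • dir y + tang y v := by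
  rw [tang]; abel

theorem vector_eq (k : E4) : k = k.1 • dU + (0, k.2) := by simp [dU]

theorem norm_spatial (v : E3) : ‖((0, v) : E4)‖ = ‖v‖ := by simp [Prod.norm_def]

theorem norm_dU : ‖dU‖ = 1 := by simp [dU, Prod.norm_def]

/-- Only `d(u + r)` varies, through the direction `y / |y|`; the Euclidean part is constant. -/
theorem fderiv_flatMetric_spatial {z : E4} (hz : z.2 ≠ 0) (v : E3) (k : E4) :
    fderiv ℝ (fun z : E4 => flatMetric z.2) z (0, v) k k
      = -2 * (k.1 + inner ℝ (dir z.2) k.2) * inner ℝ v (tang z.2 k.2) / ‖z.2‖ := by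
  have h := (differentiableAt_flatMetric hz).hasFDerivAt
  have h1 := (h.clm_apply (hasFDerivAt_const k z)).clm_apply (hasFDerivAt_const k z)
  have h2 : HasFDerivAt (fun z : E4 => k.1 + inner ℝ (dir z.2) k.2)
      ((innerSL ℝ k.2).comp (dirDeriv z.2)) z := by
    set φ : E3 →L[ℝ] ℝ := innerSL ℝ k.2 with hφ
    have h0 : HasFDerivAt φ φ (dir z.2) := φ.hasFDerivAt
    have := (h0.comp z (hasFDerivAt_dir_snd hz)).const_add k.1
    refine this.congr_of_eventuallyEq (Eventually.of_forall fun z => ?_)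
    simp [hφ, real_inner_comm]
  have h3 := (h2.mul h2).const_sub (inner ℝ k.2 k.2)
  have h5 := h3.congr_of_eventuallyEq (f₁ := fun z : E4 => flatMetric z.2 k k)
    (Eventually.of_forall fun z => flatMetric_apply _ _ _)
  have h6 := congrArg (fun L : E4 →L[ℝ] ℝ => L (0, v)) (h1.unique h5)
  have h7 : inner ℝ v (tang z.2 k.2) = inner ℝ k.2 (tang z.2 v) := by
    rw [inner_tang_right hz v, inner_tang_right hz k.2 v, real_inner_comm]
  simp only [add_apply, ContinuousLinearMap.flip_apply, ContinuousLinearMap.comp_apply,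
    zero_apply, map_zero, zero_add, neg_apply, smul_apply, innerSL_apply_apply,
    dirDeriv_apply, real_inner_smul_right, smul_eq_mul] at h6
  rw [h7]
  refine h6.trans ?_
  ring

/-- The vector in Euclidean space dual to the spatial part of a form. -/
noncomputable def spatialDual (φ : E4 →L[ℝ] ℝ) : E3 :=
  ∑ i, φ (0, EuclideanSpace.basisFun (Fin 3) ℝ i) • EuclideanSpace.basisFun (Fin 3) ℝ i

theorem inner_spatialDual (φ : E4 →L[ℝ] ℝ) (v : E3) : inner ℝ (spatialDual φ) v = φ (0, v) := by
  set b := EuclideanSpace.basisFun (Fin 3) ℝ with hb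
  have e : ((0, v) : E4) = ∑ i, inner ℝ (b i) v • ((0, b i) : E4) := by
    refine Prod.ext ?_ ?_
    · simp [Prod.fst_sum]
    · rw [Prod.snd_sum]
      exact (b.sum_repr' v).symm
  rw [e, spatialDual, sum_inner, map_sum]
  refine Finset.sum_congr rfl fun i _ => ?_
  rw [real_inner_smul_left, map_smul, smul_eq_mul, mul_comm]

end Directions

variable {M : Type*} [TopologicalSpace M] [ChartedSpace E4 M] [IsManifold 𝓘(ℝ, E4) 3 M]
  {X : Spacetime M}

namespace BondiChart

variable (B : BondiChart X)

/-- Bounds for the deviation from the Minkowski metric at a point. -/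
structure IsNearFlat (ε : ℝ) (z : E4) : Prop where
  pos : 0 ≤ ε
  small : ε ≤ 1 / 10000
  mem : B.R₀ < ‖z.2‖
  bound : ∀ V W : E4, |B.deviation z V W| ≤ ε * ‖V‖ * ‖W‖
  deriv_bound : ∀ (v : E3) (V W : E4), |fderiv ℝ B.deviation z (0, v) V W| ≤
    ε / ‖z.2‖ * ‖v‖ * ‖V‖ * ‖W‖

theorem exists_isNearFlat : ∃ R, B.R₀ ≤ R ∧ ∀ z : E4, R < ‖z.2‖ → B.IsNearFlat (1 / 10000) z := by
  obtain ⟨C, R, hC, hR, h⟩ := B.exists_deviation_bound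
  refine ⟨max R (10000 * C), hR.trans (le_max_left _ _), fun z hz => ?_⟩
  have hzR : R < ‖z.2‖ := (le_max_left _ _).trans_lt hz
  have hzC : 10000 * C < ‖z.2‖ := (le_max_right _ _).trans_lt hz
  have hpos : 0 < ‖z.2‖ := B.R₀_pos.trans (hR.trans_lt hzR)
  have hε : C / ‖z.2‖ ≤ 1 / 10000 := by rw [div_le_iff₀ hpos]; linarith
  obtain ⟨h1, h2⟩ := h z.1 z.2 hzR
  refine ⟨by norm_num, le_rfl, hR.trans_lt hzR, fun V W => (h1 V W).trans ?_,
    fun v V W => (h2 v V W).trans ?_⟩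
  · gcongr
  · gcongr

/-- The spatial momentum `g(k, ∂_y)` of a vector `k`. -/
noncomputable def momentum (z k : E4) : E3 := spatialDual (B.coordForm z k)

theorem inner_momentum (z k : E4) (v : E3) :
    inner ℝ (B.momentum z k) v = B.coordForm z k (0, v) := inner_spatialDual _ _

/-- The radial momentum, with the opposite sign. -/
noncomputable def radialMomentum (z k : E4) : ℝ := -inner ℝ (B.momentum z k) (dir z.2)

theorem coordForm_eq (z V W : E4) :
    B.coordForm z V W = flatMetric z.2 V W + B.deviation z V W := by
  simp [deviation]

variable {B} {ε : ℝ} {z : E4} (h : B.IsNearFlat ε z)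
include h

namespace IsNearFlat

theorem snd_ne : z.2 ≠ 0 := B.snd_ne_zero h.mem

theorem norm_pos : 0 < ‖z.2‖ := norm_pos_iff.mpr h.snd_ne

theorem deviation_dir_spatial (w : E3) : B.deviation z (0, dir z.2) (0, w) = 0 :=
  B.deviation_dir (u := z.1) h.mem w

theorem deviation_spatial (v w : E3) :
    B.deviation z (0, v) (0, w) = B.deviation z (0, tang z.2 v) (0, w) := by
  have e : ((0, v) : E4) = inner ℝ (dir z.2) v • (0, dir z.2) + (0, tang z.2 v) := by
    refine Prod.ext (by simp) ?_
    simpa using decompose_dir z.2 v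
  conv_lhs => rw [e]
  simp only [map_add, map_smul, add_apply, smul_apply, h.deviation_dir_spatial, smul_zero,
    zero_add]

/-- The radial part of `k` drops out by the Bondi gauge, so that `k^r`, which may be much larger
than the other components, is absent. -/
theorem abs_deviation_spatial_le {k : E4} (hk : 0 ≤ k.1) (w : E3) :
    |B.deviation z k (0, w)| ≤ ε * (k.1 + ‖tang z.2 k.2‖) * ‖w‖ := by
  have e : B.deviation z k (0, w) = k.1 * B.deviation z dU (0, w)
      + B.deviation z (0, tang z.2 k.2) (0, w) := by
    rw [← h.deviation_spatial]
    conv_lhs => rw [vector_eq k]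
    simp only [map_add, map_smul, add_apply, smul_apply, smul_eq_mul]
  have h1 := h.bound dU (0, w)
  have h2 := h.bound (0, tang z.2 k.2) (0, w)
  rw [norm_spatial, norm_dU] at h1
  rw [norm_spatial, norm_spatial] at h2
  rw [e]
  refine (abs_add_le _ _).trans ?_
  rw [abs_mul, abs_of_nonneg hk]
  have h3 : k.1 * |B.deviation z dU (0, w)| ≤ k.1 * (ε * 1 * ‖w‖) := by gcongr
  linarith

theorem abs_deviation_dir_le {k : E4} (hk : 0 ≤ k.1) :
    |B.deviation z k (0, dir z.2)| ≤ ε * k.1 := by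
  have e : B.deviation z k (0, dir z.2) = k.1 * B.deviation z dU (0, dir z.2) := by
    have h0 : B.deviation z (0, k.2) (0, dir z.2) = 0 := by
      rw [B.deviation_symm h.mem, h.deviation_dir_spatial]
    conv_lhs => rw [vector_eq k]
    simp only [map_add, map_smul, add_apply, smul_apply, smul_eq_mul, h0, add_zero]
  have h1 := h.bound dU (0, dir z.2)
  rw [norm_spatial, norm_dU, norm_dir h.snd_ne] at h1
  rw [e, abs_mul, abs_of_nonneg hk]
  have h3 : k.1 * |B.deviation z dU (0, dir z.2)| ≤ k.1 * (ε * 1 * 1) := by gcongr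
  linarith

theorem norm_spatial_le (v : E3) : ‖v‖ ≤ |inner ℝ (dir z.2) v| + ‖tang z.2 v‖ := by
  conv_lhs => rw [decompose_dir z.2 v]
  refine (norm_add_le _ _).trans ?_
  rw [norm_smul, norm_dir h.snd_ne, mul_one, Real.norm_eq_abs]

theorem norm_vector_le {k : E4} (hk : 0 ≤ k.1) :
    ‖k‖ ≤ k.1 + |inner ℝ (dir z.2) k.2| + ‖tang z.2 k.2‖ := by
  rw [Prod.norm_def, Real.norm_eq_abs, abs_of_nonneg hk]
  have h3 := h.norm_spatial_le k.2
  have h4 := abs_nonneg (inner ℝ (dir z.2) k.2)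
  have h5 := norm_nonneg (tang z.2 k.2)
  exact max_le (by linarith) (by linarith)

theorem abs_deviation_dU_le {k : E4} (hk : 0 ≤ k.1) :
    |B.deviation z dU k| ≤ ε * (k.1 + |inner ℝ (dir z.2) k.2| + ‖tang z.2 k.2‖) := by
  have h1 := h.bound dU k
  rw [norm_dU] at h1
  have h2 := h.norm_vector_le hk
  refine h1.trans ?_
  rw [mul_one]
  have := h.pos
  gcongr

/-- Without `rr` and `rI` components, `k^r` can enter only through its product with `k^u`, which the
null relation controls. -/
theorem abs_deviation_self_le {k : E4} (hk : 0 ≤ k.1) :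
    |B.deviation z k k| ≤ ε * (k.1 ^ 2 + 2 * (k.1 * |inner ℝ (dir z.2) k.2|)
      + 2 * (k.1 * ‖tang z.2 k.2‖) + ‖tang z.2 k.2‖ ^ 2) := by
  set ζ := tang z.2 k.2 with hζ
  have h0 : B.deviation z (0, k.2) (0, k.2) = B.deviation z (0, ζ) (0, ζ) := by
    rw [h.deviation_spatial, B.deviation_symm h.mem, h.deviation_spatial]
  have e : B.deviation z k k = k.1 ^ 2 * B.deviation z dU dU
      + 2 * k.1 * B.deviation z dU (0, k.2) + B.deviation z (0, ζ) (0, ζ) := by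
    rw [← h0]
    conv_lhs => rw [vector_eq k]
    simp only [map_add, map_smul, add_apply, smul_apply, smul_eq_mul,
      B.deviation_symm h.mem (0, k.2) dU]
    ring
  have h1 := h.bound dU dU
  have h2 := h.bound dU (0, k.2)
  have h3 := h.bound (0, ζ) (0, ζ)
  simp only [norm_spatial, norm_dU, mul_one] at h1 h2 h3
  have h4 := h.norm_spatial_le k.2
  have hε := h.pos
  rw [e]
  calc _ ≤ |k.1 ^ 2 * B.deviation z dU dU| + |2 * k.1 * B.deviation z dU (0, k.2)|
      + |B.deviation z (0, ζ) (0, ζ)| :=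
        (abs_add_le _ _).trans (add_le_add_left (abs_add_le _ _) _)
    _ ≤ k.1 ^ 2 * ε + 2 * k.1 * (ε * (|inner ℝ (dir z.2) k.2| + ‖ζ‖)) + ε * ‖ζ‖ * ‖ζ‖ := by
        rw [abs_mul, abs_mul, abs_of_nonneg (by positivity : 0 ≤ k.1 ^ 2),
          abs_of_nonneg (by positivity : 0 ≤ 2 * k.1)]
        gcongr
        exact h2.trans (by gcongr)
    _ = _ := by ring

/-- Differentiating `deviation_dir_spatial`. -/
theorem fderiv_deviation_dir (v w : E3) :
    fderiv ℝ B.deviation z (0, v) (0, dir z.2) (0, w)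
      = -(‖z.2‖⁻¹ * B.deviation z (0, tang z.2 v) (0, w)) := by
  have h1 := (B.differentiableAt_deviation h.mem).hasFDerivAt
  have h2 : HasFDerivAt (fun z : E4 => ((0, dir z.2) : E4))
      ((ContinuousLinearMap.inr ℝ ℝ E3).comp (dirDeriv z.2)) z :=
    ((ContinuousLinearMap.inr ℝ ℝ E3).hasFDerivAt (x := dir z.2)).comp z
      (hasFDerivAt_dir_snd h.snd_ne)
  have h3 := (h1.clm_apply h2).clm_apply (hasFDerivAt_const ((0, w) : E4) z)
  have h4 : (fun z : E4 => B.deviation z (0, dir z.2) (0, w)) =ᶠ[𝓝 z] fun _ => (0 : ℝ) := by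
    have : {z : E4 | B.R₀ < ‖z.2‖} ∈ 𝓝 z :=
      (isOpen_lt continuous_const continuous_snd.norm).mem_nhds h.mem
    filter_upwards [this] with z' hz'
    exact B.deviation_dir (u := z'.1) hz' w
  have h5 := h3.unique ((hasFDerivAt_const (0 : ℝ) z).congr_of_eventuallyEq h4)
  have h6 := congrArg (fun L : E4 →L[ℝ] ℝ => L (0, v)) h5
  simp only [add_apply, ContinuousLinearMap.flip_apply, ContinuousLinearMap.comp_apply,
    zero_apply, map_zero, zero_add, ContinuousLinearMap.inr_apply, dirDeriv_apply,
    map_smul, smul_apply, smul_eq_mul] at h6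
  linarith

theorem fderiv_deviation_dir_dir (v : E3) :
    fderiv ℝ B.deviation z (0, v) (0, dir z.2) (0, dir z.2) = 0 := by
  rw [h.fderiv_deviation_dir, B.deviation_symm h.mem, h.deviation_dir_spatial]
  simp

/-- The direction `y / |y|` is constant along radial lines, so the vanishing components may be
differentiated directly. This removes the product of `k^r` and `L` from the radial estimate. -/
theorem fderiv_deviation_radial (w : E3) :
    fderiv ℝ B.deviation z (0, dir z.2) (0, dir z.2) (0, w) = 0 := by
  rw [h.fderiv_deviation_dir, tang_dir h.snd_ne]
  have : ((0, 0) : E4) = 0 := rfl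
  simp [this]

theorem fderiv_deviation_symm (x V W : E4) :
    fderiv ℝ B.deviation z x V W = fderiv ℝ B.deviation z x W V := by
  rw [← B.fderiv_deviation_apply h.mem, ← B.fderiv_deviation_apply h.mem]
  have h4 : (fun z : E4 => B.deviation z V W) =ᶠ[𝓝 z] fun z => B.deviation z W V := by
    have : {z : E4 | B.R₀ < ‖z.2‖} ∈ 𝓝 z :=
      (isOpen_lt continuous_const continuous_snd.norm).mem_nhds h.mem
    filter_upwards [this] with z' hz'
    exact B.deviation_symm hz' V W
  rw [h4.fderiv_eq]

theorem fderiv_deviation_self (v : E3) (k : E4) :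
    fderiv ℝ B.deviation z (0, v) k k = k.1 ^ 2 * fderiv ℝ B.deviation z (0, v) dU dU
      + 2 * k.1 * fderiv ℝ B.deviation z (0, v) dU (0, k.2)
      + fderiv ℝ B.deviation z (0, v) (0, tang z.2 k.2) (0, tang z.2 k.2)
      + 2 * inner ℝ (dir z.2) k.2 *
        fderiv ℝ B.deviation z (0, v) (0, dir z.2) (0, tang z.2 k.2) := by
  have e : ((0, k.2) : E4) = inner ℝ (dir z.2) k.2 • (0, dir z.2) + (0, tang z.2 k.2) := by
    refine Prod.ext (by simp) ?_
    simpa using decompose_dir z.2 k.2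
  have h1 : fderiv ℝ B.deviation z (0, v) (0, k.2) (0, k.2)
      = fderiv ℝ B.deviation z (0, v) (0, tang z.2 k.2) (0, tang z.2 k.2)
      + 2 * inner ℝ (dir z.2) k.2 *
        fderiv ℝ B.deviation z (0, v) (0, dir z.2) (0, tang z.2 k.2) := by
    rw [e]
    simp only [map_add, map_smul, add_apply, smul_apply, smul_eq_mul, h.fderiv_deviation_dir_dir,
      h.fderiv_deviation_symm _ (0, tang z.2 k.2) (0, dir z.2)]
    ring
  conv_lhs => rw [vector_eq k]
  simp only [map_add, map_smul, add_apply, smul_apply, smul_eq_mul, h1,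
    h.fderiv_deviation_symm _ (0, k.2) dU]
  ring

theorem abs_fderiv_deviation_self_le (v : E3) {k : E4} (hk : 0 ≤ k.1) :
    ‖z.2‖ * |fderiv ℝ B.deviation z (0, v) k k| ≤ ε * ‖v‖ * (k.1 ^ 2
      + 2 * (k.1 * |inner ℝ (dir z.2) k.2|) + 2 * (k.1 * ‖tang z.2 k.2‖) + ‖tang z.2 k.2‖ ^ 2
      + 2 * (|inner ℝ (dir z.2) k.2| * ‖tang z.2 k.2‖)) := by
  have h1 := h.deriv_bound v dU dU
  have h2 := h.deriv_bound v dU (0, k.2)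
  have h3 := h.deriv_bound v (0, tang z.2 k.2) (0, tang z.2 k.2)
  have h5 := h.deriv_bound v (0, dir z.2) (0, tang z.2 k.2)
  simp only [norm_spatial, norm_dU, mul_one, norm_dir h.snd_ne] at h1 h2 h3 h5
  have h4 := h.norm_spatial_le k.2
  have hr := h.norm_pos
  rw [h.fderiv_deviation_self]
  generalize fderiv ℝ B.deviation z (0, v) = D at *
  generalize inner ℝ (dir z.2) k.2 = q at *
  have hε : 0 ≤ ε / ‖z.2‖ * ‖v‖ := by have := h.pos; positivity
  have hD : |k.1 ^ 2 * D dU dU + 2 * k.1 * D dU (0, k.2) + D (0, tang z.2 k.2) (0, tang z.2 k.2)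
      + 2 * q * D (0, dir z.2) (0, tang z.2 k.2)| ≤ k.1 ^ 2 * (ε / ‖z.2‖ * ‖v‖)
      + 2 * k.1 * (ε / ‖z.2‖ * ‖v‖ * (|q| + ‖tang z.2 k.2‖))
      + ε / ‖z.2‖ * ‖v‖ * ‖tang z.2 k.2‖ * ‖tang z.2 k.2‖
      + 2 * |q| * (ε / ‖z.2‖ * ‖v‖ * ‖tang z.2 k.2‖) := by
    refine (abs_add_le _ _).trans (add_le_add ((abs_add_le _ _).trans (add_le_add
      ((abs_add_le _ _).trans (add_le_add ?_ ?_)) h3)) ?_)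
    · rw [abs_mul, abs_of_nonneg (by positivity : 0 ≤ k.1 ^ 2)]
      gcongr
    · rw [abs_mul, abs_of_nonneg (by positivity : 0 ≤ 2 * k.1)]
      gcongr
      exact h2.trans (by gcongr)
    · rw [abs_mul, abs_mul, abs_two]
      gcongr
  calc _ ≤ _ := mul_le_mul_of_nonneg_left hD hr.le
    _ = _ := by field_simp; ring

theorem abs_fderiv_deviation_radial_le {k : E4} (hk : 0 ≤ k.1) :
    ‖z.2‖ * |fderiv ℝ B.deviation z (0, dir z.2) k k| ≤ ε * (k.1 ^ 2
      + 2 * (k.1 * |inner ℝ (dir z.2) k.2|) + 2 * (k.1 * ‖tang z.2 k.2‖)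
      + ‖tang z.2 k.2‖ ^ 2) := by
  have h1 := h.deriv_bound (dir z.2) dU dU
  have h2 := h.deriv_bound (dir z.2) dU (0, k.2)
  have h3 := h.deriv_bound (dir z.2) (0, tang z.2 k.2) (0, tang z.2 k.2)
  simp only [norm_spatial, norm_dU, mul_one, norm_dir h.snd_ne] at h1 h2 h3
  have h4 := h.norm_spatial_le k.2
  have hr := h.norm_pos
  rw [h.fderiv_deviation_self, h.fderiv_deviation_radial, mul_zero, add_zero]
  generalize fderiv ℝ B.deviation z (0, dir z.2) = D at *
  generalize inner ℝ (dir z.2) k.2 = q at *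
  have hε : 0 ≤ ε / ‖z.2‖ := by have := h.pos; positivity
  have hD : |k.1 ^ 2 * D dU dU + 2 * k.1 * D dU (0, k.2) + D (0, tang z.2 k.2) (0, tang z.2 k.2)|
      ≤ k.1 ^ 2 * (ε / ‖z.2‖) + 2 * k.1 * (ε / ‖z.2‖ * (|q| + ‖tang z.2 k.2‖))
      + ε / ‖z.2‖ * ‖tang z.2 k.2‖ * ‖tang z.2 k.2‖ := by
    refine (abs_add_le _ _).trans (add_le_add ((abs_add_le _ _).trans (add_le_add ?_ ?_)) h3)
    · rw [abs_mul, abs_of_nonneg (by positivity : 0 ≤ k.1 ^ 2)]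
      gcongr
    · rw [abs_mul, abs_of_nonneg (by positivity : 0 ≤ 2 * k.1)]
      gcongr
      exact h2.trans (by gcongr)
  calc _ ≤ _ := mul_le_mul_of_nonneg_left hD hr.le
    _ = _ := by field_simp; ring

end IsNearFlat

end BondiChart

end

/-! ### Momenta and their evolution along null geodesics. -/

section

variable {M : Type*} [TopologicalSpace M] [ChartedSpace E4 M] [IsManifold 𝓘(ℝ, E4) 3 M]
  {X : Spacetime M} {B : BondiChart X}

namespace BondiChart

variable (B) in
/-- The ratio `|π|² / π_r²`. -/
noncomputable def momentumRatio (z k : E4) : ℝ := ‖B.momentum z k‖ ^ 2 / B.radialMomentum z k ^ 2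

variable (B) in
/-- The rate of change of the radial momentum along a geodesic. -/
noncomputable def radialMomentumDeriv (z k : E4) : ℝ :=
  -(1 / 2 * fderiv ℝ B.deviation z (0, dir z.2) k k)
    - inner ℝ (B.momentum z k) (tang z.2 k.2) / ‖z.2‖

variable (B) in
/-- The rate of change of `|π|² / π_r²` along a geodesic. -/
noncomputable def momentumRatioDeriv (z k : E4) : ℝ :=
  ((-2 * (k.1 + inner ℝ (dir z.2) k.2) * inner ℝ (B.momentum z k) (tang z.2 k.2) / ‖z.2‖
      + fderiv ℝ B.deviation z (0, B.momentum z k) k k) * B.radialMomentum z k ^ 2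
    - ‖B.momentum z k‖ ^ 2 * (2 * B.radialMomentum z k * B.radialMomentumDeriv z k))
    / (B.radialMomentum z k ^ 2) ^ 2

theorem inner_momentum_eq (B : BondiChart X) (z k : E4) (v : E3) : inner ℝ (B.momentum z k) v
    = inner ℝ (tang z.2 k.2 - k.1 • dir z.2) v + B.deviation z k (0, v) := by
  rw [B.inner_momentum, B.coordForm_eq, flatMetric_apply, tang, inner_sub_left, inner_sub_left,
    real_inner_smul_left, real_inner_smul_left]
  ring

namespace IsNearFlat

variable {ε : ℝ} {z : E4} (h : B.IsNearFlat ε z)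
include h

theorem fderiv_coordForm (v : E3) (k : E4) :
    fderiv ℝ (coordMetric X.metric B.chart) z (0, v) k k
      = -2 * (k.1 + inner ℝ (dir z.2) k.2) * inner ℝ v (tang z.2 k.2) / ‖z.2‖
        + fderiv ℝ B.deviation z (0, v) k k := by
  have h1 := (differentiableAt_flatMetric h.snd_ne).hasFDerivAt
  have h2 := (B.differentiableAt_deviation h.mem).hasFDerivAt
  have h3 : coordMetric X.metric B.chart = fun z => flatMetric z.2 + B.deviation z := by
    funext z
    simp [deviation, coordForm]
  rw [h3, (h1.fun_add h2).fderiv, ← fderiv_flatMetric_spatial h.snd_ne]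
  rfl

theorem norm_sq_main (k : E4) :
    ‖tang z.2 k.2 - k.1 • dir z.2‖ ^ 2 = k.1 ^ 2 + ‖tang z.2 k.2‖ ^ 2 := by
  rw [norm_sub_sq_real, real_inner_smul_right, real_inner_comm, inner_dir_tang h.snd_ne,
    norm_smul, norm_dir h.snd_ne, mul_one, Real.norm_eq_abs, sq_abs]
  ring

theorem radialMomentum_eq (k : E4) :
    B.radialMomentum z k = k.1 - B.deviation z k (0, dir z.2) := by
  rw [radialMomentum, B.inner_momentum_eq, inner_sub_left, real_inner_comm,
    inner_dir_tang h.snd_ne, real_inner_smul_left, real_inner_self_eq_norm_sq, norm_dir h.snd_ne]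
  ring

theorem abs_radialMomentum_sub_le {k : E4} (hk : 0 ≤ k.1) :
    |B.radialMomentum z k - k.1| ≤ ε * k.1 := by
  rw [h.radialMomentum_eq, sub_sub_cancel_left, abs_neg]
  exact h.abs_deviation_dir_le hk

theorem abs_inner_momentum_tang_le {k : E4} (hk : 0 ≤ k.1) :
    |inner ℝ (B.momentum z k) (tang z.2 k.2) - ‖tang z.2 k.2‖ ^ 2|
      ≤ ε * (‖tang z.2 k.2‖ * (k.1 + ‖tang z.2 k.2‖)) := by
  have h1 := h.abs_deviation_spatial_le hk (tang z.2 k.2)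
  rw [B.inner_momentum_eq, inner_sub_left, real_inner_self_eq_norm_sq, real_inner_smul_left,
    inner_dir_tang h.snd_ne]
  refine le_of_eq_of_le ?_ (h1.trans (le_of_eq ?_))
  · congr 1; ring
  · ring

/-- The momentum is the flat one, of square `p² + L²`, plus the vector `d` dual to the deviation
contracted with `k`. -/
theorem abs_norm_momentum_sq_sub_le {k : E4} (hk : 0 ≤ k.1) :
    |‖B.momentum z k‖ ^ 2 - (k.1 ^ 2 + ‖tang z.2 k.2‖ ^ 2)|
      ≤ 5 * ε * (k.1 ^ 2 + ‖tang z.2 k.2‖ ^ 2) := by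
  set v := tang z.2 k.2 - k.1 • dir z.2 with hv
  set d := B.momentum z k - v with hd
  have hm : B.momentum z k = v + d := by rw [hd]; abel
  have hdw : ∀ w, inner ℝ d w = B.deviation z k (0, w) := fun w => by
    rw [hd, inner_sub_left, B.inner_momentum_eq]; ring
  set p := k.1
  set L := ‖tang z.2 k.2‖ with hL
  have hL0 : 0 ≤ L := norm_nonneg _
  have hε := h.pos
  have hdn : ‖d‖ ≤ ε * (p + L) := by
    by_cases hd0 : ‖d‖ = 0
    · rw [hd0]; positivity
    -- Duality: `d` is tested against itself.
    have h1 : ‖d‖ ^ 2 ≤ ε * (p + L) * ‖d‖ := by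
      rw [← real_inner_self_eq_norm_sq, hdw]
      exact (le_abs_self _).trans (h.abs_deviation_spatial_le hk d)
    have h2 : 0 < ‖d‖ := lt_of_le_of_ne (norm_nonneg _) (Ne.symm hd0)
    rw [sq] at h1
    exact le_of_mul_le_mul_right h1 h2
  have hdn2 : ‖d‖ ^ 2 ≤ 2 * ε * (p ^ 2 + L ^ 2) := by
    have h3 : ‖d‖ ^ 2 ≤ (ε * (p + L)) ^ 2 := by gcongr
    have h4 : (ε * (p + L)) ^ 2 ≤ ε * (2 * (p ^ 2 + L ^ 2)) := by
      have h5 : (p + L) ^ 2 ≤ 2 * (p ^ 2 + L ^ 2) := by nlinarith [sq_nonneg (p - L)]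
      have h6 : ε ^ 2 ≤ ε := by nlinarith [h.small]
      calc (ε * (p + L)) ^ 2 = ε ^ 2 * (p + L) ^ 2 := by ring
        _ ≤ ε * (2 * (p ^ 2 + L ^ 2)) := by gcongr
    linarith
  have hvd : |inner ℝ v d| ≤ 3 / 2 * (ε * (p ^ 2 + L ^ 2)) := by
    have e : inner ℝ v d = B.deviation z k (0, tang z.2 k.2) - p * B.deviation z k (0, dir z.2) := by
      rw [real_inner_comm, ← hdw, ← hdw, hv, inner_sub_right, real_inner_smul_right]
    have h1 := h.abs_deviation_spatial_le hk (tang z.2 k.2)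
    have h2 := h.abs_deviation_dir_le hk
    rw [e]
    refine (abs_sub _ _).trans ?_
    rw [abs_mul, abs_of_nonneg hk]
    have h3 : p * |B.deviation z k (0, dir z.2)| ≤ p * (ε * p) := by gcongr
    have h4 : ε * (2 * (p * L)) ≤ ε * (p ^ 2 + L ^ 2) := by
      gcongr
      nlinarith [sq_nonneg (p - L)]
    have h5 : 0 ≤ ε * p ^ 2 := by positivity
    have h6 : ε * (p + L) * L = ε * (p * L) + ε * L ^ 2 := by ring
    nlinarith
  rw [hm, norm_add_sq_real, h.norm_sq_main]
  have h7 := abs_le.mp hvd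
  have h8 : 0 ≤ ‖d‖ ^ 2 := by positivity
  rw [abs_le]
  constructor <;> linarith

theorem abs_null_le {k : E4} (hk : 0 ≤ k.1) (hnull : B.coordForm z k k = 0) :
    |2 * k.1 * inner ℝ (dir z.2) k.2 - (‖tang z.2 k.2‖ ^ 2 - k.1 ^ 2)|
      ≤ ε * (k.1 ^ 2 + 2 * (k.1 * |inner ℝ (dir z.2) k.2|)
      + 2 * (k.1 * ‖tang z.2 k.2‖) + ‖tang z.2 k.2‖ ^ 2) := by
  refine le_of_eq_of_le ?_ (h.abs_deviation_self_le hk)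
  rw [B.coordForm_eq, flatMetric_apply] at hnull
  have h1 := inner_tang_tang h.snd_ne k.2 k.2
  rw [real_inner_self_eq_norm_sq (tang z.2 k.2)] at h1
  congr 1
  rw [h1]
  linarith

theorem nullEstimates {k : E4} (hk : 0 < k.1) (hnull : B.coordForm z k k = 0) :
    NullEstimates ‖z.2‖ k.1 (inner ℝ (dir z.2) k.2) ‖tang z.2 k.2‖ (B.momentumRatio z k)
      (B.momentumRatioDeriv z k) (B.radialMomentum z k) (B.radialMomentumDeriv z k) := by
  refine nullEstimates_of_bounds h.norm_pos h.pos h.small hk (norm_nonneg _) (norm_nonneg _)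
    (h.abs_inner_momentum_tang_le hk.le) (h.abs_radialMomentum_sub_le hk.le)
    (h.abs_norm_momentum_sq_sub_le hk.le) (h.abs_null_le hk.le hnull) ?_
    (h.abs_fderiv_deviation_self_le _ hk.le)
  have h1 := h.abs_fderiv_deviation_radial_le hk.le
  rw [abs_mul, abs_of_pos (by norm_num : (0 : ℝ) < 1 / 2)]
  have := h.norm_pos
  have h2 : 0 ≤ ‖z.2‖ * |fderiv ℝ B.deviation z (0, dir z.2) k k| := by positivity
  linarith

/-- Null vectors with `k^u > 0` are future directed. -/
theorem coordForm_dU_neg {k : E4} (hk : 0 < k.1) (hnull : B.coordForm z k k = 0) :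
    B.coordForm z dU k < 0 := by
  have h1 := h.abs_deviation_dU_le hk.le
  have h2 := abs_le.mp (h.nullEstimates hk hnull).null
  have h3 : B.coordForm z dU k = -(k.1 + inner ℝ (dir z.2) k.2) + B.deviation z dU k := by
    rw [B.coordForm_eq, flatMetric_apply]; simp [dU]
  set q := inner ℝ (dir z.2) k.2
  set L := ‖tang z.2 k.2‖
  set p := k.1
  have hε := h.small
  have h4 : p * |q| ≤ p ^ 2 + L ^ 2 := by
    have : |p * q| ≤ p ^ 2 + L ^ 2 := abs_le.mpr ⟨by nlinarith, by nlinarith⟩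
    rwa [abs_mul, abs_of_pos hk] at this
  have h5 : 2 * (p * L) ≤ p ^ 2 + L ^ 2 := by nlinarith [sq_nonneg (p - L)]
  have h6 : |B.deviation z dU k| ≤ 1 / 10000 * (p + |q| + L) :=
    h1.trans (by have := abs_nonneg q; have := norm_nonneg (tang z.2 k.2); gcongr)
  -- The flat value is `-p(p + q) = -(p² + L²)/2` by the null relation.
  have h7 : p * B.coordForm z dU k < 0 := by
    have h8 : p * B.deviation z dU k ≤ p * (1 / 10000 * (p + |q| + L)) := by
      gcongr; exact (le_abs_self _).trans h6
    have : 0 < p ^ 2 := by positivity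
    rw [h3]
    nlinarith [sq_nonneg L]
  exact neg_of_mul_neg_right h7 hk.le

theorem coordForm_dU_dU_neg : B.coordForm z dU dU < 0 := by
  have h1 := h.bound dU dU
  have h2 : B.coordForm z dU dU = -1 + B.deviation z dU dU := by
    rw [B.coordForm_eq, flatMetric_apply]; simp [dU]
  simp only [norm_dU, mul_one] at h1
  have := (abs_le.mp h1).2
  have := h.small
  linarith

end IsNearFlat

section AlongGeodesics

variable {ε : ℝ} {z k : ℝ → E4} {t : ℝ} (h : B.IsNearFlat ε (z t)) (hz : HasDerivAt z (k t) t)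
  (hk : HasDerivAt k (geodesicAcceleration (coordMetric X.metric B.chart (z t))
      (fderiv ℝ (coordMetric X.metric B.chart) (z t)) (k t)) t)
include h hz

theorem hasDerivAt_norm_snd : HasDerivAt (fun s => ‖(z s).2‖) (inner ℝ (dir (z t).2) (k t).2) t := by
  have h1 := (hasFDerivAt_norm_snd h.snd_ne).comp_hasDerivAt t hz
  simpa [Function.comp_def] using h1

include hk

/-- The Euler–Lagrange equation for the constant fields `(0, e_i)`: only `y`-derivatives of the
metric appear. -/
theorem hasDerivAt_momentum : HasDerivAt (fun s => B.momentum (z s) (k s))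
    (spatialDual ((1 / 2 : ℝ) •
      ((fderiv ℝ (coordMetric X.metric B.chart) (z t)).flip (k t)).flip (k t))) t := by
  have hzt : z t ∈ B.chart.target := B.mem_target (z t).1 (z t).2 h.mem
  unfold momentum spatialDual
  refine HasDerivAt.fun_sum fun i _ => HasDerivAt.smul_const ?_ _
  exact Spacetime.hasDerivAt_coordMetric_apply B.chart_mem hzt hz hk _

/-- The flat metric exerts no radial force, as its radial derivative vanishes. The main term comes
from the rotation of `dir` along the curve. -/
theorem hasDerivAt_radialMomentum :
    HasDerivAt (fun s => B.radialMomentum (z s) (k s)) (B.radialMomentumDeriv (z t) (k t)) t := by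
  have h1 := hasDerivAt_momentum h hz hk
  have h2 := (hasFDerivAt_dir_snd h.snd_ne).comp_hasDerivAt t hz
  have h3 := (h1.inner ℝ h2).fun_neg
  refine h3.congr_deriv ?_
  simp only [Function.comp_apply, dirDeriv_apply, inner_spatialDual, smul_apply,
    ContinuousLinearMap.flip_apply, smul_eq_mul, h.fderiv_coordForm, radialMomentumDeriv,
    real_inner_smul_right, inner_dir_tang h.snd_ne]
  ring

theorem hasDerivAt_momentumRatio (hp : B.radialMomentum (z t) (k t) ≠ 0) :
    HasDerivAt (fun s => B.momentumRatio (z s) (k s)) (B.momentumRatioDeriv (z t) (k t)) t := by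
  have h1 := (hasDerivAt_momentum h hz hk).norm_sq
  have h2 := (hasDerivAt_radialMomentum h hz hk).fun_pow 2
  have h3 := h1.fun_div h2 (pow_ne_zero 2 hp)
  refine h3.congr_deriv ?_
  rw [real_inner_comm, inner_spatialDual, smul_apply, ContinuousLinearMap.flip_apply,
    ContinuousLinearMap.flip_apply, smul_eq_mul, h.fderiv_coordForm, momentumRatioDeriv]
  congr 1
  push_cast
  ring

end AlongGeodesics

end BondiChart

end

/-! ### Escape of null geodesics at large radius. -/

section

section UpperEnd

theorem monotoneOn_of_hasDerivAt {D : Set ℝ} (hD : Convex ℝ D) {f f' : ℝ → ℝ}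
    (hf : ∀ t ∈ D, HasDerivAt f (f' t) t) (hf' : ∀ t ∈ D, 0 ≤ f' t) : MonotoneOn f D := by
  refine monotoneOn_of_deriv_nonneg hD (fun t ht => (hf t ht).continuousAt.continuousWithinAt)
    (fun t ht => (hf t (interior_subset ht)).differentiableAt.differentiableWithinAt) fun t ht => ?_
  rw [(hf t (interior_subset ht)).deriv]
  exact hf' t (interior_subset ht)

theorem convex_paramInterval (a : ℝ) (b : EReal) : Convex ℝ (paramInterval a b) := by
  refine OrdConnected.convex ⟨fun x hx y hy t ht => ⟨hx.1.trans_le ht.1, ?_⟩⟩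
  exact (EReal.coe_le_coe_iff.mpr ht.2).trans_lt hy.2

/-- The parameter interval `[0, b)`. -/
def forwardInterval (b : EReal) : Set ℝ := {t | 0 ≤ t ∧ (t : EReal) < b}

theorem convex_forwardInterval (b : EReal) : Convex ℝ (forwardInterval b) := by
  refine OrdConnected.convex ⟨fun x hx y hy t ht => ⟨hx.1.trans ht.1, ?_⟩⟩
  exact (EReal.coe_le_coe_iff.mpr ht.2).trans_lt hy.2

theorem eventually_upperEnd {b : EReal} {t₀ : ℝ} (h : (t₀ : EReal) < b) :
    ∀ᶠ t in upperEnd b, t₀ < t ∧ (t : EReal) < b := by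
  have : Ioo (t₀ : EReal) b ∈ 𝓝[<] b := Ioo_mem_nhdsLT h
  filter_upwards [preimage_mem_comap this] with t ht
  exact ⟨EReal.coe_lt_coe_iff.mp ht.1, ht.2⟩

variable {b : EReal} {f : ℝ → ℝ}

theorem tendsto_atTop_of_monotoneOn (hf : MonotoneOn f (forwardInterval b))
    (h : ∀ C, ∃ t ∈ forwardInterval b, C ≤ f t) : Tendsto f (upperEnd b) atTop := by
  rw [tendsto_atTop]
  intro C
  obtain ⟨t₀, ht₀, hC⟩ := h C
  filter_upwards [eventually_upperEnd ht₀.2] with t ht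
  exact hC.trans (hf ht₀ ⟨ht₀.1.trans ht.1.le, ht.2⟩ ht.1.le)

theorem exists_tendsto_of_monotoneOn (hb : 0 < b) (hf : MonotoneOn f (forwardInterval b)) {C : ℝ}
    (h : ∀ t ∈ forwardInterval b, f t ≤ C) : ∃ l, Tendsto f (upperEnd b) (𝓝 l) := by
  have hne : (f '' forwardInterval b).Nonempty := ⟨f 0, 0, ⟨le_rfl, by simpa using hb⟩, rfl⟩
  have hbd : BddAbove (f '' forwardInterval b) := ⟨C, by rintro _ ⟨t, ht, rfl⟩; exact h t ht⟩
  refine ⟨sSup (f '' forwardInterval b), tendsto_order.mpr ⟨fun c hc => ?_, fun c hc => ?_⟩⟩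
  · obtain ⟨_, ⟨t₀, ht₀, rfl⟩, hlt⟩ := exists_lt_of_lt_csSup hne hc
    filter_upwards [eventually_upperEnd ht₀.2] with t ht
    exact hlt.trans_le (hf ht₀ ⟨ht₀.1.trans ht.1.le, ht.2⟩ ht.1.le)
  · have h0 : ((0 : ℝ) : EReal) < b := by simpa using hb
    filter_upwards [eventually_upperEnd h0] with t ht
    exact (le_csSup hbd (mem_image_of_mem f ⟨ht.1.le, ht.2⟩)).trans_lt hc

end UpperEnd

namespace NullEstimates

/-- A bound on `S` keeps the direction away from the outgoing radial one, where `p / |q|` tends to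
0; so `p` controls the whole velocity. -/
theorem sum_le {r p q L S S' ph ph' C : ℝ} (h : NullEstimates r p q L S S' ph ph') (hp : 0 < p)
    (hS : 1 ≤ S) (hC : S ≤ C) : p + |q| + L ≤ p * (1 + 4 * C) := by
  have h1 := (abs_le.mp h.ratio).2
  have hN : p ^ 2 + L ^ 2 ≤ 2 * C * p ^ 2 := by
    have : S * p ^ 2 ≤ C * p ^ 2 := by gcongr
    nlinarith [sq_nonneg p, sq_nonneg L]
  have hL' : L ≤ 2 * C * p := by
    refine abs_le_of_sq_le_sq' ?_ (by nlinarith) |>.2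
    nlinarith [sq_nonneg p, mul_nonneg (by linarith : 0 ≤ C) (sq_nonneg p),
      mul_nonneg (mul_nonneg (by linarith : 0 ≤ C) (by linarith : 0 ≤ C - 1)) (sq_nonneg p)]
  have hq : p * |q| ≤ p * (2 * C * p) := by
    have h2 := abs_le.mp h.null
    have h3 : |p * q| ≤ p * (2 * C * p) := abs_le.mpr ⟨by nlinarith [sq_nonneg L, sq_nonneg p],
      by nlinarith [sq_nonneg L, sq_nonneg p]⟩
    rwa [abs_mul, abs_of_pos hp] at h3
  have := le_of_mul_le_mul_left hq hp
  linarith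

end NullEstimates

variable {M : Type*} [TopologicalSpace M] [ChartedSpace E4 M] [IsManifold 𝓘(ℝ, E4) 3 M]
  {X : Spacetime M} {B : BondiChart X}

namespace BondiChart

theorem continuousOn_momentum :
    ContinuousOn (fun p : E4 × E4 => B.momentum p.1 p.2) {p | B.R₀ < ‖p.1.2‖} := by
  have hG : ContinuousOn (fun p : E4 × E4 => coordMetric X.metric B.chart p.1)
      {p | B.R₀ < ‖p.1.2‖} := fun p hp =>
    ((Spacetime.differentiableAt_coordMetric (X := X) B.chart_mem
      (B.mem_target p.1.1 p.1.2 hp)).continuousAt.comp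
        (f := Prod.fst) continuousAt_fst).continuousWithinAt
  unfold momentum spatialDual coordForm
  refine continuousOn_finsetSum _ fun i _ => ContinuousOn.fun_smul ?_ continuousOn_const
  exact (hG.clm_apply continuousOn_snd).clm_apply continuousOn_const

theorem continuousOn_radialMomentum :
    ContinuousOn (fun p : E4 × E4 => B.radialMomentum p.1 p.2) {p | B.R₀ < ‖p.1.2‖} := by
  unfold radialMomentum
  refine (continuousOn_momentum.inner ?_).neg
  intro p hp
  have h1 : ContinuousAt (fun z : E4 => dir z.2) p.1 :=
    (hasFDerivAt_dir_snd (B.snd_ne_zero hp)).continuousAt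
  exact (h1.comp (f := Prod.fst) continuousAt_fst).continuousWithinAt

variable (B) in
/-- The positions and velocities for which the estimates for escaping geodesics apply. -/
def escapeRegion (R : ℝ) : Set (E4 × E4) :=
  {p | R < ‖p.1.2‖ ∧ 0 < p.2.1 ∧
    8 / 5 * B.radialMomentum p.1 p.2 ^ 2 < ‖B.momentum p.1 p.2‖ ^ 2}

/-- The condition on the ratio is written without division, so continuity of the momenta is enough.
-/
theorem isOpen_escapeRegion {R : ℝ} (hR : B.R₀ ≤ R) : IsOpen (B.escapeRegion R) := by
  have ho : IsOpen {p : E4 × E4 | R < ‖p.1.2‖ ∧ 0 < p.2.1} :=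
    (isOpen_lt (continuous_const (y := R)) continuous_fst.snd.norm).inter
      (isOpen_lt (continuous_const (y := (0 : ℝ))) continuous_snd.fst)
  have hsub : {p : E4 × E4 | R < ‖p.1.2‖ ∧ 0 < p.2.1} ⊆ {p | B.R₀ < ‖p.1.2‖} :=
    fun p hp => hR.trans_lt hp.1
  have hc : ContinuousOn (fun p : E4 × E4 => ‖B.momentum p.1 p.2‖ ^ 2
      - 8 / 5 * B.radialMomentum p.1 p.2 ^ 2) {p : E4 × E4 | R < ‖p.1.2‖ ∧ 0 < p.2.1} :=
    ((continuousOn_momentum.norm.pow 2).sub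
      (continuousOn_const.mul (continuousOn_radialMomentum.pow 2))).mono hsub
  have h := hc.isOpen_inter_preimage ho isOpen_Ioi (t := Ioi 0)
  convert h using 1
  ext p
  simp only [escapeRegion, mem_ofPred_eq, mem_inter_iff, mem_preimage, mem_Ioi, sub_pos, and_assoc]

variable (B) in
/-- A null geodesic in Bondi coordinates, inside the region where the estimates apply. -/
structure IsTrajectory (R : ℝ) (a : ℝ) (b : EReal) (z k : ℝ → E4) : Prop where
  neg : a < 0
  pos : 0 < b
  mem : ∀ t ∈ paramInterval a b, (z t, k t) ∈ B.escapeRegion R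
  hasDerivAt_position : ∀ t ∈ paramInterval a b, HasDerivAt z (k t) t
  hasDerivAt_velocity : ∀ t ∈ paramInterval a b,
    HasDerivAt k (geodesicAcceleration (coordMetric X.metric B.chart (z t))
      (fderiv ℝ (coordMetric X.metric B.chart) (z t)) (k t)) t
  null : ∀ t ∈ paramInterval a b, B.coordForm (z t) (k t) (k t) = 0

theorem exists_isTrajectory {R : ℝ} (hR : B.R₀ ≤ R) {z₀ k₀ : E4}
    (h₀ : (z₀, k₀) ∈ B.escapeRegion R) (hnull : B.coordForm z₀ k₀ k₀ = 0) :
    ∃ (a : ℝ) (b : EReal) (z k : ℝ → E4), z 0 = z₀ ∧ k 0 = k₀ ∧ B.IsTrajectory R a b z k ∧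
      ∀ K ⊆ B.escapeRegion R, IsCompact K →
        (∀ t ∈ forwardInterval b, (z t, k t) ∈ K) → b = ⊤ := by
  have hsub : B.escapeRegion R ⊆ B.chart.target ×ˢ univ := fun p hp =>
    ⟨B.mem_target p.1.1 p.1.2 (hR.trans_lt hp.1), mem_univ _⟩
  obtain ⟨a, b, z, k, ha, hb, hz0, hk0, hsol, hmax⟩ :=
    X.exists_maximal_geodesic B.chart_mem (isOpen_escapeRegion hR) hsub h₀
  refine ⟨a, b, z, k, hz0, hk0, ⟨ha, hb, fun t ht => (hsol t ht).1, fun t ht => (hsol t ht).2.1,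
    fun t ht => (hsol t ht).2.2, fun t ht => ?_⟩, fun K hKU hK hC =>
      hmax K hKU hK fun t ht htb => hC t ⟨ht, htb⟩⟩
  have h0 : (0 : ℝ) ∈ paramInterval a b := ⟨ha, by simpa using hb⟩
  have hd : ∀ s ∈ paramInterval a b, HasDerivAt (fun s => B.coordForm (z s) (k s) (k s)) 0 s :=
    fun s hs => Spacetime.hasDerivAt_coordMetric_self B.chart_mem (hsub (hsol s hs).1).1
      (hsol s hs).2.1 (hsol s hs).2.2
  have hc := (convex_paramInterval a b).is_const_of_fderivWithin_eq_zero (𝕜 := ℝ)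
    (fun s hs => (hd s hs).differentiableAt.differentiableWithinAt) (fun s hs => by
      rw [fderivWithin_of_isOpen (isOpen_paramInterval a b) hs, (hd s hs).hasFDerivAt.fderiv]
      simp) ht h0
  rw [hc, hz0, hk0, hnull]

namespace IsTrajectory

variable {R a : ℝ} {b : EReal} {z k : ℝ → E4} (h : B.IsTrajectory R a b z k)
  (hR : ∀ z : E4, R < ‖z.2‖ → B.IsNearFlat (1 / 10000) z)
include h

theorem mem_of_forward {t : ℝ} (ht : t ∈ forwardInterval b) : t ∈ paramInterval a b :=
  ⟨h.neg.trans_le ht.1, ht.2⟩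

theorem zero_mem : (0 : ℝ) ∈ forwardInterval b := ⟨le_rfl, by simpa using h.pos⟩

include hR

theorem nearFlat {t : ℝ} (ht : t ∈ forwardInterval b) : B.IsNearFlat (1 / 10000) (z t) :=
  hR _ (h.mem t (h.mem_of_forward ht)).1

theorem estimates {t : ℝ} (ht : t ∈ forwardInterval b) :
    NullEstimates ‖(z t).2‖ (k t).1 (inner ℝ (dir (z t).2) (k t).2) ‖tang (z t).2 (k t).2‖
      (B.momentumRatio (z t) (k t)) (B.momentumRatioDeriv (z t) (k t))
      (B.radialMomentum (z t) (k t)) (B.radialMomentumDeriv (z t) (k t)) :=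
  (h.nearFlat hR ht).nullEstimates (h.mem t (h.mem_of_forward ht)).2.1
    (h.null t (h.mem_of_forward ht))

theorem radialMomentum_pos {t : ℝ} (ht : t ∈ forwardInterval b) :
    0 < B.radialMomentum (z t) (k t) :=
  (h.estimates hR ht).ph_pos (h.mem t (h.mem_of_forward ht)).2.1

theorem ratio_ge {t : ℝ} (ht : t ∈ forwardInterval b) :
    8 / 5 ≤ B.momentumRatio (z t) (k t) := by
  have h1 := h.radialMomentum_pos hR ht
  rw [momentumRatio, le_div_iff₀ (by positivity)]
  exact (h.mem t (h.mem_of_forward ht)).2.2.le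

theorem hasDerivAt_ratio {t : ℝ} (ht : t ∈ forwardInterval b) :
    HasDerivAt (fun s => B.momentumRatio (z s) (k s)) (B.momentumRatioDeriv (z t) (k t)) t :=
  hasDerivAt_momentumRatio (h.nearFlat hR ht) (h.hasDerivAt_position t (h.mem_of_forward ht))
    (h.hasDerivAt_velocity t (h.mem_of_forward ht)) (h.radialMomentum_pos hR ht).ne'

theorem hasDerivAt_radial {t : ℝ} (ht : t ∈ forwardInterval b) :
    HasDerivAt (fun s => B.radialMomentum (z s) (k s)) (B.radialMomentumDeriv (z t) (k t)) t :=
  hasDerivAt_radialMomentum (h.nearFlat hR ht) (h.hasDerivAt_position t (h.mem_of_forward ht))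
    (h.hasDerivAt_velocity t (h.mem_of_forward ht))

theorem hasDerivAt_r {t : ℝ} (ht : t ∈ forwardInterval b) :
    HasDerivAt (fun s => ‖(z s).2‖) (inner ℝ (dir (z t).2) (k t).2) t :=
  hasDerivAt_norm_snd (h.nearFlat hR ht) (h.hasDerivAt_position t (h.mem_of_forward ht))

omit hR in
theorem hasDerivAt_u {t : ℝ} (ht : t ∈ forwardInterval b) :
    HasDerivAt (fun s => (z s).1) (k t).1 t :=
  (h.hasDerivAt_position t (h.mem_of_forward ht)).fst

theorem r_pos {t : ℝ} (ht : t ∈ forwardInterval b) : 0 < ‖(z t).2‖ := (h.nearFlat hR ht).norm_pos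

omit hR in
theorem p_pos {t : ℝ} (ht : t ∈ forwardInterval b) : 0 < (k t).1 :=
  (h.mem t (h.mem_of_forward ht)).2.1

omit hR in
theorem monotoneOn_u : MonotoneOn (fun t => (z t).1) (forwardInterval b) :=
  monotoneOn_of_hasDerivAt (convex_forwardInterval b) (fun _ ht => h.hasDerivAt_u ht)
    fun _ ht => (h.p_pos ht).le

theorem monotoneOn_ratio :
    MonotoneOn (fun t => B.momentumRatio (z t) (k t)) (forwardInterval b) :=
  monotoneOn_of_hasDerivAt (convex_forwardInterval b) (fun _ ht => h.hasDerivAt_ratio hR ht)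
    fun _ ht => (h.estimates hR ht).S'_nonneg (h.r_pos hR ht) (h.p_pos ht) (h.ratio_ge hR ht)

theorem radialMomentum_le {t : ℝ} (ht : t ∈ forwardInterval b) :
    B.radialMomentum (z t) (k t) ≤ B.radialMomentum (z 0) (k 0) := by
  have := monotoneOn_of_hasDerivAt (convex_forwardInterval b)
    (fun _ ht => (h.hasDerivAt_radial hR ht).fun_neg) fun _ ht => neg_nonneg.mpr
      ((h.estimates hR ht).ph'_nonpos (h.r_pos hR ht) (h.p_pos ht) (h.ratio_ge hR ht))
  have := this h.zero_mem ht ht.1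
  simp only at this
  linarith

theorem le_radialMomentum_mul_sq {t : ℝ} (ht : t ∈ forwardInterval b) :
    B.radialMomentum (z 0) (k 0) * B.momentumRatio (z 0) (k 0) ^ 2
      ≤ B.radialMomentum (z t) (k t) * B.momentumRatio (z t) (k t) ^ 2 := by
  refine monotoneOn_of_hasDerivAt (convex_forwardInterval b)
    (fun _ ht => (h.hasDerivAt_radial hR ht).fun_mul ((h.hasDerivAt_ratio hR ht).fun_pow 2))
    (fun t ht => ?_) h.zero_mem ht ht.1
  have := (h.estimates hR ht).ph_mul_S_sq (h.r_pos hR ht) (h.p_pos ht) (h.ratio_ge hR ht)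
  refine this.trans (le_of_eq ?_)
  push_cast
  ring

theorem u_add_le {t : ℝ} (ht : t ∈ forwardInterval b) :
    (z t).1 + 4 * (‖(z t).2‖ / B.momentumRatio (z t) (k t))
      ≤ (z 0).1 + 4 * (‖(z 0).2‖ / B.momentumRatio (z 0) (k 0)) := by
  have hd := fun t ht => ((h.hasDerivAt_u ht).fun_add (((h.hasDerivAt_r hR ht).fun_div
    (h.hasDerivAt_ratio hR ht)
      (by have := h.ratio_ge hR ht; linarith)).const_mul 4)).fun_neg (x := t)
  have := monotoneOn_of_hasDerivAt (convex_forwardInterval b) hd (fun t ht => neg_nonneg.mpr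
    ((h.estimates hR ht).u_add_nonpos (h.p_pos ht) (h.ratio_ge hR ht))) h.zero_mem ht ht.1
  simp only at this
  linarith

theorem log_r_ge {t : ℝ} (ht : t ∈ forwardInterval b) :
    Real.log ‖(z 0).2‖ - 2 / B.momentumRatio (z 0) (k 0)
        - 1 / 16 * Real.log (B.momentumRatio (z 0) (k 0))
      ≤ Real.log ‖(z t).2‖ - 2 / B.momentumRatio (z t) (k t)
        - 1 / 16 * Real.log (B.momentumRatio (z t) (k t)) := by
  have hS : ∀ t ∈ forwardInterval b, B.momentumRatio (z t) (k t) ≠ 0 := fun t ht => by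
    have := h.ratio_ge hR ht; linarith
  refine monotoneOn_of_hasDerivAt (convex_forwardInterval b)
    (fun t ht => (((h.hasDerivAt_r hR ht).log (h.r_pos hR ht).ne').fun_sub
      ((hasDerivAt_const t (2 : ℝ)).fun_div (h.hasDerivAt_ratio hR ht) (hS t ht))).fun_sub
      (((h.hasDerivAt_ratio hR ht).log (hS t ht)).const_mul (1 / 16)))
    (fun t ht => ?_) h.zero_mem ht ht.1
  have := (h.estimates hR ht).log_r_nonneg (h.r_pos hR ht) (h.p_pos ht) (h.ratio_ge hR ht)
  refine this.trans (le_of_eq ?_)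
  ring

theorem u_le {t : ℝ} (ht : t ∈ forwardInterval b) :
    (z t).1 ≤ (z 0).1 + 4 * (‖(z 0).2‖ / B.momentumRatio (z 0) (k 0)) := by
  have h1 := h.u_add_le hR ht
  have h2 := h.ratio_ge hR ht
  have h3 : 0 ≤ ‖(z t).2‖ / B.momentumRatio (z t) (k t) := by positivity
  linarith

/-- In the logarithmic monotone quantity `log S` only grows, and the initial value of `2/S` is at
most 2. This bounds any inward excursion. -/
theorem r_ge {t : ℝ} (ht : t ∈ forwardInterval b) : ‖(z 0).2‖ * Real.exp (-2) ≤ ‖(z t).2‖ := by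
  have h1 := h.log_r_ge hR ht
  have h2 := h.ratio_ge hR h.zero_mem
  have h3 := h.ratio_ge hR ht
  have h4 := h.monotoneOn_ratio hR h.zero_mem ht ht.1
  have h5 : Real.log (B.momentumRatio (z 0) (k 0)) ≤ Real.log (B.momentumRatio (z t) (k t)) :=
    Real.log_le_log (by linarith) h4
  have h6 : 2 / B.momentumRatio (z 0) (k 0) ≤ 2 := by
    rw [div_le_iff₀ (by linarith)]; linarith
  have h7 : 0 ≤ 2 / B.momentumRatio (z t) (k t) := by positivity
  have h8 := h.r_pos hR h.zero_mem
  rw [← Real.log_le_log_iff (by positivity) (h.r_pos hR ht),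
    Real.log_mul h8.ne' (Real.exp_pos _).ne', Real.log_exp]
  linarith

/-- Since `u` does not decrease and `u + 4r/S` does not increase, `r/S` does not increase. -/
theorem r_le {C : ℝ} {t : ℝ} (ht : t ∈ forwardInterval b)
    (hC : B.momentumRatio (z t) (k t) ≤ C) :
    ‖(z t).2‖ ≤ ‖(z 0).2‖ / B.momentumRatio (z 0) (k 0) * C := by
  have h1 := h.u_add_le hR ht
  have h2 := h.monotoneOn_u h.zero_mem ht ht.1
  have h3 := h.ratio_ge hR ht
  simp only at h2
  have h4 : ‖(z t).2‖ / B.momentumRatio (z t) (k t)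
      ≤ ‖(z 0).2‖ / B.momentumRatio (z 0) (k 0) := by linarith
  rw [div_le_iff₀ (by linarith)] at h4
  have h5 := h.ratio_ge hR h.zero_mem
  refine h4.trans ?_
  gcongr

/-- Monotonicity of `-π_r S²` bounds `-π_r` from below while `S ≤ C`; the factor 2 covers the
passage from `-π_r` to `k^u`. -/
theorem le_p {C : ℝ} {t : ℝ} (ht : t ∈ forwardInterval b)
    (hC : B.momentumRatio (z t) (k t) ≤ C) :
    B.radialMomentum (z 0) (k 0) * B.momentumRatio (z 0) (k 0) ^ 2 / (2 * C ^ 2) ≤ (k t).1 := by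
  have h1 := h.le_radialMomentum_mul_sq hR ht
  have h2 := h.ratio_ge hR ht
  have h3 := h.radialMomentum_pos hR ht
  have h4 : B.radialMomentum (z t) (k t) * B.momentumRatio (z t) (k t) ^ 2
      ≤ B.radialMomentum (z t) (k t) * C ^ 2 := by gcongr
  have h5 := (abs_le.mp (h.estimates hR ht).ph_near).2
  have hp := h.p_pos ht
  have h6 : B.radialMomentum (z t) (k t) * C ^ 2 ≤ 2 * (k t).1 * C ^ 2 := by
    gcongr
    linarith
  rw [div_le_iff₀ (by nlinarith)]
  linarith

theorem norm_velocity_le {C : ℝ} {t : ℝ} (ht : t ∈ forwardInterval b)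
    (hC : B.momentumRatio (z t) (k t) ≤ C) :
    ‖k t‖ ≤ 2 * B.radialMomentum (z 0) (k 0) * (1 + 4 * C) := by
  have h2 := h.ratio_ge hR ht
  have h5 := (abs_le.mp (h.estimates hR ht).ph_near).1
  have h6 := h.radialMomentum_le hR ht
  refine ((h.nearFlat hR ht).norm_vector_le (h.p_pos ht).le).trans
    (((h.estimates hR ht).sum_le (h.p_pos ht) (by linarith) hC).trans ?_)
  have hp := h.p_pos ht
  gcongr
  · linarith
  · linarith

/-- If the ratio `|π|² / π_r²` stays bounded, the trajectory stays in a compact set. -/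
theorem exists_compact (hRexp : R < ‖(z 0).2‖ * Real.exp (-2))
    (hS₀ : 19 / 10 ≤ B.momentumRatio (z 0) (k 0)) {C : ℝ}
    (hC : ∀ t ∈ forwardInterval b, B.momentumRatio (z t) (k t) ≤ C) :
    ∃ K ⊆ B.escapeRegion R, IsCompact K ∧ ∃ c > 0, ∀ t ∈ forwardInterval b,
      (z t, k t) ∈ K ∧ c ≤ (k t).1 := by
  set c := B.radialMomentum (z 0) (k 0) * B.momentumRatio (z 0) (k 0) ^ 2 / (2 * C ^ 2) with hc
  have hc0 : 0 < c := by
    have h1 := h.radialMomentum_pos hR h.zero_mem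
    have h2 := hC 0 h.zero_mem
    have h3 : 0 < B.momentumRatio (z 0) (k 0) := by linarith
    have h4 : 0 < C := by linarith
    positivity
  set V := 2 * B.radialMomentum (z 0) (k 0) * (1 + 4 * C)
  set r₁ := ‖(z 0).2‖ / B.momentumRatio (z 0) (k 0) * C
  set u₁ := (z 0).1 + 4 * (‖(z 0).2‖ / B.momentumRatio (z 0) (k 0))
  set Q : Set (E4 × E4) := ((Icc (z 0).1 u₁ ×ˢ Metric.closedBall 0 r₁) ×ˢ Metric.closedBall 0 V)
    ∩ {p | ‖(z 0).2‖ * Real.exp (-2) ≤ ‖p.1.2‖ ∧ c ≤ p.2.1} with hQdef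
  have hQ : IsCompact Q :=
    ((isCompact_Icc.prod (isCompact_closedBall _ _)).prod (isCompact_closedBall _ _)).inter_right
      ((isClosed_le (continuous_const (y := ‖(z 0).2‖ * Real.exp (-2)))
        continuous_fst.snd.norm).inter (isClosed_le (continuous_const (y := c)) continuous_snd.fst))
  have hQR : ∀ p ∈ Q, R < ‖p.1.2‖ := fun p hp => hRexp.trans_le hp.2.1
  have hcont : ContinuousOn (fun p : E4 × E4 => ‖B.momentum p.1 p.2‖ ^ 2
      - 19 / 10 * B.radialMomentum p.1 p.2 ^ 2) Q :=
    ((continuousOn_momentum.norm.pow 2).sub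
      (continuousOn_const.mul (continuousOn_radialMomentum.pow 2))).mono
        fun p hp => (hR p.1 (hQR p hp)).mem
  -- The closed condition `S ≥ 19/10`, preserved by monotonicity, fits inside the open condition `S
  -- > 8/5` that defines the escape region.
  refine ⟨Q ∩ (fun p : E4 × E4 => ‖B.momentum p.1 p.2‖ ^ 2
      - 19 / 10 * B.radialMomentum p.1 p.2 ^ 2) ⁻¹' Ici 0, fun p hp => ?_,
    hQ.of_isClosed_subset (hcont.preimage_isClosed_of_isClosed hQ.isClosed isClosed_Ici)
      inter_subset_left, c, hc0, fun t ht => ⟨⟨⟨⟨⟨⟨h.monotoneOn_u h.zero_mem ht ht.1,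
        h.u_le hR ht⟩, ?_⟩, ?_⟩, h.r_ge hR ht, h.le_p hR ht (hC t ht)⟩, ?_⟩,
        h.le_p hR ht (hC t ht)⟩⟩
  · have h1 : c ≤ p.2.1 := hp.1.2.2
    have h2 := (abs_le.mp ((hR p.1 (hQR p hp.1)).abs_radialMomentum_sub_le (hc0.le.trans h1))).1
    have h3 : 0 < B.radialMomentum p.1 p.2 := by linarith
    have h4 : 0 ≤ ‖B.momentum p.1 p.2‖ ^ 2 - 19 / 10 * B.radialMomentum p.1 p.2 ^ 2 := hp.2
    have h5 : 0 < B.radialMomentum p.1 p.2 ^ 2 := by positivity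
    exact ⟨hQR p hp.1, hc0.trans_le h1, by linarith⟩
  · simpa using h.r_le hR ht (hC t ht)
  · simpa using h.norm_velocity_le hR ht (hC t ht)
  · have h1 := hS₀.trans (h.monotoneOn_ratio hR h.zero_mem ht ht.1)
    have h2 := h.radialMomentum_pos hR ht
    simp only [momentumRatio] at h1
    rw [le_div_iff₀ (by positivity)] at h1
    exact sub_nonneg.mpr h1

theorem tendsto_ratio (hRexp : R < ‖(z 0).2‖ * Real.exp (-2))
    (hS₀ : 19 / 10 ≤ B.momentumRatio (z 0) (k 0))
    (hmax : ∀ K ⊆ B.escapeRegion R, IsCompact K →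
        (∀ t ∈ forwardInterval b, (z t, k t) ∈ K) → b = ⊤) :
    Tendsto (fun t => B.momentumRatio (z t) (k t)) (upperEnd b) atTop := by
  refine tendsto_atTop_of_monotoneOn (h.monotoneOn_ratio hR) ?_
  by_contra! hbdd
  obtain ⟨C, hC⟩ := hbdd
  obtain ⟨K, hKU, hK, c, hc, hmem⟩ := h.exists_compact hR hRexp hS₀ (fun t ht => (hC t ht).le)
  have hb := hmax K hKU hK fun t ht => (hmem t ht).1
  have hd : ∀ t ∈ forwardInterval b, HasDerivAt (fun t => (z t).1 - c * t) ((k t).1 - c * 1) t :=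
    fun t ht => (h.hasDerivAt_u ht).fun_sub ((hasDerivAt_id t).const_mul c)
  have hmono := monotoneOn_of_hasDerivAt (convex_forwardInterval b) hd fun t ht => by
    have := (hmem t ht).2
    linarith
  -- By this time `u`, growing at rate at least `c`, has exceeded its upper bound by 1.
  set T := (4 * (‖(z 0).2‖ / B.momentumRatio (z 0) (k 0)) + 1) / c with hT
  have hT0 : 0 ≤ T := by positivity
  have hTb : T ∈ forwardInterval b := ⟨hT0, by rw [hb]; exact EReal.coe_lt_top T⟩
  have h1 := hmono h.zero_mem hTb hT0
  have h2 := h.u_le hR hTb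
  have h3 : c * T = 4 * (‖(z 0).2‖ / B.momentumRatio (z 0) (k 0)) + 1 := by
    rw [hT]; field_simp
  simp only at h1
  linarith

/-- The logarithmic quantity gives `log r ≥ const + (log S)/16`. -/
theorem tendsto_r (hratio : Tendsto (fun t => B.momentumRatio (z t) (k t)) (upperEnd b) atTop) :
    Tendsto (fun t => ‖(z t).2‖) (upperEnd b) atTop := by
  have h1 : Tendsto (fun t => Real.log ‖(z 0).2‖ - 2 / B.momentumRatio (z 0) (k 0)
        - 1 / 16 * Real.log (B.momentumRatio (z 0) (k 0))
        + 1 / 16 * Real.log (B.momentumRatio (z t) (k t))) (upperEnd b) atTop :=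
    tendsto_atTop_add_const_left _ _
      ((Real.tendsto_log_atTop.comp hratio).const_mul_atTop (by norm_num))
  have h0 : ((0 : ℝ) : EReal) < b := by simpa using h.pos
  have h2 : Tendsto (fun t => Real.log ‖(z t).2‖) (upperEnd b) atTop := by
    refine tendsto_atTop_mono' _ ?_ h1
    filter_upwards [eventually_upperEnd h0] with t ht
    have ht' : t ∈ forwardInterval b := ⟨ht.1.le, ht.2⟩
    have h3 := h.log_r_ge hR ht'
    have h4 := h.ratio_ge hR ht'
    have h5 : 0 ≤ 2 / B.momentumRatio (z t) (k t) := by positivity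
    linarith
  refine (Real.tendsto_exp_atTop.comp h2).congr' ?_
  filter_upwards [eventually_upperEnd h0] with t ht
  exact Real.exp_log (h.r_pos hR ⟨ht.1.le, ht.2⟩)

end IsTrajectory

/-- Null vectors at large radius which are not directed inwards are tangent to null geodesics that
reach future null infinity. -/
theorem exists_escaping_trajectory {R : ℝ} (hR₀ : B.R₀ ≤ R)
    (hR : ∀ z : E4, R < ‖z.2‖ → B.IsNearFlat (1 / 10000) z) {z₀ k₀ : E4}
    (hz₀ : R < ‖z₀.2‖ * Real.exp (-2)) (hk₀ : 0 < k₀.1) (hnull : B.coordForm z₀ k₀ k₀ = 0)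
    (hS₀ : 19 / 10 ≤ B.momentumRatio z₀ k₀) :
    ∃ (a : ℝ) (b : EReal) (z k : ℝ → E4), z 0 = z₀ ∧ k 0 = k₀ ∧ B.IsTrajectory R a b z k ∧
      Tendsto (fun t => ‖(z t).2‖) (upperEnd b) atTop ∧
      ∃ u₁, Tendsto (fun t => (z t).1) (upperEnd b) (𝓝 u₁) := by
  have hz₀' : R < ‖z₀.2‖ := by
    refine hz₀.trans_le (mul_le_of_le_one_right (norm_nonneg _) ?_)
    rw [Real.exp_le_one_iff]; norm_num
  have hflat := hR z₀ hz₀'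
  have hph := (hflat.nullEstimates hk₀ hnull).ph_pos hk₀
  have hmem : (z₀, k₀) ∈ B.escapeRegion R := by
    refine ⟨hz₀', hk₀, ?_⟩
    rw [momentumRatio, le_div_iff₀ (by positivity)] at hS₀
    have : 0 < B.radialMomentum z₀ k₀ ^ 2 := by positivity
    simp only
    linarith
  obtain ⟨a, b, z, k, hz0, hk0, htraj, hmax⟩ := exists_isTrajectory hR₀ hmem hnull
  have hratio := htraj.tendsto_ratio hR (by rwa [hz0]) (by rwa [hz0, hk0]) hmax
  exact ⟨a, b, z, k, hz0, hk0, htraj, htraj.tendsto_r hR hratio,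
    exists_tendsto_of_monotoneOn htraj.pos htraj.monotoneOn_u fun t ht => htraj.u_le hR ht⟩

end BondiChart

end

/-! ### Choice of the null direction, and transfer of trajectories to the manifold. -/

section

variable {M : Type*} [TopologicalSpace M] [ChartedSpace E4 M] [IsManifold 𝓘(ℝ, E4) 3 M]
  {X : Spacetime M} {B : BondiChart X}

namespace BondiChart

/-- Vectors proportional to the metric dual of `d(u + r)` are nearly proportional to `∂_u`. -/
theorem IsNearFlat.abs_radial_le {ε : ℝ} {z τ : E4} (h : B.IsNearFlat ε z) {c : ℝ}
    (hτ : ∀ V, B.coordForm z τ V = c * flatTime z.2 V) (hp : 0 ≤ τ.1) :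
    ‖tang z.2 τ.2‖ ≤ 2 * ε * τ.1 ∧ |inner ℝ (dir z.2) τ.2| ≤ 4 * ε * τ.1 := by
  have hε := h.pos
  have hε' := h.small
  have h1 := h.abs_deviation_spatial_le hp (tang z.2 τ.2)
  have h2 := h.abs_deviation_dir_le hp
  have h3 := h.abs_deviation_dU_le hp
  have e1 := hτ (0, tang z.2 τ.2)
  have e2 := hτ (0, dir z.2)
  have e3 := hτ dU
  rw [B.coordForm_eq, flatMetric_apply, flatTime_apply] at e1 e2 e3
  rw [B.deviation_symm h.mem] at e3
  have hx : inner ℝ (dir z.2) (dir z.2) = (1 : ℝ) := by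
    rw [real_inner_self_eq_norm_sq, norm_dir h.snd_ne]; norm_num
  simp only [inner_dir_tang h.snd_ne, dU, inner_zero_right, hx] at e1 e2 e3
  rw [inner_tang_right h.snd_ne, real_inner_self_eq_norm_sq] at e1
  rw [real_inner_comm (dir z.2) τ.2] at e2
  set L := ‖tang z.2 τ.2‖ with hL
  set q := inner ℝ (dir z.2) τ.2
  set p := τ.1
  have hL0 : 0 ≤ L := norm_nonneg _
  have hLle : L ≤ ε * (p + L) := by
    rcases hL0.eq_or_lt with h0 | h0
    · rw [← h0]; positivity
    have h4 : L * L ≤ ε * (p + L) * L := by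
      have := (abs_le.mp h1).1
      nlinarith
    -- The proportionality, tested on the tangential part itself, gives a factor `L` on both sides.
    exact le_of_mul_le_mul_right h4 h0
  have hL2 : L ≤ 2 * ε * p := by
    have : ε * L ≤ 1 / 2 * L := by gcongr; linarith
    linarith
  refine ⟨hL2, ?_⟩
  have hq : |q| ≤ ε * (p + |q| + L) + ε * p := by
    have h5 := abs_le.mp h2
    have h6 := abs_le.mp h3
    simp only [dU] at h6
    rw [abs_le]
    constructor <;> linarith
  have h7 : ε * |q| ≤ 1 / 10 * |q| := by gcongr; linarith
  have h8 : ε * L ≤ 1 / 10 * (2 * ε * p) := by gcongr; linarith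
  have h9 : 0 ≤ ε * p := by positivity
  linarith

theorem exists_null_of_nonneg {z τ n : E4} (h : B.IsNearFlat (1 / 10000) z) {c : ℝ}
    (hτ : ∀ V, B.coordForm z τ V = c * flatTime z.2 V) (hp : 0 ≤ τ.1)
    (hunit : B.coordForm z τ τ = -1) (hn : B.coordForm z n τ = 0) :
    ∃ k : E4, 0 < k.1 ∧ B.coordForm z k k = 0 ∧ B.coordForm z n k = 0 ∧
      19 / 10 ≤ B.momentumRatio z k := by
  obtain ⟨hL, hq⟩ := h.abs_radial_le hτ hp
  have hp' : 0 < τ.1 := by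
    refine hp.lt_of_ne fun h0 => ?_
    rw [← h0, mul_zero] at hL hq
    have h1 : τ.2 = 0 := norm_le_zero_iff.mp ((h.norm_spatial_le τ.2).trans (by linarith))
    have h2 : τ = 0 := Prod.ext h0.symm h1
    rw [h2, map_zero] at hunit
    simp at hunit
  have hLor : IsLorentzian (B.coordForm z) :=
    Spacetime.isLorentzian_coordMetric B.chart_mem (B.mem_target z.1 z.2 h.mem)
  -- Two linear conditions on three-dimensional space: tangency to the sphere and orthogonality to
  -- `n`. A nonzero solution exists.
  let φ : E3 →ₗ[ℝ] ℝ × ℝ := (innerSL ℝ (dir z.2) : E3 →L[ℝ] ℝ).toLinearMap.prod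
    ((B.coordForm z n).comp (ContinuousLinearMap.inr ℝ ℝ E3)).toLinearMap
  have hker : LinearMap.ker φ ≠ ⊥ := LinearMap.ker_ne_bot_of_finrank_lt (by simp)
  obtain ⟨η, hη, hη0⟩ := Submodule.exists_mem_ne_zero_of_ne_bot hker
  have hη1 : inner ℝ (dir z.2) η = 0 := congrArg Prod.fst (LinearMap.mem_ker.mp hη)
  have hη2 : B.coordForm z n (0, η) = 0 := congrArg Prod.snd (LinearMap.mem_ker.mp hη)
  have hη3 : B.coordForm z τ (0, η) = 0 := by
    rw [hτ, flatTime_apply]; simp [hη1]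
  have hη4 : 0 < B.coordForm z (0, η) (0, η) :=
    hLor.pos_of_orthogonal (by rw [hunit]; norm_num) hη3 fun h0 => hη0 (congrArg Prod.snd h0)
  set s := (√(B.coordForm z (0, η) (0, η)))⁻¹ with hs
  have hs2 : s * s * B.coordForm z (0, η) (0, η) = 1 := by
    have := Real.mul_self_sqrt hη4.le
    have h0 : √(B.coordForm z (0, η) (0, η)) ≠ 0 := (Real.sqrt_pos.mpr hη4).ne'
    rw [hs]
    field_simp
    rw [sq, this]
  set k := τ + s • ((0, η) : E4) with hk
  have hk1 : k.1 = τ.1 := by simp [hk]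
  have hkq : inner ℝ (dir z.2) k.2 = inner ℝ (dir z.2) τ.2 := by
    simp [hk, inner_add_right, real_inner_smul_right, hη1]
  have hnull : B.coordForm z k k = 0 := by
    simp only [hk, map_add, map_smul, add_apply, smul_apply, smul_eq_mul, hη3, hunit,
      B.coordForm_symm h.mem (0, η) τ]
    linarith
  have hkp : 0 < k.1 := by rwa [hk1]
  refine ⟨k, hkp, hnull, by rw [hk, map_add, map_smul, hn, hη2, smul_zero, add_zero], ?_⟩
  have hest := h.nullEstimates hkp hnull
  have h1 := (abs_le.mp hest.null).2
  have h2 := (abs_le.mp hest.ratio).2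
  rw [hkq] at h1
  rw [hk1] at h1 h2
  have h3 := abs_le.mp hq
  have h4 : 0 < τ.1 ^ 2 := by positivity
  -- The radial component is negligible, so `L² ≈ p²` by the null relation, and `S ≈ 2`.
  have h6 : -(2 * τ.1 * (4 * (1 / 10000) * τ.1)) ≤ 2 * τ.1 * inner ℝ (dir z.2) τ.2 := by
    nlinarith [h3.1]
  have h7 : 19 / 10 * τ.1 ^ 2 ≤ B.momentumRatio z k * τ.1 ^ 2 := by nlinarith
  exact le_of_mul_le_mul_right h7 h4

/-- Orthogonally to any vector `n` that is orthogonal to the dual `τ` of `d(u + r)`, there are null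
vectors which are tangent to escaping geodesics. -/
theorem exists_null {z τ n : E4} (h : B.IsNearFlat (1 / 10000) z) {c : ℝ}
    (hτ : ∀ V, B.coordForm z τ V = c * flatTime z.2 V)
    (hunit : B.coordForm z τ τ = -1) (hn : B.coordForm z n τ = 0) :
    ∃ k : E4, 0 < k.1 ∧ B.coordForm z k k = 0 ∧ B.coordForm z n k = 0 ∧
      19 / 10 ≤ B.momentumRatio z k := by
  -- `T` may point to the past; `-τ` is dual to `d(u + r)` up to a factor as well, and gives a
  -- vector with `k^u > 0`.
  rcases le_total 0 τ.1 with hp | hp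
  · exact exists_null_of_nonneg h hτ hp hunit hn
  · refine exists_null_of_nonneg h (τ := -τ) (c := -c) (fun V => ?_) ?_ ?_ ?_
    · rw [map_neg, neg_apply, hτ]; ring
    · simpa using hp
    · simpa using hunit
    · simpa using hn

theorem dUR_coordFrame {z : E4} (hz : B.R₀ < ‖z.2‖) (V : E4) :
    B.dUR (B.chart.symm z) (coordFrame B.chart z V) = flatTime z.2 V := by
  have hzt : z ∈ B.chart.target := B.mem_target z.1 z.2 hz
  have h1 : HasFDerivAt (fun w : E4 => w.1 + ‖w.2‖) (flatTime z.2) z := by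
    have := (hasFDerivAt_fst (𝕜 := ℝ) (p := z)).add (hasFDerivAt_norm_snd (B.snd_ne_zero hz))
    exact this
  have h2 := ((mdifferentiable_of_mem_maximalAtlas B.chart_mem).mdifferentiableAt
    (B.chart.map_target hzt)).hasMFDerivAt
  have h3 : HasMFDerivAt 𝓘(ℝ, E4) 𝓘(ℝ, ℝ) (fun w : E4 => w.1 + ‖w.2‖)
      (B.chart (B.chart.symm z)) (flatTime z.2) := by
    rw [B.chart.right_inv hzt]; exact h1.hasMFDerivAt
  have h4 : HasMFDerivAt 𝓘(ℝ, E4) 𝓘(ℝ, ℝ) (fun q => B.u q + B.r q) (B.chart.symm z)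
      ((flatTime z.2).comp (coordCoframe B.chart z)) := HasMFDerivAt.comp _ h3 h2
  unfold dUR
  rw [h4.mfderiv]
  exact congrArg (flatTime z.2) (coordCoframe_coordFrame B.chart_mem hzt V)

theorem symm_mem_region {R : ℝ} (hR₀ : B.R₀ ≤ R) {z : E4} (hz : R < ‖z.2‖) :
    B.chart.symm z ∈ B.region R := by
  have hzt : z ∈ B.chart.target := B.mem_target z.1 z.2 (hR₀.trans_lt hz)
  have hr : B.r (B.chart.symm z) = ‖z.2‖ := by rw [r, B.chart.right_inv hzt]
  exact ⟨B.chart.map_target hzt, by rw [hr]; exact hR₀.trans_lt hz, by rwa [hr]⟩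

theorem region_mono {R R' : ℝ} (h : R ≤ R') : B.region R' ⊆ B.region R :=
  fun _ hp => ⟨hp.1, hp.2.1, h.trans_lt hp.2.2⟩

theorem isOpen_region (R : ℝ) : IsOpen (B.region R) := by
  have h := B.chart.isOpen_inter_preimage
    (isOpen_lt (continuous_const (y := max B.R₀ R)) (continuous_snd (X := ℝ) (Y := E3)).norm)
  convert h using 1
  ext p
  simp [region, r]
  tauto

/-- Null vectors at large radius which are not directed inwards are tangent to future directed null
geodesics that reach future null infinity. -/
theorem exists_escaping_geodesic {R : ℝ} (hR₀ : B.R₀ ≤ R)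
    (hR : ∀ z : E4, R < ‖z.2‖ → B.IsNearFlat (1 / 10000) z)
    (hfut : ∀ z : E4, R < ‖z.2‖ → metricAt X.metric (B.chart.symm z)
      (X.timeOrientation (B.chart.symm z)) (coordFrame B.chart z dU) < 0) {z₀ k₀ : E4}
    (hz₀ : R < ‖z₀.2‖ * Real.exp (-2)) (hk₀ : 0 < k₀.1) (hnull : B.coordForm z₀ k₀ k₀ = 0)
    (hS₀ : 19 / 10 ≤ B.momentumRatio z₀ k₀) :
    ∃ (γ : ℝ → M) (a : ℝ) (b : EReal), (0 : ℝ) ∈ paramInterval a b ∧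
      X.IsFutureNullGeodesic γ a b ∧
      (⟨γ 0, velocity γ 0⟩ : TangentBundle 𝓘(ℝ, E4) M)
        = ⟨B.chart.symm z₀, coordFrame B.chart z₀ k₀⟩ ∧ B.Reaches γ b := by
  obtain ⟨a, b, z, k, hz0, hk0, htraj, hr, u₁, hu⟩ :=
    exists_escaping_trajectory hR₀ hR hz₀ hk₀ hnull hS₀
  have hmem : ∀ t ∈ paramInterval a b, R < ‖(z t).2‖ := fun t ht => (htraj.mem t ht).1
  have htar : ∀ t ∈ paramInterval a b, z t ∈ B.chart.target := fun t ht =>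
    B.mem_target (z t).1 (z t).2 (hR₀.trans_lt (hmem t ht))
  have h0 : (0 : ℝ) ∈ paramInterval a b := ⟨htraj.neg, by simpa using htraj.pos⟩
  have hvel : ∀ t ∈ paramInterval a b, velocity (fun s => B.chart.symm (z s)) t
      = coordFrame B.chart (z t) (k t) := fun t ht =>
    Spacetime.velocity_symm_comp B.chart_mem (htar t ht) (htraj.hasDerivAt_position t ht)
  have hev : ∀ᶠ t in upperEnd b, t ∈ paramInterval a b := by
    filter_upwards [eventually_upperEnd h0.2] with t ht
    exact ⟨htraj.neg.trans ht.1, ht.2⟩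
  refine ⟨fun s => B.chart.symm (z s), a, b, h0, fun t ht => ⟨?_, ?_⟩, ?_, ?_, ?_, u₁, ?_⟩
  · have hnhds : ∀ᶠ s in 𝓝 t, s ∈ paramInterval a b := (isOpen_paramInterval a b).mem_nhds ht
    refine Spacetime.isGeodesicNear_symm_comp (k := k) B.chart_mem ?_ ?_ ?_
    · filter_upwards [hnhds] with s hs using htar s hs
    · filter_upwards [hnhds] with s hs using htraj.hasDerivAt_position s hs
    · filter_upwards [hnhds] with s hs using htraj.hasDerivAt_velocity s hs
  · rw [hvel t ht]
    have hflat := hR _ (hmem t ht)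
    have hn := htraj.null t ht
    refine ⟨hn, ?_⟩
    -- The vector `k` lies in the time cone of `∂_u`, and `∂_u` in that of the time orientation.
    exact (X.isLorentzian (B.chart.symm (z t))).neg_of_neg_of_neg
      (X.timeOrientation_timelike _) hflat.coordForm_dU_dU_neg hn.le (hfut _ (hmem t ht))
      (hflat.coordForm_dU_neg (htraj.mem t ht).2.1 hn)
  · have := hvel 0 h0
    rw [hz0, hk0] at this
    refine Bundle.TotalSpace.ext (by simp [hz0]) ?_
    exact heq_of_eq this
  · filter_upwards [hev] with t ht
    exact region_mono hR₀ (symm_mem_region hR₀ (hmem t ht))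
  · refine hr.congr' ?_
    filter_upwards [hev] with t ht
    rw [r, B.chart.right_inv (htar t ht)]
  · refine hu.congr' ?_
    filter_upwards [hev] with t ht
    rw [u, B.chart.right_inv (htar t ht)]

theorem not_mem_innerDarkDomain {T : ∀ p : M, TangentSpace 𝓘(ℝ, E4) p}
    (hT : X.IsUnitTimelike T) {R : ℝ} (hR₀ : B.R₀ ≤ R)
    (hR : ∀ z : E4, R < ‖z.2‖ → B.IsNearFlat (1 / 10000) z)
    (hfut : ∀ z : E4, R < ‖z.2‖ → metricAt X.metric (B.chart.symm z)
      (X.timeOrientation (B.chart.symm z)) (coordFrame B.chart z dU) < 0) {z : E4}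
    (hz : R < ‖z.2‖ * Real.exp (-2))
    (hTz : ∃ c : ℝ, ∀ v, metricAt X.metric (B.chart.symm z) (T (B.chart.symm z)) v
      = c * B.dUR (B.chart.symm z) v) :
    B.chart.symm z ∉ B.innerDarkDomain T := by
  rintro ⟨n, -, hTn, hn⟩
  obtain ⟨c, hc⟩ := hTz
  have hz' : R < ‖z.2‖ := by
    refine hz.trans_le (mul_le_of_le_one_right (norm_nonneg _) ?_)
    rw [Real.exp_le_one_iff]; norm_num
  have hzR := hR₀.trans_lt hz'
  have hzt : z ∈ B.chart.target := B.mem_target z.1 z.2 hzR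
  set τ : E4 := coordCoframe B.chart z (T (B.chart.symm z)) with hτdef
  set ν : E4 := coordCoframe B.chart z n with hνdef
  have hτ : coordFrame B.chart z τ = T (B.chart.symm z) :=
    coordFrame_coordCoframe B.chart_mem hzt _
  have hν : coordFrame B.chart z ν = n := coordFrame_coordCoframe B.chart_mem hzt _
  obtain ⟨k, hk, hnull, hνk, hS⟩ := exists_null (hR z hz') (τ := τ) (n := ν) (c := c)
    (fun V => by
      rw [coordForm, coordMetric_apply, hτ, hc, dUR_coordFrame hzR])
    (by
      rw [coordForm, coordMetric_apply, hτ]; exact hT _)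
    (by
      rw [B.coordForm_symm hzR, coordForm, coordMetric_apply, hτ, hν]; exact hTn)
  obtain ⟨γ, a, b, h0, hγ, heq, hreach⟩ := exists_escaping_geodesic hR₀ hR hfut hz hk hnull hS
  refine hn (coordFrame B.chart z k) ?_ γ a b h0 hγ heq hreach
  rw [coordForm, coordMetric_apply, hν] at hνk
  exact hνk

end BondiChart

end

/-! ### Black holes, and the position of the inner dark domain. -/

section

variable {M : Type*} [TopologicalSpace M] [ChartedSpace E4 M] [IsManifold 𝓘(ℝ, E4) 3 M]
  {X : Spacetime M} {B : BondiChart X}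

/-- The coordinate velocity is differentiable, hence continuous. This makes null geodesics
admissible in the definition of the causal past. -/
theorem Spacetime.IsGeodesicNear.contMDiffAt {γ : ℝ → M} {t : ℝ} (h : X.IsGeodesicNear γ t) :
    ContMDiffAt 𝓘(ℝ, ℝ) 𝓘(ℝ, E4) 1 γ t := by
  obtain ⟨-, e, he, hev⟩ := h
  have h1 : ContDiffAt ℝ 1 (e ∘ γ) t := by
    rw [contDiffAt_one_iff]
    refine ⟨fun s => ContinuousLinearMap.toSpanSingleton ℝ (deriv (e ∘ γ) s), _, hev,
      fun s hs => ?_, fun s hs => hs.2.1.hasDerivAt.hasFDerivAt⟩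
    exact ((ContinuousLinearMap.toSpanSingletonCLE (𝕜 := ℝ) (E := E4)).continuous.continuousAt.comp
      hs.2.2.1.continuousAt).continuousWithinAt
  have h2 : ContMDiffAt 𝓘(ℝ, E4) 𝓘(ℝ, E4) 1 e.symm (e (γ t)) :=
    ((contMDiffOn_symm_of_mem_maximalAtlas he).contMDiffAt
      (e.open_target.mem_nhds (e.map_source hev.self_of_nhds.1))).of_le (by norm_num)
  refine (ContMDiffAt.comp t (g := e.symm) (f := e ∘ γ) h2 h1.contMDiffAt).congr_of_eventuallyEq ?_
  filter_upwards [hev] with s hs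
  exact (e.left_inv hs.1).symm

theorem Spacetime.IsFutureNullGeodesic.isFutureCausalCurve {γ : ℝ → M} {a : ℝ} {b : EReal}
    (h : X.IsFutureNullGeodesic γ a b) : X.IsFutureCausalCurve γ a b :=
  ⟨fun t ht => (h t ht).1.contMDiffAt.contMDiffWithinAt,
    fun t ht => ⟨(h t ht).2.1.le, (h t ht).2.2⟩⟩

theorem IsLorentzian.exists_spacelike {g : E4 →L[ℝ] E4 →L[ℝ] ℝ} (hg : IsLorentzian g) {a : E4}
    (ha : g a a < 0) : ∃ n, 0 < g n n ∧ g a n = 0 := by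
  have hker : LinearMap.ker (g a).toLinearMap ≠ ⊥ := LinearMap.ker_ne_bot_of_finrank_lt (by simp)
  obtain ⟨n, hn, hn0⟩ := Submodule.exists_mem_ne_zero_of_ne_bot hker
  exact ⟨n, hg.pos_of_orthogonal ha hn hn0, hn⟩

namespace BondiChart

/-- The black hole region lies in the inner dark domain of any timelike vector field. -/
theorem blackHole_subset_innerDarkDomain {T : ∀ p : M, TangentSpace 𝓘(ℝ, E4) p}
    (hT : X.IsUnitTimelike T) : B.blackHole ⊆ B.innerDarkDomain T := by
  intro p hp
  obtain ⟨n, hn, hTn⟩ := (X.isLorentzian p).exists_spacelike (a := T p)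
    ((hT p).trans_lt (by norm_num))
  refine ⟨n, hn, hTn, fun k _ γ a b h0 hγ heq hreach => hp ?_⟩
  exact ⟨γ, a, b, h0, congrArg Bundle.TotalSpace.proj heq, hγ.isFutureCausalCurve, hreach⟩

theorem exists_disjoint_region {T : ∀ p : M, TangentSpace 𝓘(ℝ, E4) p}
    (hT : X.IsUnitTimelike T) (hTB : B.IsAdapted T) :
    ∃ R, B.R₀ ≤ R ∧ Disjoint (B.region R) (B.innerDarkDomain T) := by
  obtain ⟨R₁, hR₁, hflat⟩ := B.exists_isNearFlat
  obtain ⟨R₂, hR₂, hfut⟩ := B.future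
  obtain ⟨R₃, hR₃⟩ := hTB
  set R := max R₁ (max R₂ R₃) with hR
  have h1 : R₁ ≤ R := le_max_left _ _
  have h2 : R₂ ≤ R := (le_max_left _ _).trans (le_max_right _ _)
  have h3 : R₃ ≤ R := (le_max_right _ _).trans (le_max_right _ _)
  have h0 : 0 < R := B.R₀_pos.trans_le (hR₁.trans h1)
  have hexp : R ≤ R * Real.exp 2 := le_mul_of_one_le_right h0.le (Real.one_le_exp (by norm_num))
  -- The factor `e²` allows for the inward excursion: the geodesic then remains in `r > R`, where
  -- all estimates hold.
  refine ⟨R * Real.exp 2, (hR₁.trans h1).trans hexp, Set.disjoint_left.mpr fun p hp => ?_⟩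
  have hsymm : B.chart.symm (B.chart p) = p := B.chart.left_inv hp.1
  have hz : R < ‖(B.chart p).2‖ * Real.exp (-2) := by
    rw [Real.exp_neg, ← div_eq_mul_inv, lt_div_iff₀ (Real.exp_pos _)]
    exact hp.2.2
  have hpR : p ∈ B.region R₃ := region_mono (h3.trans hexp) hp
  rw [← hsymm] at hpR ⊢
  exact not_mem_innerDarkDomain hT (hR₁.trans h1) (fun z hz => hflat z (h1.trans_lt hz))
    (fun z hz => hfut z.1 z.2 (h2.trans_lt hz)) hz (hR₃ _ hpR)

theorem region_nonempty {R : ℝ} (hR : B.R₀ ≤ R) : (B.region R).Nonempty := by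
  have h0 : 0 < R := B.R₀_pos.trans_le hR
  refine ⟨B.chart.symm (0, EuclideanSpace.single 0 (R + 1)), symm_mem_region hR ?_⟩
  rw [PiLp.norm_single, Real.norm_eq_abs, abs_of_pos (by linarith)]
  linarith

end BondiChart

end

end DarkHorizon

/-- The hypothesis `hΩ` is not needed: null geodesics emitted tangentially at large radius may move
inwards for a while, but only by a bounded factor of `r`, and then escape. -/
theorem mainTheorem7 {M : Type*} [TopologicalSpace M] [T2Space M] [SecondCountableTopology M]
    [ConnectedSpace M] [ChartedSpace DarkHorizon.E4 M]
    [IsManifold 𝓘(ℝ, DarkHorizon.E4) 3 M]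
    (X : DarkHorizon.Spacetime M) (B : DarkHorizon.BondiChart X)
    (hΩ : 0 < B.OmegaInf)
    (hB : B.blackHole.Nonempty)
    (T : ∀ p : M, TangentSpace 𝓘(ℝ, DarkHorizon.E4) p)
    (hT : X.IsUnitTimelike T) (hTB : B.IsAdapted T) :
    (B.innerDarkHorizon T).Nonempty ∧ ¬ B.ConnectedToScri (B.innerDarkHorizon T) := by
  obtain ⟨R, hR, hdisj⟩ := B.exists_disjoint_region hT hTB
  refine ⟨?_, fun hconn => ?_⟩
  · have hne : (B.innerDarkDomain T).Nonempty :=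
      hB.mono (B.blackHole_subset_innerDarkDomain hT)
    obtain ⟨p, hp⟩ := B.region_nonempty hR
    -- Connectedness of `M` enters here.
    refine nonempty_frontier_iff.mpr ⟨hne, fun huniv => ?_⟩
    exact Set.disjoint_left.mp hdisj hp (huniv ▸ mem_univ p)
  · obtain ⟨p, hp, hpR⟩ := hconn R
    -- An open set disjoint from the IDD is disjoint from its closure, hence from its boundary.
    exact Set.disjoint_left.mp (hdisj.closure_right (B.isOpen_region R)) hpR
      (frontier_subset_closure hp)
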